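/- **Setting.** A game $G=\langle V,\Sigma,\Gamma,E,\iota,F\rangle$ has a finite vertex set $V=V_1\uplus V_2$, finite action sets $\Sigma$ (player $P_1$) and $\Gamma$ (player $P_2$), total transition functions $E_1:V_1\times\Sigma\to V_2$ and $E_2:V_2\times\Gamma\to V_1$, an initial vertex $\iota\in V_1$ and a colouring $F:V\to\mathbb N$. A word $w=a_0b_0a_1b_1\dots\in(\Sigma\Gamma)^\omega$ generates the play $u_0v_0u_1v_1\dots$ with $u_0=\iota$, $v_i=E_1(u_i,a_i)$, $u_{i+1}=E_2(v_i,b_i)$. In a parity game $P_2$ wins the play if the largest colour occurring infinitely often is even; in a Büchi game ($F:V\to\{1,2\}$) if some vertex of colour $2$ occurs infinitely often; in a reachability game ($F:V\to\{1,2\}$) if some vertex of colour $2$ (a final vertex) occurs. A $k$-transducer ($k\ge 1$) has a set $M$ of $k$ states, an initial state $s\in M$, a transition function $\eta:M\times\Gamma\to M$ and a labelling $L:M\to\Sigma$; on input $x\in\Gamma^*$ it outputs $\widehat L(x)=L(\eta(s,x))$. A finite or infinite word $a_0b_0a_1b_1\dots$ agrees with it if $a_i=\widehat L(b_0\cdots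 b_{i-1})$ for all $i\ge 0$. $\mathcal L_k(G)$ is the set of $w\in(\Sigma\Gamma)^\omega$ that agree with some $k$-transducer and generate a play won by $P_2$. $G$ is $k$-transducer live if for every $\alpha\in(\Sigma\Gamma)^*$ that agrees with some $k$-transducer there is $\beta\in(\Sigma\Gamma)^\omega$ with $\alpha\beta\in\mathcal L_k(G)$. A strategy $f:(\Sigma\Gamma)^*\Sigma\to\Gamma$ of $P_2$ is winning (against $k$-transducers) if, for every $k$-transducer $T$, every word that agrees with $T$ and $f$ generates a play won by $P_2$. An online Turing machine is a fixed deterministic machine with finitely many states, a finite alphabet and finitely many work stacks that is used in rounds: in each round it receives a word, computes until it halts, and outputs a word, and it keeps its memory from round to round. It runs the strategy $f$ for $(G,k)$ in space $s$ if it first reads a binary code of $(G,k)$, one bit per round and only once (sizes, initial vertex and transition tables in unary; the colouring as the list of characteristic sequences of $F^{-1}(0),F^{-1}(1),\dots$ up to the largest colour), then receives the actions of $P_1$ one per round and answers each with the action of $P_2$ prescribed by $f$, for arbitrary behaviour of $P_1$, and never stores more than $s$ symbols in total. **Theorem.** For each of the three kinds of games (reachability, Büchi, parity) there are an online Turing machine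 $\mathcal M$ and polynomials $p,q,r$ with natural number coefficients such that the following holds for all $k\ge1$ and every $k$-transducer live game $G$ of this kind, where $n=|V|$. There is a strategy $f$ of $P_2$ such that 1. $f$ is winning for $P_2$ in $G$ against $k$-transducers (so $G$ is winning for $P_2$); 2. $\mathcal M$ runs $f$ for $(G,k)$ in space $p(n+k+|\Sigma|+|\Gamma|)$; in particular, for fixed alphabets, in space polynomial in $n$ and $k$; 3. if $G$ is a reachability game, then every play in which $P_2$ follows $f$ and $P_1$ follows a $k$-transducer visits a final vertex after at most $q(n)\cdot 2^{\,r(k+|\Sigma|+|\Gamma|)}$ moves; in particular, for fixed alphabets, after a number of moves polynomial in $n$ and exponential in $k$. -/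

import Mathlib

/-! ## Games -/

/-- A finite two-player game graph: player 1 moves from `V₁` with actions in `A`, player 2 moves
from `V₂` with actions in `B`; the vertex set is the disjoint union `V₁ ⊕ V₂`. -/
structure Game (V₁ V₂ A B : Type*) where
  E₁ : V₁ → A → V₂
  E₂ : V₂ → B → V₁
  init : V₁
  color : V₁ ⊕ V₂ → ℕ

/-- The three kinds of games. -/
inductive Objective
  | reachability
  | buchi
  | parity

/-- The word formed by the first `i` letters of an infinite word. -/
def wordPrefix {L : Type*} (w : ℕ → L) (i : ℕ) : List L := (List.range i).map w

/-- The concatenation of a finite word and an infinite word. -/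
def wordAppend {L : Type*} (α : List L) (β : ℕ → L) : ℕ → L :=
  fun i => if h : i < α.length then α[i] else β (i - α.length)

namespace Game

variable {V₁ V₂ A B : Type*} (G : Game V₁ V₂ A B)

/-- The player 1 vertices `u₀, u₁, …` of the play generated by `w = a₀b₀a₁b₁…`. -/
def pos (w : ℕ → A × B) : ℕ → V₁
  | 0 => G.init
  | i + 1 => G.E₂ (G.E₁ (pos w i) (w i).1) (w i).2

/-- The `j`-th vertex (counting from `0`) of the play `u₀ v₀ u₁ v₁ …` generated by `w`; it is
reached after `j` moves. -/
def vertex (w : ℕ → A × B) (j : ℕ) : V₁ ⊕ V₂ :=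
  if j % 2 = 0 then Sum.inl (G.pos w (j / 2))
  else Sum.inr (G.E₁ (G.pos w (j / 2)) (w (j / 2)).1)

/-- Reachability and Büchi games have a colouring with values in `{1, 2}`. -/
def HasKind : Objective → Prop
  | .reachability => ∀ v, G.color v = 1 ∨ G.color v = 2
  | .buchi => ∀ v, G.color v = 1 ∨ G.color v = 2
  | .parity => True

/-- The play generated by `w` is winning for player 2. -/
def WinningPlay (o : Objective) (w : ℕ → A × B) : Prop :=
  match o with
  | .reachability => ∃ j, G.color (G.vertex w j) = 2
  | .buchi => ∃ v, G.color v = 2 ∧ ∃ᶠ j in Filter.atTop, G.vertex w j = v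
  | .parity => ∃ d, Even d ∧ (∃ᶠ j in Filter.atTop, G.color (G.vertex w j) = d) ∧
      ∀ d', (∃ᶠ j in Filter.atTop, G.color (G.vertex w j) = d') → d' ≤ d

end Game

/-! ## Transducers -/

/-- A transducer with input alphabet `B`, output alphabet `A` and state set `M`. -/
structure Transducer (A B M : Type*) where
  init : M
  next : M → B → M
  label : M → A

namespace Transducer

variable {A B M : Type*} (T : Transducer A B M)

/-- The output after reading a word over the input alphabet. -/
def out (x : List B) : A := T.label (x.foldl T.next T.init)

/-- A finite word `a₀b₀a₁b₁…aₙbₙ` agrees with the transducer. -/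
def AgreesFin (α : List (A × B)) : Prop :=
  ∀ (i : ℕ) (h : i < α.length), (α[i]).1 = T.out ((α.take i).map Prod.snd)

/-- An infinite word `a₀b₀a₁b₁…` agrees with the transducer. -/
def Agrees (w : ℕ → A × B) : Prop :=
  ∀ i, (w i).1 = T.out ((wordPrefix w i).map Prod.snd)

end Transducer

/-- A `k`-transducer is a transducer with `k` states. -/
abbrev KTransducer (A B : Type*) (k : ℕ) := Transducer A B (Fin k)

namespace Game

variable {V₁ V₂ A B : Type*} (G : Game V₁ V₂ A B)

/-- The `k`-transducer language of a game. -/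
def transducerLanguage (o : Objective) (k : ℕ) : Set (ℕ → A × B) :=
  {w | (∃ T : KTransducer A B k, T.Agrees w) ∧ G.WinningPlay o w}

/-- `k`-transducer liveness. -/
def IsTransducerLive (o : Objective) (k : ℕ) : Prop :=
  ∀ α : List (A × B), (∃ T : KTransducer A B k, T.AgreesFin α) →
    ∃ β : ℕ → A × B, wordAppend α β ∈ G.transducerLanguage o k

end Game

/-- A strategy of player 2 maps a history `a₀b₀…aₙ₋₁bₙ₋₁` followed by an action `aₙ` of player 1 to
the next action of player 2. -/
abbrev Strategy₂ (A B : Type*) := List (A × B) → A → B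

/-- An infinite word agrees with a strategy of player 2. -/
def Strategy₂.Agrees {A B : Type*} (f : Strategy₂ A B) (w : ℕ → A × B) : Prop :=
  ∀ i, (w i).2 = f (wordPrefix w i) (w i).1

/-- The strategy wins against player 1 restricted to `k`-transducer strategies. -/
def Game.IsWinningStrategy {V₁ V₂ A B : Type*} (G : Game V₁ V₂ A B) (o : Objective) (k : ℕ)
    (f : Strategy₂ A B) : Prop :=
  ∀ (T : KTransducer A B k) (w : ℕ → A × B), T.Agrees w → f.Agrees w → G.WinningPlay o w

/-! ## Online Turing machines -/

/-- An online Turing machine: a deterministic machine of the multi-stack model `Turing.TM2`, with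
finitely many stacks, a finite stack alphabet containing the bits, finitely many labels and
finitely many internal states, one input stack and one output stack. -/
structure OnlineTM where
  K : Type
  [decEqK : DecidableEq K]
  [fintypeK : Fintype K]
  S : Type
  [finiteS : Finite S]
  Λ : Type
  [finiteΛ : Finite Λ]
  σ : Type
  [finiteσ : Finite σ]
  bit : Bool ↪ S
  inp : K
  out : K
  main : Λ
  start : σ
  prog : Λ → Turing.TM2.Stmt (fun _ : K => S) Λ σ

namespace OnlineTM

variable (M : OnlineTM)

instance : DecidableEq M.K := M.decEqK

instance : Fintype M.K := M.fintypeK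

/-- Configurations of the machine. -/
abbrev Cfg : Type := Turing.TM2.Cfg (fun _ : M.K => M.S) M.Λ M.σ

/-- What the machine keeps between two rounds: the internal state and the contents of all
stacks. -/
abbrev Memory : Type := M.σ × (M.K → List M.S)

/-- The space used by a configuration: the total number of symbols on all stacks. -/
def space (c : M.Cfg) : ℕ := ∑ i, (c.stk i).length

/-- The initial memory: all stacks are empty. -/
def initMemory : M.Memory := (M.start, fun _ => [])

/-- The configuration in which a round starts: the input word is put on the input stack and the
machine is started at its main label. -/
def startCfg (m : M.Memory) (x : List Bool) : M.Cfg :=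
  ⟨some M.main, m.1, Function.update m.2 M.inp (x.map M.bit ++ m.2 M.inp)⟩

/-- A round within space `s`: started with memory `m` and input word `x`, the machine halts with
the word `y` on its output stack (which is then emptied) and with memory `m'`, and no
configuration of this computation uses more than `s` cells. -/
def Round (s : ℕ) (m : M.Memory) (x y : List Bool) (m' : M.Memory) : Prop :=
  ∃ c : M.Cfg,
    M.space (M.startCfg m x) ≤ s ∧
    Relation.ReflTransGen (fun c₁ c₂ : M.Cfg => c₂ ∈ Turing.TM2.step M.prog c₁ ∧ M.space c₂ ≤ s)
      (M.startCfg m x) c ∧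
    c.l = none ∧
    c.stk M.out = y.map M.bit ∧
    m' = (c.var, Function.update c.stk M.out [])

/-- The machine reads a word bit by bit, one bit in every round, without any output. -/
def Reads (s : ℕ) : M.Memory → List Bool → M.Memory → Prop
  | m, [], m' => m' = m
  | m, b :: x, m' => ∃ m₁, M.Round s m [b] [] m₁ ∧ Reads s m₁ x m'

end OnlineTM

/-! ## Running a strategy on an online Turing machine -/

/-- The self-delimiting unary code of a natural number. -/
def natCode (m : ℕ) : List Bool := List.replicate m true ++ [false]

/-- The code of a game and a number `k`: the number `k`, the sizes of the alphabets and of the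
vertex sets, the initial vertex and the two transition tables in unary, and then, for every
`d = 0, 1, …` up to the largest colour, the bit `true` followed by the characteristic sequence
of the set of vertices of colour `d`; the bit `false` ends the code. -/
def Game.code {n₁ n₂ a b : ℕ} (G : Game (Fin n₁) (Fin n₂) (Fin a) (Fin b)) (k : ℕ) : List Bool :=
  natCode k ++ natCode a ++ natCode b ++ natCode n₁ ++ natCode n₂ ++ natCode G.init ++
  ((List.finRange n₁).flatMap fun u => (List.finRange a).flatMap fun x => natCode (G.E₁ u x)) ++
  ((List.finRange n₂).flatMap fun v => (List.finRange b).flatMap fun y => natCode (G.E₂ v y)) ++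
  ((List.range (Finset.univ.sup G.color + 1)).flatMap fun d =>
    true :: (((List.finRange n₁).map fun u => decide (G.color (Sum.inl u) = d)) ++
      ((List.finRange n₂).map fun v => decide (G.color (Sum.inr v) = d)))) ++
  [false]

/-- After reading the word `x` the machine runs the strategy `f` forever, one round for every
action of player 1, whatever player 1 does, and all this within space `s`. -/
def OnlineTM.RunsStrategy (M : OnlineTM) (s : ℕ) (x : List Bool) {a b : ℕ}
    (f : Strategy₂ (Fin a) (Fin b)) : Prop :=
  ∃ m₀, M.Reads s M.initMemory x m₀ ∧
    ∀ w : ℕ → Fin a × Fin b, f.Agrees w →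
      ∃ m : ℕ → M.Memory, m 0 = m₀ ∧
        ∀ i, M.Round s (m i) (natCode (w i).1) (natCode (w i).2) (m (i + 1))

/-!
# Strategies against `k`-transducers in polynomial space

Player 1 plays according to an unknown transducer with `k` states. Player 2 enumerates the
hypotheses `(t, j, g)`: a transducer `t` without initial state, the number `j` of a candidate, and a
positional strategy `g` of player 2 in the product of the game with `t`. For the current transducer
player 2 keeps `k` candidates: the state that each possible initial state has reached since the
transducer is considered, as long as player 1 has not contradicted it. In every round player 2
adopts the least remaining hypothesis whose candidate is not contradicted and whose strategy `g`
wins the product from the current state, and answers according to `g`. Hypotheses that have been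
passed over are never considered again.

The strategy wins for the following reason. A product is a one-player game for player 2, so winnable states
are won by positional strategies (`exists_positional_wins`). Hence, when a transducer `t` has been
given up, no state of `t` that is compatible with the history can be beaten any more
(`Hyps.Inv`). Liveness of the game says that some transducer compatible with the history can still
be beaten, so the hypotheses are never exhausted. Therefore, the hypothesis is eventually constant
and the play follows a winning positional strategy in a product (`Hyps.isWinningStrategy`). In a
reachability game a good strategy reaches a final vertex within as many moves as the product has
states, so a hypothesis is replaced by one with another candidate before this number of rounds has
passed, unless a final vertex occurs; counting the candidates bounds the number of moves
(`Hyps.visited_of_reachability`).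

A hypothesis is a word of polynomial length in a mixed radix notation (`digitHyps`), the next
hypothesis is found by counting, and a positional strategy is tested by following its orbit. So
polynomial space is sufficient. For the online machine, a small language of expressions and
commands over arrays of numbers (`StackProg.Expr`, `StackProg.Cmd`) is compiled to stack programs
and these to machines (`StackProg.toOnlineTM`); the space of a round is polynomial in a bound for all
lengths and numbers (`StackProg.round_roundProg`, `StackProg.exists_polynomial_roundSpace`). The
number of colours in the code of the game is not bounded in terms of the number of vertices;
therefore, the colours are replaced by their ranks and parities while the code is read
(`GameProg.ColState`).
-/

/-! ### Structured programs over stacks of bits -/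

/-- A structured program over stacks of bits indexed by `K`. The only control structure besides
sequencing is `loop k c body`: pop the stack `k`; if it was empty, stop; if the bit `x` was popped,
run `body x`, and repeat in case `c x` holds. -/
inductive StackProg (K : Type) : Type
  | skip : StackProg K
  | push : K → Bool → StackProg K
  | seq : StackProg K → StackProg K → StackProg K
  | loop : K → (Bool → Bool) → (Bool → StackProg K) → StackProg K

namespace StackProg

open Turing Relation

variable {K : Type}

/-- The labels of the machine code of a program. -/
def Lab : StackProg K → Type
  | skip => Unit
  | push _ _ => Unit
  | seq p q => p.Lab ⊕ q.Lab
  | loop _ _ b => Option (Σ x, (b x).Lab)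

theorem finite_lab : ∀ p : StackProg K, Finite p.Lab
  | skip => inferInstanceAs (Finite Unit)
  | push _ _ => inferInstanceAs (Finite Unit)
  | seq p q => by
      have := finite_lab p
      have := finite_lab q
      exact inferInstanceAs (Finite (p.Lab ⊕ q.Lab))
  | loop _ _ b => by
      have := fun x => finite_lab (b x)
      exact inferInstanceAs (Finite (Option (Σ x, (b x).Lab)))

/-- The label at which a program is entered. -/
def entry : (p : StackProg K) → p.Lab
  | skip => ()
  | push _ _ => ()
  | seq p _ => Sum.inl p.entry
  | loop _ _ _ => (none : Option _)

/-- The machine code of a program whose labels are embedded by `e` and which is left by a jump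
to `x`. The internal state only serves to inspect a popped bit; it is `none` at every jump. -/
def code {Λ : Type} : (p : StackProg K) → (p.Lab → Λ) → Λ → p.Lab →
    TM2.Stmt (fun _ : K => Bool) Λ (Option Bool)
  | skip, _, x, _ => .goto fun _ => x
  | push k b, _, x, _ => .push k (fun _ => b) (.goto fun _ => x)
  | seq p q, e, _, .inl l => p.code (fun l => e (.inl l)) (e (.inr q.entry)) l
  | seq _ q, e, x, .inr l => q.code (fun l => e (.inr l)) x l
  | loop k _ b, e, x, none => .pop k (fun _ o => o) (.branch (fun o => o == some true)
      (.load (fun _ => none) (.goto fun _ => e (some ⟨true, (b true).entry⟩)))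
      (.branch (fun o => o == some false)
        (.load (fun _ => none) (.goto fun _ => e (some ⟨false, (b false).entry⟩)))
        (.load (fun _ => none) (.goto fun _ => x))))
  | loop _ c b, e, x, some ⟨y, l⟩ =>
      (b y).code (fun l => e (some ⟨y, l⟩)) (if c y then e none else x) l

variable [DecidableEq K] [Fintype K]

/-- The total number of symbols on all stacks. -/
def space (S : K → List Bool) : ℕ := ∑ i, (S i).length

theorem space_update (S : K → List Bool) (k : K) (l : List Bool) :
    space (Function.update S k l) + (S k).length = space S + l.length := by
  classical
  unfold space
  rw [← Finset.add_sum_erase _ _ (Finset.mem_univ k),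
    ← Finset.add_sum_erase (a := k) _ (fun i => (S i).length) (Finset.mem_univ k)]
  have : ∑ x ∈ Finset.univ.erase k, (Function.update S k l x).length =
      ∑ x ∈ Finset.univ.erase k, (S x).length :=
    Finset.sum_congr rfl fun x hx => by
      rw [Function.update_of_ne (Finset.ne_of_mem_erase hx)]
  simp only [Function.update_self, this]
  omega

/-- Within space `s`, the program `p` transforms the stacks `S` into `S'`, wherever its code is
placed in a machine. -/
def Runs (s : ℕ) (p : StackProg K) (S S' : K → List Bool) : Prop :=
  ∀ (Λ : Type) (prog : Λ → TM2.Stmt (fun _ : K => Bool) Λ (Option Bool)) (e : p.Lab → Λ) (x : Λ),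
    (∀ l, prog (e l) = p.code e x l) →
    ReflTransGen (fun c₁ c₂ : TM2.Cfg (fun _ : K => Bool) Λ (Option Bool) =>
      c₂ ∈ TM2.step prog c₁ ∧ space c₂.stk ≤ s) ⟨some (e p.entry), none, S⟩ ⟨some x, none, S'⟩

theorem Runs.skip {s : ℕ} {S : K → List Bool} (h : space S ≤ s) : Runs s skip S S := by
  intro Λ prog e x he
  refine ReflTransGen.single ⟨?_, h⟩
  simp [he, code]

theorem Runs.push {s : ℕ} {S : K → List Bool} (k : K) (b : Bool) (h : space S + 1 ≤ s) :
    Runs s (push k b) S (Function.update S k (b :: S k)) := by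
  intro Λ prog e x he
  refine ReflTransGen.single ⟨by simp [he, code], ?_⟩
  have := space_update S k (b :: S k)
  simp only [List.length_cons] at this
  dsimp only
  omega

theorem Runs.seq {s : ℕ} {p q : StackProg K} {S S₁ S₂ : K → List Bool} (hp : Runs s p S S₁)
    (hq : Runs s q S₁ S₂) : Runs s (seq p q) S S₂ := by
  intro Λ prog e x he
  exact (hp Λ prog (fun l => e (.inl l)) (e (.inr q.entry)) fun l => he (.inl l)).trans
    (hq Λ prog (fun l => e (.inr l)) x fun l => he (.inr l))

theorem Runs.loop_nil {s : ℕ} {k : K} {c : Bool → Bool} {b : Bool → StackProg K}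
    {S : K → List Bool} (hk : S k = []) (h : space S ≤ s) : Runs s (loop k c b) S S := by
  intro Λ prog e x he
  refine ReflTransGen.single ⟨?_, h⟩
  have : Function.update S k [] = S := by rw [← hk, Function.update_eq_self]
  have he' := he none
  simp only [code] at he'
  simp only [entry, TM2.step, he', TM2.stepAux, hk, Option.mem_def]
  simp [this]

theorem Runs.loop_cons_aux {s : ℕ} {k : K} {c : Bool → Bool} {b : Bool → StackProg K}
    {S : K → List Bool} {y : Bool} {r : List Bool} (hk : S k = y :: r) (h : space S ≤ s)
    {Λ : Type} (prog : Λ → TM2.Stmt (fun _ : K => Bool) Λ (Option Bool))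
    (e : (loop k c b).Lab → Λ) (x : Λ) (he : ∀ l, prog (e l) = (loop k c b).code e x l) :
    ReflTransGen (fun c₁ c₂ : TM2.Cfg (fun _ : K => Bool) Λ (Option Bool) =>
      c₂ ∈ TM2.step prog c₁ ∧ space c₂.stk ≤ s) ⟨some (e none), none, S⟩
      ⟨some (e (some ⟨y, (b y).entry⟩)), none, Function.update S k r⟩ := by
  refine ReflTransGen.single ⟨?_, ?_⟩
  · have he' := he none
    simp only [code] at he'
    simp only [TM2.step, he', TM2.stepAux, hk, Option.mem_def]
    cases y <;> simp
  · have := space_update S k r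
    rw [hk] at this
    simp only [List.length_cons] at this
    dsimp only
    omega

theorem Runs.loop_done {s : ℕ} {k : K} {c : Bool → Bool} {b : Bool → StackProg K}
    {S S' : K → List Bool} {y : Bool} {r : List Bool} (hk : S k = y :: r) (h : space S ≤ s)
    (hc : c y = false) (hb : Runs s (b y) (Function.update S k r) S') :
    Runs s (loop k c b) S S' := by
  intro Λ prog e x he
  refine (Runs.loop_cons_aux hk h prog e x he).trans ?_
  refine hb Λ prog (fun l => e (some ⟨y, l⟩)) x fun l => ?_
  have := he (some ⟨y, l⟩)
  simpa [code, hc] using this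

theorem Runs.loop_cont {s : ℕ} {k : K} {c : Bool → Bool} {b : Bool → StackProg K}
    {S S₁ S' : K → List Bool} {y : Bool} {r : List Bool} (hk : S k = y :: r) (h : space S ≤ s)
    (hc : c y = true) (hb : Runs s (b y) (Function.update S k r) S₁)
    (hl : Runs s (loop k c b) S₁ S') : Runs s (loop k c b) S S' := by
  intro Λ prog e x he
  refine ((Runs.loop_cons_aux hk h prog e x he).trans ?_).trans (hl Λ prog e x he)
  refine hb Λ prog (fun l => e (some ⟨y, l⟩)) (e none) fun l => ?_
  have := he (some ⟨y, l⟩)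
  simpa [code, hc] using this

/-! ### The online machine of a program -/

/-- The online machine that runs the program `P` in every round. -/
def toOnlineTM (P : StackProg K) (i o : K) : OnlineTM where
  K := K
  S := Bool
  Λ := Option P.Lab
  finiteΛ := by
    have := P.finite_lab
    infer_instance
  σ := Option Bool
  bit := Function.Embedding.refl Bool
  inp := i
  out := o
  main := some P.entry
  start := none
  prog := fun l => match l with
    | none => .halt
    | some l => P.code some none l

theorem Runs.round {s : ℕ} {P : StackProg K} {i o : K} {S S' : K → List Bool} {x y : List Bool}
    (hs : space (Function.update S i (x ++ S i)) ≤ s)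
    (h : Runs s P (Function.update S i (x ++ S i)) S') (ho : S' o = y) (hs' : space S' ≤ s) :
    (P.toOnlineTM i o).Round s (none, S) x y (none, Function.update S' o []) := by
  have hm : ∀ l : List Bool, l.map (P.toOnlineTM i o).bit = l := fun l => List.map_id l
  refine ⟨⟨none, none, S'⟩, ?_, ?_, rfl, ?_, rfl⟩
  · unfold OnlineTM.startCfg
    rw [hm]
    exact hs
  · unfold OnlineTM.startCfg
    rw [hm]
    refine ReflTransGen.tail (h _ (P.toOnlineTM i o).prog some none fun l => rfl) ⟨rfl, hs'⟩
  · rw [hm]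
    exact ho

end StackProg

/-! ### Auxiliary stacks and moving numbers between stacks -/

/-- The auxiliary stacks of the compiler: input, output, a work stack for the values of
expressions, three scratch stacks, and a stack on which a new array is built. -/
inductive Aux : Type
  | inp | out | work | tmp₁ | tmp₂ | tmp₃ | new
  deriving DecidableEq

instance : Fintype Aux where
  elems := {.inp, .out, .work, .tmp₁, .tmp₂, .tmp₃, .new}
  complete x := by cases x <;> simp

namespace StackProg

variable {V : Type}

/-- The stacks with the given contents: `m` for the variables, and one list for every auxiliary
stack. -/
def stk (m : V → List Bool) (i o w t₁ t₂ t₃ a : List Bool) : V ⊕ Aux → List Bool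
  | .inl v => m v
  | .inr .inp => i
  | .inr .out => o
  | .inr .work => w
  | .inr .tmp₁ => t₁
  | .inr .tmp₂ => t₂
  | .inr .tmp₃ => t₃
  | .inr .new => a

section stk

variable (m : V → List Bool) (i o w t₁ t₂ t₃ a l : List Bool) (v : V)

@[simp] theorem stk_var : stk m i o w t₁ t₂ t₃ a (.inl v) = m v := rfl
@[simp] theorem stk_inp : stk m i o w t₁ t₂ t₃ a (.inr .inp) = i := rfl
@[simp] theorem stk_out : stk m i o w t₁ t₂ t₃ a (.inr .out) = o := rfl
@[simp] theorem stk_work : stk m i o w t₁ t₂ t₃ a (.inr .work) = w := rfl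
@[simp] theorem stk_tmp₁ : stk m i o w t₁ t₂ t₃ a (.inr .tmp₁) = t₁ := rfl
@[simp] theorem stk_tmp₂ : stk m i o w t₁ t₂ t₃ a (.inr .tmp₂) = t₂ := rfl
@[simp] theorem stk_tmp₃ : stk m i o w t₁ t₂ t₃ a (.inr .tmp₃) = t₃ := rfl
@[simp] theorem stk_new : stk m i o w t₁ t₂ t₃ a (.inr .new) = a := rfl

variable [DecidableEq V]

@[simp] theorem update_stk_var : Function.update (stk m i o w t₁ t₂ t₃ a) (.inl v) l =
    stk (Function.update m v l) i o w t₁ t₂ t₃ a := by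
  funext x
  rcases x with x | x
  · by_cases h : x = v
    · subst h; simp
    · simp [h]
  · cases x <;> rfl

@[simp] theorem update_stk_inp : Function.update (stk m i o w t₁ t₂ t₃ a) (.inr .inp) l =
    stk m l o w t₁ t₂ t₃ a := by
  funext x
  rcases x with x | x
  · rfl
  · cases x <;> rfl

@[simp] theorem update_stk_out : Function.update (stk m i o w t₁ t₂ t₃ a) (.inr .out) l =
    stk m i l w t₁ t₂ t₃ a := by
  funext x
  rcases x with x | x
  · rfl
  · cases x <;> rfl

@[simp] theorem update_stk_work : Function.update (stk m i o w t₁ t₂ t₃ a) (.inr .work) l =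
    stk m i o l t₁ t₂ t₃ a := by
  funext x
  rcases x with x | x
  · rfl
  · cases x <;> rfl

@[simp] theorem update_stk_tmp₁ : Function.update (stk m i o w t₁ t₂ t₃ a) (.inr .tmp₁) l =
    stk m i o w l t₂ t₃ a := by
  funext x
  rcases x with x | x
  · rfl
  · cases x <;> rfl

@[simp] theorem update_stk_tmp₂ : Function.update (stk m i o w t₁ t₂ t₃ a) (.inr .tmp₂) l =
    stk m i o w t₁ l t₃ a := by
  funext x
  rcases x with x | x
  · rfl
  · cases x <;> rfl

@[simp] theorem update_stk_tmp₃ : Function.update (stk m i o w t₁ t₂ t₃ a) (.inr .tmp₃) l =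
    stk m i o w t₁ t₂ l a := by
  funext x
  rcases x with x | x
  · rfl
  · cases x <;> rfl

@[simp] theorem update_stk_new : Function.update (stk m i o w t₁ t₂ t₃ a) (.inr .new) l =
    stk m i o w t₁ t₂ t₃ l := by
  funext x
  rcases x with x | x
  · rfl
  · cases x <;> rfl

end stk

theorem space_stk [Fintype V] (m : V → List Bool) (i o w t₁ t₂ t₃ a : List Bool) :
    space (stk m i o w t₁ t₂ t₃ a) = space m + i.length + o.length + w.length + t₁.length +
      t₂.length + t₃.length + a.length := by
  have : (Finset.univ : Finset Aux) = {.inp, .out, .work, .tmp₁, .tmp₂, .tmp₃, .new} := rfl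
  simp only [space, Fintype.sum_sum_type, stk_var]
  rw [this]
  simp [Finset.sum_insert]
  ring

theorem natCode_succ (n : ℕ) : natCode (n + 1) = true :: natCode n := rfl

@[simp] theorem length_natCode (n : ℕ) : (natCode n).length = n + 1 := by simp [natCode]

section moves

variable {K : Type} [DecidableEq K] [Fintype K] {s : ℕ}

/-- Pop a number from the stack `i`, running `p` for every unit of it, and `q` at its end. -/
def count (i : K) (p q : StackProg K) : StackProg K :=
  loop i id fun x => if x then p else q

theorem runs_count_zero {i : K} {p q : StackProg K} {S S' : K → List Bool} {r : List Bool}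
    (hi : S i = natCode 0 ++ r) (hs : space S ≤ s) (hq : Runs s q (Function.update S i r) S') :
    Runs s (count i p q) S S' :=
  Runs.loop_done (y := false) hi hs rfl hq

theorem runs_count_nil {i : K} {p q : StackProg K} {S : K → List Bool}
    (hi : S i = []) (hs : space S ≤ s) : Runs s (count i p q) S S :=
  Runs.loop_nil hi hs

theorem runs_count_succ {i : K} {p q : StackProg K} {S S₁ S' : K → List Bool} {r : List Bool}
    (hi : S i = true :: r) (hs : space S ≤ s)
    (hp : Runs s p (Function.update S i r) S₁) (hl : Runs s (count i p q) S₁ S') :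
    Runs s (count i p q) S S' :=
  Runs.loop_cont (y := true) hi hs rfl hp hl

/-- Remove a number from a stack. -/
def dropNum (i : K) : StackProg K := count i skip skip

theorem runs_dropNum (i : K) (n : ℕ) (S : K → List Bool) {S' : K → List Bool} {r : List Bool}
    (hi : S i = natCode n ++ r) (hs : space S ≤ s) (hS' : S' = Function.update S i r) :
    Runs s (dropNum i) S S' := by
  subst hS'
  unfold dropNum
  have hsp : ∀ (n : ℕ) (S : K → List Bool) (l : List Bool), S i = natCode n ++ l → space S ≤ s →
      space (Function.update S i l) ≤ s := fun n S l h hs => by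
    have := space_update S i l
    rw [h] at this
    simp at this
    omega
  induction n generalizing S with
  | zero => exact runs_count_zero hi hs (Runs.skip (hsp _ _ _ hi hs))
  | succ n ih =>
    rw [natCode_succ] at hi
    have h1 : space (Function.update S i (natCode n ++ r)) ≤ s := by
      have := space_update S i (natCode n ++ r)
      rw [hi] at this
      simp at this
      omega
    refine runs_count_succ hi hs (Runs.skip h1) ?_
    have := ih (Function.update S i (natCode n ++ r)) (by simp) h1
    simpa using this

/-- Pop units from the stack `i` and push them to the stack `j`, up to the end of a number, which
is removed. -/
def moveUnits (i j : K) : StackProg K := count i (push j true) skip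

theorem space_update_update {i j : K} (hij : i ≠ j) (S : K → List Bool) (l l' : List Bool) :
    space (Function.update (Function.update S i l) j l') + (S i).length + (S j).length =
      space S + l.length + l'.length := by
  have h1 := space_update S i l
  have h2 := space_update (Function.update S i l) j l'
  rw [Function.update_of_ne hij.symm] at h2
  omega

theorem replicate_append_cons (n : ℕ) (x : Bool) (l : List Bool) :
    List.replicate n x ++ x :: l = List.replicate (n + 1) x ++ l := by
  rw [List.replicate_succ']
  simp

theorem runs_push_update {i j : K} (hij : i ≠ j) (S : K → List Bool) {x y : Bool} {r : List Bool}
    (hi : S i = y :: r) (hs : space S ≤ s) : Runs s (push j x) (Function.update S i r)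
      (Function.update (Function.update S i r) j (x :: S j)) := by
  have := Runs.push (s := s) (S := Function.update S i r) j x (by
    have := space_update S i r
    rw [hi] at this
    simp at this
    omega)
  rwa [Function.update_of_ne hij.symm] at this

theorem runs_moveUnits {i j : K} (hij : i ≠ j) (n : ℕ) (S : K → List Bool) {S' : K → List Bool}
    {r : List Bool} (hi : S i = natCode n ++ r) (hs : space S ≤ s)
    (hS' : S' = Function.update (Function.update S i r) j (List.replicate n true ++ S j)) :
    Runs s (moveUnits i j) S S' := by
  subst hS'
  unfold moveUnits
  induction n generalizing S with
  | zero =>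
    have h0 : Function.update (Function.update S i r) j (List.replicate 0 true ++ S j) =
        Function.update S i r := by
      funext x
      by_cases hx : x = j
      · subst hx; simp [hij.symm]
      · simp [hx]
    rw [h0]
    refine runs_count_zero hi hs (Runs.skip ?_)
    have := space_update S i r
    rw [hi] at this
    simp at this
    omega
  | succ n ih =>
    rw [natCode_succ, List.cons_append] at hi
    refine runs_count_succ hi hs (runs_push_update hij S hi hs) ?_
    have h1 := space_update_update hij S (natCode n ++ r) (true :: S j)
    rw [hi] at h1
    simp only [List.length_cons, List.length_append] at h1
    have := ih (Function.update (Function.update S i (natCode n ++ r)) j (true :: S j))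
      (by simp [hij]) (by omega)
    convert this using 1
    funext x
    by_cases hx : x = j
    · subst hx; simp [replicate_append_cons]
    · by_cases hx' : x = i
      · subst hx'; simp [hx]
      · simp [hx, hx']

theorem runs_moveUnits_nil {i j : K} (hij : i ≠ j) (n : ℕ) (S : K → List Bool)
    {S' : K → List Bool} (hi : S i = List.replicate n true) (hs : space S ≤ s)
    (hS' : S' = Function.update (Function.update S i []) j (List.replicate n true ++ S j)) :
    Runs s (moveUnits i j) S S' := by
  subst hS'
  unfold moveUnits
  induction n generalizing S with
  | zero =>
    have h0 : Function.update (Function.update S i []) j (List.replicate 0 true ++ S j) = S := by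
      funext x
      by_cases hx : x = j
      · subst hx; simp
      · by_cases hx' : x = i
        · subst hx'; simp [hi, hx]
        · simp [hx, hx']
    rw [h0]
    exact runs_count_nil hi hs
  | succ n ih =>
    rw [List.replicate_succ] at hi
    refine runs_count_succ hi hs (runs_push_update hij S hi hs) ?_
    have h1 := space_update_update hij S (List.replicate n true) (true :: S j)
    rw [hi] at h1
    simp only [List.length_cons] at h1
    have := ih (Function.update (Function.update S i (List.replicate n true)) j (true :: S j))
      (by simp [hij]) (by omega)
    convert this using 1
    funext x
    by_cases hx : x = j
    · subst hx; simp [replicate_append_cons]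
    · by_cases hx' : x = i
      · subst hx'; simp [hx]
      · simp [hx, hx']

/-- Move a number from the stack `i` to the stack `j`, reversing its code. -/
def shiftNum (i j : K) : StackProg K := count i (push j true) (push j false)

theorem runs_shiftNum {i j : K} (hij : i ≠ j) (n : ℕ) (S : K → List Bool) {S' : K → List Bool}
    {r : List Bool} (hi : S i = natCode n ++ r) (hs : space S ≤ s)
    (hS' : S' = Function.update (Function.update S i r) j ((natCode n).reverse ++ S j)) :
    Runs s (shiftNum i j) S S' := by
  subst hS'
  unfold shiftNum
  induction n generalizing S with
  | zero => exact runs_count_zero hi hs (runs_push_update hij S hi hs)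
  | succ n ih =>
    rw [natCode_succ, List.cons_append] at hi
    refine runs_count_succ hi hs (runs_push_update hij S hi hs) ?_
    have h1 := space_update_update hij S (natCode n ++ r) (true :: S j)
    rw [hi] at h1
    simp only [List.length_cons, List.length_append] at h1
    have := ih (Function.update (Function.update S i (natCode n ++ r)) j (true :: S j))
      (by simp [hij]) (by omega)
    convert this using 1
    funext x
    by_cases hx : x = j
    · subst hx; simp [natCode_succ]
    · by_cases hx' : x = i
      · subst hx'; simp [hx]
      · simp [hx, hx']

/-- Move the contents of the stack `i` to the stack `j`, which reverses it. -/
def pour (i j : K) : StackProg K := loop i (fun _ => true) (fun x => push j x)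

theorem runs_pour {i j : K} (hij : i ≠ j) (l : List Bool) (S : K → List Bool)
    {S' : K → List Bool} (hi : S i = l) (hs : space S ≤ s)
    (hS' : S' = Function.update (Function.update S i []) j (l.reverse ++ S j)) :
    Runs s (pour i j) S S' := by
  subst hS'
  unfold pour
  induction l generalizing S with
  | nil =>
    have h0 : Function.update (Function.update S i []) j ([].reverse ++ S j) = S := by
      funext x
      by_cases hx : x = j
      · subst hx; simp
      · by_cases hx' : x = i
        · subst hx'; simp [hi, hx]
        · simp [hx, hx']
    rw [h0]
    exact Runs.loop_nil hi hs
  | cons y l ih =>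
    refine Runs.loop_cont hi hs rfl (runs_push_update hij S hi hs) ?_
    have h1 := space_update_update hij S l (y :: S j)
    rw [hi] at h1
    simp only [List.length_cons] at h1
    have := ih (Function.update (Function.update S i l) j (y :: S j))
      (by simp [hij]) (by omega)
    convert this using 1
    funext x
    by_cases hx : x = j
    · subst hx; simp
    · by_cases hx' : x = i
      · subst hx'; simp [hx]
      · simp [hx, hx']

/-- Empty a stack. -/
def clear (i : K) : StackProg K := loop i (fun _ => true) (fun _ => skip)

theorem runs_clear {i : K} (l : List Bool) (S : K → List Bool)
    {S' : K → List Bool} (hi : S i = l) (hs : space S ≤ s)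
    (hS' : S' = Function.update S i []) : Runs s (clear i) S S' := by
  subst hS'
  unfold clear
  induction l generalizing S with
  | nil =>
    have h0 : Function.update S i [] = S := by rw [← hi, Function.update_eq_self]
    rw [h0]
    exact Runs.loop_nil hi hs
  | cons y l ih =>
    have h1 := space_update S i l
    rw [hi] at h1
    simp only [List.length_cons] at h1
    refine Runs.loop_cont hi hs rfl (Runs.skip (by omega)) ?_
    simpa using ih (Function.update S i l) (by simp) (by omega)

end moves

end StackProg

/-! ### Arithmetic on the work stack -/

namespace StackProg

variable {V : Type}

/-- Add the two topmost numbers of the work stack. -/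
def addP : StackProg (V ⊕ Aux) :=
  seq (moveUnits (.inr .work) (.inr .tmp₁)) (moveUnits (.inr .tmp₁) (.inr .work))

/-- Pop the stack `k` if its topmost symbol is a unit. -/
def dec (k : V ⊕ Aux) : StackProg (V ⊕ Aux) :=
  loop k (fun _ => false) fun x => if x then skip else push k false

/-- Subtract the topmost number of the work stack from the one below it. -/
def subP : StackProg (V ⊕ Aux) :=
  seq (moveUnits (.inr .work) (.inr .tmp₁)) (count (.inr .tmp₁) (dec (.inr .work)) skip)

/-- Copy the units on the stack `tmp₂` to the work stack. -/
def copyUnits : StackProg (V ⊕ Aux) :=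
  seq (count (.inr .tmp₂) (seq (push (.inr .tmp₃) true) (push (.inr .work) true)) skip)
    (moveUnits (.inr .tmp₃) (.inr .tmp₂))

/-- Multiply the two topmost numbers of the work stack. -/
def mulP : StackProg (V ⊕ Aux) :=
  seq (moveUnits (.inr .work) (.inr .tmp₁)) (seq (moveUnits (.inr .work) (.inr .tmp₂))
    (seq (push (.inr .work) false) (seq (count (.inr .tmp₁) copyUnits skip)
      (clear (.inr .tmp₂)))))

/-- Push units on the work stack. -/
def unitsP : ℕ → StackProg (V ⊕ Aux)
  | 0 => skip
  | n + 1 => seq (unitsP n) (push (.inr .work) true)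

/-- Push the number `n` on the work stack. -/
def litP (n : ℕ) : StackProg (V ⊕ Aux) := seq (push (.inr .work) false) (unitsP n)

/-- Replace the topmost number `i` of the work stack by the `i`-th entry of the array `A`. -/
def getP (A : V) : StackProg (V ⊕ Aux) :=
  seq (count (.inr .work) (shiftNum (.inl A) (.inr .tmp₁)) skip)
    (seq (count (.inl A) (seq (push (.inr .tmp₁) true) (push (.inr .tmp₂) true))
        (push (.inr .tmp₁) false))
      (seq (pour (.inr .tmp₁) (.inl A))
        (seq (push (.inr .work) false) (moveUnits (.inr .tmp₂) (.inr .work)))))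

variable [DecidableEq V] [Fintype V] {s : ℕ} (m : V → List Bool)
  (i o w t₁ t₂ t₃ a : List Bool)

theorem units_natCode (n x : ℕ) :
    List.replicate n true ++ natCode x = natCode (x + n) := by
  simp [natCode, ← List.append_assoc, List.replicate_append_replicate, Nat.add_comm]

theorem units_natCode_append (n x : ℕ) (w : List Bool) :
    List.replicate n true ++ (natCode x ++ w) = natCode (x + n) ++ w := by
  rw [← List.append_assoc, units_natCode]

theorem runs_addP (x y : ℕ)
    (hs : space (stk m i o (natCode y ++ (natCode x ++ w)) [] t₂ t₃ a) ≤ s) :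
    Runs s addP (stk m i o (natCode y ++ (natCode x ++ w)) [] t₂ t₃ a)
      (stk m i o (natCode (x + y) ++ w) [] t₂ t₃ a) := by
  refine Runs.seq (S₁ := stk m i o (natCode x ++ w) (List.replicate y true) t₂ t₃ a)
    (runs_moveUnits (by simp) y _ (r := natCode x ++ w) (by simp) hs (by simp))
    (runs_moveUnits_nil (by simp) y _ (by simp) ?_ (by simp [units_natCode_append]))
  simp only [space_stk, List.length_append, length_natCode, List.length_replicate,
    List.length_nil] at hs ⊢
  omega

theorem runs_dec (x : ℕ)
    (hs : space (stk m i o (natCode x ++ w) t₁ t₂ t₃ a) ≤ s) :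
    Runs s (dec (.inr .work)) (stk m i o (natCode x ++ w) t₁ t₂ t₃ a)
      (stk m i o (natCode (x - 1) ++ w) t₁ t₂ t₃ a) := by
  cases x with
  | zero =>
    refine Runs.loop_done (y := false) (r := w) (by simp [natCode]) hs rfl ?_
    have := Runs.push (s := s) (S := stk m i o w t₁ t₂ t₃ a) (.inr .work) false (by
      simp only [space_stk, List.length_append, length_natCode] at hs ⊢
      omega)
    simpa [natCode] using this
  | succ x =>
    refine Runs.loop_done (y := true) (r := natCode x ++ w) (by simp [natCode_succ]) hs rfl ?_
    have := Runs.skip (s := s) (S := stk m i o (natCode x ++ w) t₁ t₂ t₃ a) (by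
      simp only [space_stk, List.length_append, length_natCode] at hs ⊢
      omega)
    simpa using this

theorem runs_subP (x y : ℕ)
    (hs : space (stk m i o (natCode y ++ (natCode x ++ w)) [] t₂ t₃ a) ≤ s) :
    Runs s subP (stk m i o (natCode y ++ (natCode x ++ w)) [] t₂ t₃ a)
      (stk m i o (natCode (x - y) ++ w) [] t₂ t₃ a) := by
  refine Runs.seq (S₁ := stk m i o (natCode x ++ w) (List.replicate y true) t₂ t₃ a)
    (runs_moveUnits (by simp) y _ (r := natCode x ++ w) (by simp) hs (by simp)) ?_
  have hs' : space (stk m i o (natCode x ++ w) (List.replicate y true) t₂ t₃ a) ≤ s := by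
    simp only [space_stk, List.length_append, length_natCode, List.length_replicate,
      List.length_nil] at hs ⊢
    omega
  clear hs
  induction y generalizing x with
  | zero => exact runs_count_nil (by simp) hs'
  | succ y ih =>
    have h1 : space (stk m i o (natCode x ++ w) (List.replicate y true) t₂ t₃ a) ≤ s := by
      simp only [space_stk, List.length_append, length_natCode, List.length_replicate] at hs' ⊢
      omega
    refine runs_count_succ (r := List.replicate y true) (by simp [List.replicate_succ]) hs'
      (S₁ := stk m i o (natCode (x - 1) ++ w) (List.replicate y true) t₂ t₃ a) ?_ ?_
    · simpa using runs_dec m i o w _ t₂ t₃ a x h1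
    · have : x - (y + 1) = x - 1 - y := by omega
      rw [this]
      refine ih (x - 1) ?_
      simp only [space_stk, List.length_append, length_natCode, List.length_replicate] at h1 ⊢
      omega

theorem runs_copyUnits (x z : ℕ)
    (hs : space (stk m i o (natCode z ++ w) t₁ (List.replicate x true) [] a) + x ≤ s) :
    Runs s copyUnits (stk m i o (natCode z ++ w) t₁ (List.replicate x true) [] a)
      (stk m i o (natCode (z + x) ++ w) t₁ (List.replicate x true) [] a) := by
  simp only [space_stk, List.length_append, length_natCode, List.length_replicate,
      List.length_nil] at hs
  refine Runs.seq (S₁ := stk m i o (natCode (z + x) ++ w) t₁ [] (List.replicate x true) a) ?_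
    (runs_moveUnits_nil (by simp) x _ (by simp) ?_ (by simp))
  swap
  · simp only [space_stk, List.length_append, length_natCode, List.length_replicate,
      List.length_nil]
    omega
  have key : ∀ (x y z : ℕ), space m + i.length + o.length + (z + 1 + w.length) + t₁.length +
      x + y + a.length + x ≤ s →
    Runs s (count (.inr .tmp₂) (seq (push (.inr .tmp₃) true) (push (.inr .work) true)) skip)
      (stk m i o (natCode z ++ w) t₁ (List.replicate x true) (List.replicate y true) a)
      (stk m i o (natCode (z + x) ++ w) t₁ [] (List.replicate (y + x) true) a) := by
    intro x
    induction x with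
    | zero =>
      intro y z h
      refine runs_count_nil rfl ?_
      simp only [space_stk, List.length_append, length_natCode, List.length_replicate]
      omega
    | succ x ih =>
      intro y z h
      refine runs_count_succ (r := List.replicate x true) (by simp [List.replicate_succ]) ?_
        (S₁ := stk m i o (natCode (z + 1) ++ w) t₁ (List.replicate x true)
          (List.replicate (y + 1) true) a) ?_ ?_
      · simp only [space_stk, List.length_append, length_natCode, List.length_replicate]
        omega
      · rw [update_stk_tmp₂]
        have h1 := Runs.push (s := s) (S := stk m i o (natCode z ++ w) t₁ (List.replicate x true)
          (List.replicate y true) a) (.inr .tmp₃) true (by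
            simp only [space_stk, List.length_append, length_natCode, List.length_replicate]
            omega)
        have h2 := Runs.push (s := s) (S := stk m i o (natCode z ++ w) t₁ (List.replicate x true)
          (List.replicate (y + 1) true) a) (.inr .work) true (by
            simp only [space_stk, List.length_append, length_natCode, List.length_replicate]
            omega)
        refine Runs.seq (S₁ := stk m i o (natCode z ++ w) t₁ (List.replicate x true)
          (List.replicate (y + 1) true) a) ?_ ?_
        · simpa [List.replicate_succ] using h1
        · simpa [natCode_succ] using h2
      · have := ih (y + 1) (z + 1) (by omega)
        rwa [show z + 1 + x = z + (x + 1) by ring, show y + 1 + x = y + (x + 1) by ring] at this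
  simpa using key x 0 z (by omega)

theorem runs_mulP (x y : ℕ)
    (hs : space (stk m i o (natCode y ++ (natCode x ++ w)) [] [] [] a) + x * y + x ≤ s) :
    Runs s mulP (stk m i o (natCode y ++ (natCode x ++ w)) [] [] [] a)
      (stk m i o (natCode (x * y) ++ w) [] [] [] a) := by
  have hs0 := hs
  simp only [space_stk, List.length_append, length_natCode, List.length_nil] at hs0
  refine Runs.seq (S₁ := stk m i o (natCode x ++ w) (List.replicate y true) [] [] a)
    (runs_moveUnits (by simp) y _ (r := natCode x ++ w) (by simp) (by omega) (by simp)) ?_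
  refine Runs.seq (S₁ := stk m i o w (List.replicate y true) (List.replicate x true) [] a)
    (runs_moveUnits (by simp) x _ (r := w) (by simp) ?_ (by simp)) ?_
  · simp only [space_stk, List.length_append, length_natCode, List.length_replicate,
      List.length_nil]
    omega
  refine Runs.seq (S₁ := stk m i o (natCode 0 ++ w) (List.replicate y true)
    (List.replicate x true) [] a) ?_ ?_
  · have := Runs.push (s := s) (S := stk m i o w (List.replicate y true)
      (List.replicate x true) [] a) (.inr .work) false (by
        simp only [space_stk, List.length_replicate, List.length_nil]
        omega)
    simpa [natCode] using this
  refine Runs.seq (S₁ := stk m i o (natCode (x * y) ++ w) []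
    (List.replicate x true) [] a) ?_
      (runs_clear _ _ rfl ?_ (by simp))
  swap
  · simp only [space_stk, List.length_append, length_natCode, List.length_replicate,
      List.length_nil]
    omega
  have key : ∀ (y z : ℕ), space m + i.length + o.length + (z + 1 + w.length) + y + x +
      a.length + x * y + x ≤ s →
    Runs s (count (.inr .tmp₁) copyUnits skip)
      (stk m i o (natCode z ++ w) (List.replicate y true) (List.replicate x true) [] a)
      (stk m i o (natCode (z + x * y) ++ w) [] (List.replicate x true) [] a) := by
    intro y
    induction y with
    | zero =>
      intro z h
      refine runs_count_nil rfl ?_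
      simp only [space_stk, List.length_append, length_natCode, List.length_replicate,
        List.length_nil]
      omega
    | succ y ih =>
      intro z h
      rw [Nat.mul_succ] at h
      refine runs_count_succ (r := List.replicate y true) (by simp [List.replicate_succ]) ?_
        (S₁ := stk m i o (natCode (z + x) ++ w) (List.replicate y true)
          (List.replicate x true) [] a) ?_ ?_
      · simp only [space_stk, List.length_append, length_natCode, List.length_replicate,
          List.length_nil]
        omega
      · rw [update_stk_tmp₁]
        refine runs_copyUnits m i o w _ a x z ?_
        simp only [space_stk, List.length_append, length_natCode, List.length_replicate,
          List.length_nil]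
        omega
      · have := ih (z + x) (by omega)
        rwa [show z + x + x * y = z + x * (y + 1) by ring] at this
  simpa using key y 0 (by omega)

theorem runs_unitsP (n x : ℕ) (hs : space (stk m i o (natCode x ++ w) t₁ t₂ t₃ a) + n ≤ s) :
    Runs s (unitsP n) (stk m i o (natCode x ++ w) t₁ t₂ t₃ a)
      (stk m i o (natCode (x + n) ++ w) t₁ t₂ t₃ a) := by
  induction n with
  | zero => exact Runs.skip hs
  | succ n ih =>
    refine Runs.seq (ih (by omega)) ?_
    have := Runs.push (s := s) (S := stk m i o (natCode (x + n) ++ w) t₁ t₂ t₃ a)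
      (.inr .work) true (by
        simp only [space_stk, List.length_append, length_natCode] at hs ⊢
        omega)
    simpa [← add_assoc, natCode_succ] using this

theorem runs_litP (n : ℕ) (hs : space (stk m i o w t₁ t₂ t₃ a) + n + 1 ≤ s) :
    Runs s (litP n) (stk m i o w t₁ t₂ t₃ a) (stk m i o (natCode n ++ w) t₁ t₂ t₃ a) := by
  refine Runs.seq (S₁ := stk m i o (natCode 0 ++ w) t₁ t₂ t₃ a) ?_ ?_
  · have := Runs.push (s := s) (S := stk m i o w t₁ t₂ t₃ a) (.inr .work) false (by omega)
    simpa [natCode] using this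
  · have := runs_unitsP (s := s) m i o w t₁ t₂ t₃ a n 0 (by
      simp only [space_stk, List.length_append, length_natCode] at hs ⊢
      omega)
    simpa using this

/-- The code of an array of numbers. -/
def listCode (l : List ℕ) : List Bool := l.flatMap natCode

@[simp] theorem listCode_nil : listCode [] = [] := rfl

@[simp] theorem listCode_cons (n : ℕ) (l : List ℕ) :
    listCode (n :: l) = natCode n ++ listCode l := rfl

theorem length_listCode_cons (n : ℕ) (l : List ℕ) :
    (listCode (n :: l)).length = n + 1 + (listCode l).length := by simp

/-- The codes of the arrays of a memory. -/
def memCode (m : V → List ℕ) (v : V) : List Bool := listCode (m v)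

omit [Fintype V] in
theorem update_memCode (m : V → List ℕ) (v : V) (l : List ℕ) :
    Function.update (memCode m) v (listCode l) = memCode (Function.update m v l) := by
  funext x
  by_cases h : x = v
  · subst h; simp [memCode]
  · simp [memCode, h]

theorem runs_skipNums (A : V) (n : ℕ) (l : List ℕ) (t : List Bool)
    (hs : space (stk (Function.update m A (listCode l)) i o (natCode n ++ w) t t₂ t₃ a) ≤ s) :
    Runs s (count (.inr .work) (shiftNum (.inl A) (.inr .tmp₁)) skip)
      (stk (Function.update m A (listCode l)) i o (natCode n ++ w) t t₂ t₃ a)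
      (stk (Function.update m A (listCode (l.drop n))) i o w
        ((listCode (l.take n)).reverse ++ t) t₂ t₃ a) := by
  induction n generalizing l t with
  | zero =>
    refine runs_count_zero (r := w) (by simp) hs ?_
    have := Runs.skip (s := s) (S := stk (Function.update m A (listCode l)) i o w t t₂ t₃ a) (by
      simp only [space_stk, List.length_append, length_natCode] at hs ⊢
      omega)
    simpa using this
  | succ n ih =>
    have hs0 := hs
    have h1 := space_update m A (listCode l)
    simp only [space_stk, List.length_append, length_natCode] at hs0
    cases l with
    | nil =>
      refine runs_count_succ (r := natCode n ++ w) (by simp [natCode_succ]) hs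
        (S₁ := stk (Function.update m A (listCode [])) i o (natCode n ++ w) t t₂ t₃ a) ?_ ?_
      · rw [update_stk_work]
        refine runs_count_nil (by simp) ?_
        simp only [space_stk, List.length_append, length_natCode]
        omega
      · have := ih [] t (by
          simp only [space_stk, List.length_append, length_natCode]
          omega)
        simpa using this
    | cons x l =>
      rw [length_listCode_cons] at h1
      have h2 := space_update m A (listCode l)
      refine runs_count_succ (r := natCode n ++ w) (by simp [natCode_succ]) hs
        (S₁ := stk (Function.update m A (listCode l)) i o (natCode n ++ w)
          ((natCode x).reverse ++ t) t₂ t₃ a) ?_ ?_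
      · rw [update_stk_work]
        refine runs_shiftNum (by simp) x _ (r := listCode l) (by simp) ?_ (by simp)
        simp only [space_stk, List.length_append, length_natCode]
        omega
      · have := ih l ((natCode x).reverse ++ t) (by
          simp only [space_stk, List.length_append, length_natCode, List.length_reverse]
          omega)
        simpa using this

theorem runs_copyNum (A : V) (n : ℕ) (l : List Bool) (t t' : List Bool)
    (hs : space (stk (Function.update m A (natCode n ++ l)) i o w t t' t₃ a) + n ≤ s) :
    Runs s (count (.inl A) (seq (push (.inr .tmp₁) true) (push (.inr .tmp₂) true))
        (push (.inr .tmp₁) false))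
      (stk (Function.update m A (natCode n ++ l)) i o w t t' t₃ a)
      (stk (Function.update m A l) i o w ((natCode n).reverse ++ t)
        (List.replicate n true ++ t') t₃ a) := by
  have h2 := space_update m A l
  induction n generalizing t t' with
  | zero =>
    have h1 := space_update m A (natCode 0 ++ l)
    simp only [space_stk, List.length_append, length_natCode] at hs h1
    refine runs_count_zero (r := l) (by simp) (by simp only [space_stk]; omega) ?_
    have := Runs.push (s := s) (S := stk (Function.update m A l) i o w t t' t₃ a)
      (.inr .tmp₁) false (by
        simp only [space_stk]
        omega)
    simpa [natCode] using this
  | succ n ih =>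
    have h1 := space_update m A (natCode (n + 1) ++ l)
    have h3 := space_update m A (natCode n ++ l)
    simp only [space_stk, List.length_append, length_natCode] at hs h1 h3
    refine runs_count_succ (r := natCode n ++ l) (by simp [natCode_succ])
      (by simp only [space_stk]; omega)
      (S₁ := stk (Function.update m A (natCode n ++ l)) i o w (true :: t) (true :: t') t₃ a) ?_ ?_
    · rw [update_stk_var, Function.update_idem]
      refine Runs.seq (S₁ := stk (Function.update m A (natCode n ++ l)) i o w (true :: t) t' t₃ a)
        ?_ ?_
      · have := Runs.push (s := s) (S := stk (Function.update m A (natCode n ++ l)) i o w t t' t₃ a)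
          (.inr .tmp₁) true (by
            simp only [space_stk]
            omega)
        simpa using this
      · have := Runs.push (s := s)
          (S := stk (Function.update m A (natCode n ++ l)) i o w (true :: t) t' t₃ a)
          (.inr .tmp₂) true (by
            simp only [space_stk, List.length_cons]
            omega)
        simpa using this
    · have := ih (true :: t) (true :: t') (by
        simp only [space_stk, List.length_cons]
        omega)
      simpa [natCode_succ, replicate_append_cons] using this

theorem runs_getP (m : V → List ℕ) (A : V) (n : ℕ)
    (hs : space (stk (memCode m) i o (natCode n ++ w) [] [] [] a) + (m A).getD n 0 + 1 ≤ s) :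
    Runs s (getP A) (stk (memCode m) i o (natCode n ++ w) [] [] [] a)
      (stk (memCode m) i o (natCode ((m A).getD n 0) ++ w) [] [] [] a) := by
  have hs0 := hs
  simp only [space_stk, List.length_append, length_natCode, List.length_nil] at hs0
  have hm : Function.update (memCode m) A (listCode (m A)) = memCode m := by
    rw [show listCode (m A) = memCode m A from rfl, Function.update_eq_self]
  have h1 := runs_skipNums (s := s) (memCode m) i o w [] [] a A n (m A) [] (by
    rw [hm]; omega)
  rw [hm] at h1
  refine Runs.seq h1 ?_
  have hsp : ∀ l l' : List ℕ, m A = l ++ l' →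
      space (Function.update (memCode m) A (listCode l')) + (listCode l).length =
        space (memCode m) := by
    intro l l' h
    have := space_update (memCode m) A (listCode l')
    have h2 : (memCode m A).length = (listCode l).length + (listCode l').length := by
      rw [memCode, h]
      simp [listCode]
    omega
  set x := (m A).getD n 0 with hx
  have hpour : ∀ l l' : List ℕ, m A = l ++ l' →
      Runs s (seq (pour (.inr .tmp₁) (.inl A)) (seq (push (.inr .work) false)
        (moveUnits (.inr .tmp₂) (.inr .work))))
        (stk (Function.update (memCode m) A (listCode l')) i o w (listCode l).reverse
          (List.replicate x true) [] a)
        (stk (memCode m) i o (natCode x ++ w) [] [] [] a) := by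
    intro l l' h
    refine Runs.seq (S₁ := stk (memCode m) i o w [] (List.replicate x true) [] a)
      (runs_pour (by simp) _ _ rfl ?_ ?_) ?_
    · have := hsp l l' h
      simp only [space_stk, List.length_reverse, List.length_replicate, List.length_nil]
      omega
    · simp only [stk_tmp₁, List.reverse_reverse, update_stk_tmp₁, stk_var, Function.update_self,
        update_stk_var, Function.update_idem]
      rw [← hm, h]
      simp [listCode]
    · refine Runs.seq (S₁ := stk (memCode m) i o (natCode 0 ++ w) [] (List.replicate x true) [] a)
        ?_ ?_
      · have := Runs.push (s := s) (S := stk (memCode m) i o w [] (List.replicate x true) [] a)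
          (.inr .work) false (by
            simp only [space_stk, List.length_replicate, List.length_nil]
            omega)
        simpa [natCode] using this
      · refine runs_moveUnits_nil (by simp) x _ (by simp) ?_ (by simp [units_natCode_append])
        simp only [space_stk, List.length_append, length_natCode, List.length_replicate,
          List.length_nil]
        omega
  have hle := hsp _ _ (List.take_append_drop n (m A)).symm
  cases hd : (m A).drop n with
  | nil =>
    rw [hd] at hle
    have hx0 : x = 0 := by
      rw [hx, List.getD_eq_getElem?_getD, List.getElem?_eq_none, Option.getD_none]
      simpa using hd
    refine Runs.seq (runs_count_nil (by simp) ?_) ?_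
    · simp only [space_stk, List.length_append, List.length_reverse, List.length_nil]
      omega
    · have := hpour _ _ (List.take_append_drop n (m A)).symm
      rw [hd, hx0] at this
      rw [hx0]
      simpa using this
  | cons y l =>
    have hxy : x = y := by
      have h : (m A)[n]? = some y := by
        rw [← List.head?_drop, hd]; rfl
      rw [hx, List.getD_eq_getElem?_getD, h, Option.getD_some]
    rw [hd] at hle
    have h4 := runs_copyNum (s := s) (memCode m) i o w [] a A y (listCode l)
      ((listCode ((m A).take n)).reverse ++ []) [] (by
        rw [← listCode_cons]
        simp only [space_stk, List.length_append, List.length_reverse, List.length_nil]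
        omega)
    refine Runs.seq h4 ?_
    have h5 : m A = ((m A).take n ++ [y]) ++ l := by
      rw [List.append_assoc, List.singleton_append, ← hd, List.take_append_drop]
    have := hpour _ _ h5
    rw [hxy] at this ⊢
    simpa [listCode] using this

end StackProg

/-! ### Expressions over arrays of numbers -/

namespace StackProg

variable {V : Type} [DecidableEq V]

/-- The memory `m` with the number `x` put in front of the array `v`. -/
def pushVar (m : V → List ℕ) (v : V) (x : ℕ) : V → List ℕ := Function.update m v (x :: m v)

/-- Arithmetic expressions over a memory of arrays. `get A e` is the entry of the array `A` at the
index `e`, or `0` out of range. `loop cap acc i n init body` iterates `body`, `n` times and starting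
with the value `init`; during the iteration the accumulated value and the number of the iteration
are the first entries of the arrays `acc` and `i`. New values are cut off at the first entry of the
array `cap`, so that the values of an expression are bounded in terms of the memory. -/
inductive Expr (V : Type) : Type
  | lit : ℕ → Expr V
  | get : V → Expr V → Expr V
  | add : Expr V → Expr V → Expr V
  | mul : Expr V → Expr V → Expr V
  | sub : Expr V → Expr V → Expr V
  | loop (cap acc i : V) (n init body : Expr V) : Expr V

namespace Expr

/-- The value of an expression. -/
def eval : Expr V → (V → List ℕ) → ℕ
  | lit n, _ => n
  | get A e, m => (m A).getD (e.eval m) 0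
  | add e f, m => e.eval m + f.eval m
  | mul e f, m => e.eval m * f.eval m
  | sub e f, m => e.eval m - f.eval m
  | loop cap acc i n init body, m =>
      Nat.rec (motive := fun _ => ℕ) (init.eval m) (fun j r =>
        min ((pushVar (pushVar m i j) acc r cap).getD 0 0)
          (body.eval (pushVar (pushVar m i j) acc r))) (n.eval m)

/-- A bound for the value of an expression if all numbers in the memory are at most `B`. -/
def bd : Expr V → ℕ → ℕ
  | lit n, _ => n
  | get _ _, B => B
  | add e f, B => e.bd B + f.bd B
  | mul e f, B => e.bd B * f.bd B
  | sub e _, B => e.bd B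
  | loop _ _ _ n init _, B => B + n.bd B + init.bd B

/-- A bound for the additional space that the evaluation of an expression needs if all numbers in
the memory are at most `B`. -/
def sp : Expr V → ℕ → ℕ
  | lit n, _ => n + 1
  | get _ e, B => e.sp B + e.bd B + B + 2
  | add e f, B => e.sp B + f.sp B + e.bd B + f.bd B + 2
  | mul e f, B => e.sp B + f.sp B + e.bd B + f.bd B + 2 + e.bd B * f.bd B + e.bd B
  | sub e f, B => e.sp B + f.sp B + e.bd B + f.bd B + 2
  | loop _ _ _ n init body, B =>
      n.sp B + init.sp B + 10 * (B + n.bd B + init.bd B + 1) +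
        body.sp (B + n.bd B + init.bd B) + body.bd (B + n.bd B + init.bd B)

omit [DecidableEq V] in
theorem exists_polynomial_bd (e : Expr V) : ∃ p : Polynomial ℕ, ∀ B, p.eval B = e.bd B := by
  induction e with
  | lit n => exact ⟨.C n, by simp [bd]⟩
  | get _ _ _ => exact ⟨.X, by simp [bd]⟩
  | add e f he hf =>
    obtain ⟨p, hp⟩ := he
    obtain ⟨q, hq⟩ := hf
    exact ⟨p + q, by simp [bd, hp, hq]⟩
  | mul e f he hf =>
    obtain ⟨p, hp⟩ := he
    obtain ⟨q, hq⟩ := hf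
    exact ⟨p * q, by simp [bd, hp, hq]⟩
  | sub e f he hf =>
    obtain ⟨p, hp⟩ := he
    exact ⟨p, by simp [bd, hp]⟩
  | loop _ _ _ n init body hn hi hb =>
    obtain ⟨p, hp⟩ := hn
    obtain ⟨q, hq⟩ := hi
    exact ⟨.X + p + q, by simp [bd, hp, hq]⟩

omit [DecidableEq V] in
theorem exists_polynomial_sp (e : Expr V) : ∃ p : Polynomial ℕ, ∀ B, p.eval B = e.sp B := by
  induction e with
  | lit n => exact ⟨.C (n + 1), by simp [sp]⟩
  | get _ e he =>
    obtain ⟨p, hp⟩ := he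
    obtain ⟨p', hp'⟩ := e.exists_polynomial_bd
    exact ⟨p + p' + .X + 2, by simp [sp, hp, hp']⟩
  | add e f he hf =>
    obtain ⟨p, hp⟩ := he
    obtain ⟨q, hq⟩ := hf
    obtain ⟨p', hp'⟩ := e.exists_polynomial_bd
    obtain ⟨q', hq'⟩ := f.exists_polynomial_bd
    exact ⟨p + q + p' + q' + 2, by simp [sp, hp, hq, hp', hq']⟩
  | mul e f he hf =>
    obtain ⟨p, hp⟩ := he
    obtain ⟨q, hq⟩ := hf
    obtain ⟨p', hp'⟩ := e.exists_polynomial_bd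
    obtain ⟨q', hq'⟩ := f.exists_polynomial_bd
    exact ⟨p + q + p' + q' + 2 + p' * q' + p', by simp [sp, hp, hq, hp', hq']⟩
  | sub e f he hf =>
    obtain ⟨p, hp⟩ := he
    obtain ⟨q, hq⟩ := hf
    obtain ⟨p', hp'⟩ := e.exists_polynomial_bd
    obtain ⟨q', hq'⟩ := f.exists_polynomial_bd
    exact ⟨p + q + p' + q' + 2, by simp [sp, hp, hq, hp', hq']⟩
  | loop _ _ _ n init body hn hi hb =>
    obtain ⟨p, hp⟩ := hn
    obtain ⟨q, hq⟩ := hi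
    obtain ⟨r, hr⟩ := hb
    obtain ⟨p', hp'⟩ := n.exists_polynomial_bd
    obtain ⟨q', hq'⟩ := init.exists_polynomial_bd
    obtain ⟨r', hr'⟩ := body.exists_polynomial_bd
    exact ⟨p + q + 10 * (.X + p' + q' + 1) + r.comp (.X + p' + q') + r'.comp (.X + p' + q'), by
      simp [sp, hp, hq, hr, hp', hq', hr']⟩

/-- All numbers in the memory `m` are at most `B`. -/
def Below (B : ℕ) (m : V → List ℕ) : Prop := ∀ v, ∀ x ∈ m v, x ≤ B

omit [DecidableEq V] in
theorem Below.getD {B : ℕ} {m : V → List ℕ} (h : Below B m) (v : V) (n : ℕ) :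
    (m v).getD n 0 ≤ B := by
  rw [List.getD_eq_getElem?_getD]
  rcases hx : (m v)[n]? with _ | x
  · simp
  · simpa using h v x (List.mem_of_getElem? hx)

theorem Below.pushVar {B : ℕ} {m : V → List ℕ} (h : Below B m) (v : V) {x : ℕ} (hx : x ≤ B) :
    Below B (pushVar m v x) := by
  intro u y hy
  by_cases huv : u = v
  · subst huv
    simp only [StackProg.pushVar, Function.update_self, List.mem_cons] at hy
    rcases hy with rfl | hy
    · exact hx
    · exact h u y hy
  · simp only [StackProg.pushVar, Function.update_of_ne huv] at hy
    exact h u y hy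

omit [DecidableEq V] in
theorem Below.mono {B B' : ℕ} {m : V → List ℕ} (h : Below B m) (hB : B ≤ B') : Below B' m :=
  fun v x hx => (h v x hx).trans hB

theorem eval_le_bd (e : Expr V) {B : ℕ} {m : V → List ℕ} (h : Below B m) :
    e.eval m ≤ e.bd B := by
  induction e generalizing m with
  | lit n => exact le_rfl
  | get A e he => exact h.getD _ _
  | add e f he hf => exact Nat.add_le_add (he h) (hf h)
  | mul e f he hf => exact Nat.mul_le_mul (he h) (hf h)
  | sub e f he hf => exact (Nat.sub_le _ _).trans (he h)
  | loop cap acc i n init body hn hi hb =>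
    simp only [eval, bd]
    have h1 := hn h
    have h2 := hi h
    have : ∀ k ≤ n.eval m, Nat.rec (motive := fun _ => ℕ) (init.eval m) (fun j r =>
        min ((StackProg.pushVar (StackProg.pushVar m i j) acc r cap).getD 0 0)
          (body.eval (StackProg.pushVar (StackProg.pushVar m i j) acc r))) k ≤
        B + n.bd B + init.bd B := by
      intro k
      induction k with
      | zero => intro _; change init.eval m ≤ _; omega
      | succ k ih =>
        intro hk
        refine (min_le_left _ _).trans ?_
        exact Below.getD (((h.mono (by omega)).pushVar i (by omega)).pushVar acc (ih (by omega)))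
          _ _
    exact this _ le_rfl

/-- The program that evaluates an expression and pushes its value on the work stack. -/
def comp : Expr V → StackProg (V ⊕ Aux)
  | lit n => litP n
  | get A e => seq e.comp (getP A)
  | add e f => seq e.comp (seq f.comp addP)
  | mul e f => seq e.comp (seq f.comp mulP)
  | sub e f => seq e.comp (seq f.comp subP)
  | loop cap acc i n init body => seq n.comp (seq init.comp (seq (push (.inl i) false)
      (seq (seq (push (.inl acc) false) (moveUnits (.inr .work) (.inl acc)))
      (seq (count (.inr .work)
        (seq (seq (litP 0) (getP cap)) (seq (seq (litP 0) (getP cap)) (seq body.comp (seq subP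
          (seq subP (seq (dropNum (.inl acc)) (seq (push (.inl i) true)
            (seq (push (.inl acc) false) (moveUnits (.inr .work) (.inl acc)))))))))) skip)
      (seq (seq (push (.inr .work) false) (moveUnits (.inl acc) (.inr .work)))
        (dropNum (.inl i)))))))

end Expr

theorem memCode_pushVar (m : V → List ℕ) (v : V) (x : ℕ) :
    memCode (pushVar m v x) = Function.update (memCode m) v (natCode x ++ memCode m v) := by
  rw [pushVar, ← update_memCode, listCode_cons]
  rfl

variable [Fintype V] {s : ℕ} (m : V → List ℕ) (i o w t₁ t₂ t₃ a : List Bool)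

theorem space_memCode_pushVar (v : V) (x : ℕ) :
    space (memCode (pushVar m v x)) = space (memCode m) + x + 1 := by
  have := space_update (memCode m) v (natCode x ++ memCode m v)
  rw [memCode_pushVar]
  simp only [List.length_append, length_natCode] at this
  omega

theorem runs_pushZero (v : V)
    (hs : space (stk (memCode m) i o w t₁ t₂ t₃ a) + 1 ≤ s) :
    Runs s (push (.inl v) false) (stk (memCode m) i o w t₁ t₂ t₃ a)
      (stk (memCode (pushVar m v 0)) i o w t₁ t₂ t₃ a) := by
  have := Runs.push (s := s) (S := stk (memCode m) i o w t₁ t₂ t₃ a) (.inl v) false hs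
  simpa [memCode_pushVar, natCode] using this

theorem runs_incVar (v : V) (x : ℕ)
    (hs : space (stk (memCode (pushVar m v x)) i o w t₁ t₂ t₃ a) + 1 ≤ s) :
    Runs s (push (.inl v) true) (stk (memCode (pushVar m v x)) i o w t₁ t₂ t₃ a)
      (stk (memCode (pushVar m v (x + 1))) i o w t₁ t₂ t₃ a) := by
  have := Runs.push (s := s) (S := stk (memCode (pushVar m v x)) i o w t₁ t₂ t₃ a) (.inl v) true hs
  simpa [memCode_pushVar, natCode_succ] using this

theorem runs_pushFromWork (v : V) (x : ℕ)
    (hs : space (stk (memCode m) i o (natCode x ++ w) t₁ t₂ t₃ a) + 1 ≤ s) :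
    Runs s (seq (push (.inl v) false) (moveUnits (.inr .work) (.inl v)))
      (stk (memCode m) i o (natCode x ++ w) t₁ t₂ t₃ a)
      (stk (memCode (pushVar m v x)) i o w t₁ t₂ t₃ a) := by
  refine Runs.seq (runs_pushZero m i o _ t₁ t₂ t₃ a v hs)
    (runs_moveUnits (by simp) x _ (r := w) (by simp) ?_ ?_)
  · simp only [space_stk, List.length_append, length_natCode, space_memCode_pushVar] at hs ⊢
    omega
  · simp [memCode_pushVar, units_natCode_append]

theorem runs_popToWork (v : V) (x : ℕ)
    (hs : space (stk (memCode (pushVar m v x)) i o w t₁ t₂ t₃ a) + 1 ≤ s) :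
    Runs s (seq (push (.inr .work) false) (moveUnits (.inl v) (.inr .work)))
      (stk (memCode (pushVar m v x)) i o w t₁ t₂ t₃ a)
      (stk (memCode m) i o (natCode x ++ w) t₁ t₂ t₃ a) := by
  refine Runs.seq (S₁ := stk (memCode (pushVar m v x)) i o (natCode 0 ++ w) t₁ t₂ t₃ a) ?_
    (runs_moveUnits (by simp) x _ (r := memCode m v) (by simp [memCode_pushVar]) ?_ ?_)
  · have := Runs.push (s := s) (S := stk (memCode (pushVar m v x)) i o w t₁ t₂ t₃ a)
      (.inr .work) false hs
    simpa [natCode] using this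
  · simp only [space_stk, List.length_append, length_natCode] at hs ⊢
    omega
  · simp [memCode_pushVar, units_natCode_append]

theorem runs_dropVar (v : V) (x : ℕ)
    (hs : space (stk (memCode (pushVar m v x)) i o w t₁ t₂ t₃ a) ≤ s) :
    Runs s (dropNum (.inl v)) (stk (memCode (pushVar m v x)) i o w t₁ t₂ t₃ a)
      (stk (memCode m) i o w t₁ t₂ t₃ a) :=
  runs_dropNum _ x _ (r := memCode m v) (by simp [memCode_pushVar]) hs
    (by simp [memCode_pushVar])

theorem runs_getFirst (v : V) (x : ℕ) (hx : (m v).getD 0 0 = x)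
    (hs : space (stk (memCode m) i o w [] [] [] a) + x + 2 ≤ s) :
    Runs s (seq (litP 0) (getP v)) (stk (memCode m) i o w [] [] [] a)
      (stk (memCode m) i o (natCode x ++ w) [] [] [] a) := by
  subst hx
  refine Runs.seq (runs_litP _ i o w [] [] [] a 0 (by omega)) (runs_getP i o w a m v 0 ?_)
  simp only [space_stk, List.length_append, length_natCode] at hs ⊢
  omega

/-- Evaluating an expression leaves the memory as it is and pushes the value on the work stack. -/
theorem Expr.runs (e : Expr V) {B : ℕ} (hB : Expr.Below B m)
    (hs : space (stk (memCode m) i o w [] [] [] a) + e.sp B ≤ s) :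
    Runs s e.comp (stk (memCode m) i o w [] [] [] a)
      (stk (memCode m) i o (natCode (e.eval m) ++ w) [] [] [] a) := by
  induction e generalizing m w B with
  | lit n => exact runs_litP _ i o w [] [] [] a n hs
  | get A e he =>
    simp only [Expr.sp] at hs
    have h1 := e.eval_le_bd hB
    have h2 := hB.getD A (e.eval m)
    refine Runs.seq (he m w hB (by omega)) (runs_getP i o w a m A _ ?_)
    simp only [space_stk, List.length_append, length_natCode] at hs ⊢
    omega
  | add e f he hf =>
    simp only [Expr.sp] at hs
    have h1 := e.eval_le_bd hB
    have h2 := f.eval_le_bd hB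
    simp only [space_stk] at hs
    refine Runs.seq (he m w hB ?_) (Runs.seq (hf m _ hB ?_) (runs_addP _ i o w [] [] a _ _ ?_)) <;>
    · simp only [space_stk, List.length_append, length_natCode]
      omega
  | mul e f he hf =>
    simp only [Expr.sp] at hs
    have h1 := e.eval_le_bd hB
    have h2 := f.eval_le_bd hB
    have h3 := Nat.mul_le_mul h1 h2
    simp only [space_stk] at hs
    refine Runs.seq (he m w hB ?_) (Runs.seq (hf m _ hB ?_) (runs_mulP _ i o w a _ _ ?_)) <;>
    · simp only [space_stk, List.length_append, length_natCode]
      omega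
  | sub e f he hf =>
    simp only [Expr.sp] at hs
    have h1 := e.eval_le_bd hB
    have h2 := f.eval_le_bd hB
    simp only [space_stk] at hs
    refine Runs.seq (he m w hB ?_) (Runs.seq (hf m _ hB ?_) (runs_subP _ i o w [] [] a _ _ ?_)) <;>
    · simp only [space_stk, List.length_append, length_natCode]
      omega
  | loop cap acc j n init body hn hi hb =>
    simp only [Expr.sp] at hs
    have h1 := n.eval_le_bd hB
    have h2 := init.eval_le_bd hB
    simp only [space_stk, List.length_nil] at hs
    set b₀ := B + n.bd B + init.bd B with hb₀
    have hf0 : (Expr.loop cap acc j n init body).eval m = Nat.rec (motive := fun _ => ℕ)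
      (init.eval m) (fun x r => min ((pushVar (pushVar m j x) acc r cap).getD 0 0)
          (body.eval (pushVar (pushVar m j x) acc r))) (n.eval m) := rfl
    set f : ℕ → ℕ := Nat.rec (motive := fun _ => ℕ)
      (init.eval m) (fun x r => min ((pushVar (pushVar m j x) acc r cap).getD 0 0)
          (body.eval (pushVar (pushVar m j x) acc r))) with hf
    have hfs : ∀ x, f (x + 1) = min ((pushVar (pushVar m j x) acc (f x) cap).getD 0 0)
          (body.eval (pushVar (pushVar m j x) acc (f x))) := fun x => rfl
    have hbel : ∀ x ≤ n.bd B, ∀ r ≤ b₀, Expr.Below b₀ (pushVar (pushVar m j x) acc r) :=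
      fun x hx r hr => ((hB.mono (by omega)).pushVar j (by omega)).pushVar acc hr
    have hfb : ∀ x ≤ n.eval m, f x ≤ b₀ := by
      intro x
      induction x with
      | zero => intro _; change init.eval m ≤ b₀; omega
      | succ x ih =>
        intro hx
        rw [hfs]
        exact (min_le_left _ _).trans ((hbel x (by omega) _ (ih (by omega))).getD _ _)
    have main : ∀ r x, x + r = n.eval m → Runs s (count (.inr .work)
        (seq (seq (litP 0) (getP cap)) (seq (seq (litP 0) (getP cap)) (seq body.comp (seq subP
          (seq subP (seq (dropNum (.inl acc)) (seq (push (.inl j) true)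
            (seq (push (.inl acc) false) (moveUnits (.inr .work) (.inl acc)))))))))) skip)
        (stk (memCode (pushVar (pushVar m j x) acc (f x))) i o (natCode r ++ w) [] [] [] a)
        (stk (memCode (pushVar (pushVar m j (n.eval m)) acc (f (n.eval m)))) i o w [] [] [] a) := by
      intro r
      induction r with
      | zero =>
        intro x hx
        have hx' : x = n.eval m := by omega
        subst hx'
        have h4 := hfb _ le_rfl
        refine runs_count_zero (r := w) (by simp) ?_ ?_
        · simp only [space_stk, space_memCode_pushVar, List.length_append, length_natCode,
            List.length_nil]
          omega
        · rw [update_stk_work]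
          refine Runs.skip ?_
          simp only [space_stk, space_memCode_pushVar, List.length_nil]
          omega
      | succ r ih =>
        intro x hx
        have h4 := hfb x (by omega)
        have h5 := hfb (x + 1) (by omega)
        set m' := pushVar (pushVar m j x) acc (f x) with hm'
        have hm'B : Expr.Below b₀ m' := hbel x (by omega) _ h4
        have h6 := body.eval_le_bd hm'B
        have h7 := hm'B.getD cap 0
        have hsp : space (memCode m') = space (memCode m) + x + f x + 2 := by
          rw [hm', space_memCode_pushVar, space_memCode_pushVar]
          omega
        refine runs_count_succ (r := natCode r ++ w) (by simp [natCode_succ]) ?_ ?_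
          (ih (x + 1) (by omega))
        · simp only [space_stk, List.length_append, length_natCode, List.length_nil]
          omega
        rw [update_stk_work]
        have hmin : f (x + 1) = (m' cap).getD 0 0 - ((m' cap).getD 0 0 - body.eval m') := by
          rw [hfs, ← hm', Nat.sub_sub_eq_min]
        refine Runs.seq (runs_getFirst m' i o _ a cap _ rfl ?_)
          (Runs.seq (runs_getFirst m' i o _ a cap _ rfl ?_)
          (Runs.seq (hb m' _ hm'B ?_) (Runs.seq (runs_subP _ i o _ [] [] a _ _ ?_)
          (Runs.seq (runs_subP _ i o _ [] [] a _ _ ?_)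
          (Runs.seq (runs_dropVar (pushVar m j x) i o _ [] [] [] a acc (f x) ?_)
          (Runs.seq (runs_incVar m i o _ [] [] [] a j x ?_) ?_))))))
        · simp only [space_stk, List.length_append, length_natCode, List.length_nil]
          omega
        · simp only [space_stk, List.length_append, length_natCode, List.length_nil]
          omega
        · simp only [space_stk, List.length_append, length_natCode, List.length_nil]
          omega
        · simp only [space_stk, List.length_append, length_natCode, List.length_nil]
          omega
        · simp only [space_stk, List.length_append, length_natCode, List.length_nil]
          omega
        · simp only [space_stk, space_memCode_pushVar, List.length_append, length_natCode,
            List.length_nil]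
          omega
        · simp only [space_stk, space_memCode_pushVar, List.length_append, length_natCode,
            List.length_nil]
          omega
        · rw [← hmin]
          refine runs_pushFromWork (pushVar m j (x + 1)) i o _ [] [] [] a acc _ ?_
          simp only [space_stk, space_memCode_pushVar, List.length_append, length_natCode,
            List.length_nil]
          omega
    have h4 := hfb _ le_rfl
    rw [hf0]
    refine Runs.seq (hn m w hB ?_) (Runs.seq (hi m _ hB ?_)
      (Runs.seq (runs_pushZero m i o _ [] [] [] a j ?_)
      (Runs.seq (runs_pushFromWork _ i o _ [] [] [] a acc _ ?_)
      (Runs.seq (main (n.eval m) 0 (by omega))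
      (Runs.seq (runs_popToWork (pushVar m j (n.eval m)) i o w [] [] [] a acc _ ?_)
        (runs_dropVar m i o _ [] [] [] a j _ ?_))))))
    · simp only [space_stk, List.length_nil]
      omega
    all_goals
      simp only [space_stk, space_memCode_pushVar, List.length_append, length_natCode,
        List.length_nil]
      omega

end StackProg

/-! ### Commands and the rounds of an online machine -/

namespace StackProg

variable {V : Type} [DecidableEq V]

/-- Commands over a memory of arrays. `assign A t n body` replaces the array `A` by the array of
length `n` whose entries are the values of `body`, where the index is the first entry of the array
`t`; `loop e c` repeats `c` while `e` is not zero; `cond e c` executes `c` if `e` is not zero. -/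
inductive Cmd (V : Type) : Type
  | assign (A t : V) (n body : Expr V) : Cmd V
  | seq (c d : Cmd V) : Cmd V
  | loop (e : Expr V) (c : Cmd V) : Cmd V
  | cond (e : Expr V) (c : Cmd V) : Cmd V

namespace Cmd

/-- The memory after an assignment. -/
def assignMem (A t : V) (n body : Expr V) (m : V → List ℕ) : V → List ℕ :=
  Function.update m A ((List.range (n.eval m)).map fun j => body.eval (pushVar m t j))

/-- The command `c` transforms the memory `m` into `m'`, where all lengths and values that are
assigned are at most `B`. -/
inductive Exec (B : ℕ) : Cmd V → (V → List ℕ) → (V → List ℕ) → Prop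
  | assign {A t : V} {n body : Expr V} {m : V → List ℕ} (hn : n.eval m ≤ B)
      (hb : ∀ j < n.eval m, body.eval (pushVar m t j) ≤ B) :
      Exec B (assign A t n body) m (assignMem A t n body m)
  | seq {c d : Cmd V} {m₁ m₂ m₃ : V → List ℕ} : Exec B c m₁ m₂ → Exec B d m₂ m₃ →
      Exec B (seq c d) m₁ m₃
  | loop_done {e : Expr V} {c : Cmd V} {m : V → List ℕ} : e.eval m = 0 → Exec B (loop e c) m m
  | loop_cont {e : Expr V} {c : Cmd V} {m₁ m₂ m₃ : V → List ℕ} : e.eval m₁ ≠ 0 →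
      Exec B c m₁ m₂ → Exec B (loop e c) m₂ m₃ → Exec B (loop e c) m₁ m₃
  | cond_skip {e : Expr V} {c : Cmd V} {m : V → List ℕ} : e.eval m = 0 → Exec B (cond e c) m m
  | cond_exec {e : Expr V} {c : Cmd V} {m₁ m₂ : V → List ℕ} : e.eval m₁ ≠ 0 →
      Exec B c m₁ m₂ → Exec B (cond e c) m₁ m₂

/-- All arrays of the memory have length at most `B` and entries at most `B`. -/
def Fits (B : ℕ) (m : V → List ℕ) : Prop := ∀ v, (m v).length ≤ B ∧ ∀ x ∈ m v, x ≤ B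

theorem Fits.update {B : ℕ} {m : V → List ℕ} (h : Fits B m) (v : V) {l : List ℕ}
    (hl : l.length ≤ B) (hx : ∀ x ∈ l, x ≤ B) : Fits B (Function.update m v l) := by
  intro u
  by_cases huv : u = v
  · subst huv
    simpa using ⟨hl, hx⟩
  · simpa [huv] using h u

omit [DecidableEq V] in
theorem Fits.below {B : ℕ} {m : V → List ℕ} (h : Fits B m) : Expr.Below B m := fun v => (h v).2

theorem Exec.fits {B : ℕ} {c : Cmd V} {m m' : V → List ℕ} (h : Exec B c m m') (hm : Fits B m) :
    Fits B m' := by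
  induction h with
  | assign hn hb =>
    refine hm.update _ (by simpa using hn) fun x hx => ?_
    simp only [List.mem_map, List.mem_range] at hx
    obtain ⟨j, hj, rfl⟩ := hx
    exact hb j hj
  | seq _ _ h1 h2 => exact h2 (h1 hm)
  | loop_done _ => exact hm
  | loop_cont _ _ _ h1 h2 => exact h2 (h1 hm)
  | cond_skip _ => exact hm
  | cond_exec _ _ h1 => exact h1 hm

/-- The program of a command. -/
def comp : Cmd V → StackProg (V ⊕ Aux)
  | assign A t n body => .seq n.comp (.seq (.push (.inl t) false) (.seq (count (.inr .work)
      (.seq body.comp (.seq (shiftNum (.inr .work) (.inr .new)) (.push (.inl t) true))) .skip)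
      (.seq (dropNum (.inl t)) (.seq (clear (.inl A)) (pour (.inr .new) (.inl A))))))
  | seq c d => .seq c.comp d.comp
  | loop e c => .seq e.comp (count (.inr .work)
      (.seq (dropNum (.inr .work)) (.seq c.comp e.comp)) .skip)
  | cond e c => .seq e.comp (count (.inr .work)
      (.seq (dropNum (.inr .work)) (.seq c.comp (.push (.inr .work) false))) .skip)

/-- A bound for the additional space that a command needs if all lengths and values in the memory
are at most `B` throughout. -/
def sp : Cmd V → ℕ → ℕ
  | assign _ _ n body, B => n.sp B + body.sp B + B * (B + 1) + 4 * (B + 1)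
  | seq c d, B => c.sp B + d.sp B
  | loop e c, B => e.sp B + e.bd B + c.sp B + 2
  | cond e c, B => e.sp B + e.bd B + c.sp B + 2

omit [DecidableEq V] in
theorem exists_polynomial_sp (c : Cmd V) : ∃ p : Polynomial ℕ, ∀ B, p.eval B = c.sp B := by
  induction c with
  | assign A t n body =>
    obtain ⟨p, hp⟩ := n.exists_polynomial_sp
    obtain ⟨q, hq⟩ := body.exists_polynomial_sp
    exact ⟨p + q + .X * (.X + 1) + 4 * (.X + 1), by simp [sp, hp, hq]⟩
  | seq c d hc hd =>
    obtain ⟨p, hp⟩ := hc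
    obtain ⟨q, hq⟩ := hd
    exact ⟨p + q, by simp [sp, hp, hq]⟩
  | loop e c hc =>
    obtain ⟨p, hp⟩ := hc
    obtain ⟨q, hq⟩ := e.exists_polynomial_sp
    obtain ⟨r, hr⟩ := e.exists_polynomial_bd
    exact ⟨q + r + p + 2, by simp [sp, hp, hq, hr]⟩
  | cond e c hc =>
    obtain ⟨p, hp⟩ := hc
    obtain ⟨q, hq⟩ := e.exists_polynomial_sp
    obtain ⟨r, hr⟩ := e.exists_polynomial_bd
    exact ⟨q + r + p + 2, by simp [sp, hp, hq, hr]⟩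

theorem length_listCode_le {B : ℕ} (l : List ℕ) (h : ∀ x ∈ l, x ≤ B) :
    (listCode l).length ≤ l.length * (B + 1) := by
  induction l with
  | nil => simp
  | cons x l ih =>
    have h1 := h x (by simp)
    have h2 := ih fun y hy => h y (by simp [hy])
    rw [length_listCode_cons, List.length_cons, Nat.succ_mul]
    omega

variable [Fintype V] {s : ℕ}

omit [DecidableEq V] in
theorem Fits.space_le {B : ℕ} {m : V → List ℕ} (h : Fits B m) :
    space (memCode m) ≤ Fintype.card V * (B * (B + 1)) := by
  refine (Finset.sum_le_card_nsmul _ _ (B * (B + 1)) fun v _ => ?_).trans (by simp)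
  exact (length_listCode_le _ (h v).2).trans (Nat.mul_le_mul_right _ (h v).1)

/-- The stacks that represent a memory between two commands. -/
def memStk (m : V → List ℕ) : V ⊕ Aux → List Bool := stk (memCode m) [] [] [] [] [] [] []

/-- A bound for the space of the execution of a command. -/
def totalSpace (c : Cmd V) (B : ℕ) : ℕ := Fintype.card V * (B * (B + 1)) + c.sp B

theorem runs_assign (A t : V) (n body : Expr V) (m : V → List ℕ) {B : ℕ} (hm : Fits B m)
    (hn : n.eval m ≤ B) (hb : ∀ j < n.eval m, body.eval (pushVar m t j) ≤ B)
    (hs : (assign A t n body).totalSpace B ≤ s) :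
    Runs s (assign A t n body).comp (memStk m) (memStk (assignMem A t n body m)) := by
  have hsp := hm.space_le
  simp only [totalSpace, sp] at hs
  set f := fun j => body.eval (pushVar m t j) with hf
  set N := n.eval m with hN
  have hlen : ∀ x ≤ N, (listCode ((List.range x).map f)).length ≤ B * (B + 1) := by
    intro x hx
    refine (length_listCode_le (B := B) _ ?_).trans ?_
    · intro y hy
      simp only [List.mem_map, List.mem_range] at hy
      obtain ⟨j, hj, rfl⟩ := hy
      exact hb j (by omega)
    · simp only [List.length_map, List.length_range]
      exact Nat.mul_le_mul_right _ (hx.trans hn)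
  have main : ∀ r x, x + r = N → Runs s (count (.inr .work)
      (.seq body.comp (.seq (shiftNum (.inr .work) (.inr .new)) (.push (.inl t) true))) .skip)
      (stk (memCode (pushVar m t x)) [] [] (natCode r) [] [] []
        (listCode ((List.range x).map f)).reverse)
      (stk (memCode (pushVar m t N)) [] [] [] [] [] []
        (listCode ((List.range N).map f)).reverse) := by
    intro r
    induction r with
    | zero =>
      intro x hx
      have hx' : x = N := by omega
      have h1 := hlen N le_rfl
      rw [hx']
      refine runs_count_zero (r := []) (by simp) ?_ ?_
      · simp only [space_stk, space_memCode_pushVar, List.length_reverse, length_natCode,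
          List.length_nil]
        omega
      · rw [update_stk_work]
        refine Runs.skip ?_
        simp only [space_stk, space_memCode_pushVar, List.length_reverse, List.length_nil]
        omega
    | succ r ih =>
      intro x hx
      have h1 := hlen x (by omega)
      have h2 := hlen (x + 1) (by omega)
      have h3 : (listCode ((List.range (x + 1)).map f)).reverse =
          (natCode (f x)).reverse ++ (listCode ((List.range x).map f)).reverse := by
        simp [List.range_succ, listCode]
      have h3' := congrArg List.length h3
      simp only [List.length_reverse, List.length_append, length_natCode] at h3'
      have h4 := hb x (by omega)
      refine runs_count_succ (r := natCode r) (by simp [natCode_succ]) ?_ ?_ (ih (x + 1) (by omega))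
      · simp only [space_stk, space_memCode_pushVar, List.length_reverse, length_natCode,
          List.length_nil]
        omega
      rw [update_stk_work]
      refine Runs.seq (Expr.runs _ _ _ _ _ body (hm.below.pushVar t (x := x) (by omega)) ?_)
        (Runs.seq (runs_shiftNum (by simp) (f x) _ (r := natCode r) (by simp [f]) ?_ rfl) ?_)
      · simp only [space_stk, space_memCode_pushVar, List.length_reverse, length_natCode,
          List.length_nil]
        omega
      · simp only [space_stk, space_memCode_pushVar, List.length_reverse, length_natCode,
          List.length_nil, List.length_append]
        change _ + (f x + 1 + _) + _ + _ + _ + _ ≤ _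
        omega
      · rw [h3]
        have := runs_incVar (s := s) m [] [] (natCode r) [] [] []
          ((natCode (f x)).reverse ++ (listCode ((List.range x).map f)).reverse) t x (by
            simp only [space_stk, space_memCode_pushVar, List.length_reverse, length_natCode,
              List.length_nil, List.length_append]
            omega)
        simpa using this
  have h1 := hlen N le_rfl
  refine Runs.seq (Expr.runs m [] [] [] [] n hm.below ?_) (Runs.seq
    (runs_pushZero m [] [] _ [] [] [] [] t ?_) (Runs.seq (S₁ := stk (memCode (pushVar m t N))
      [] [] [] [] [] [] (listCode ((List.range N).map f)).reverse) ?_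
    (Runs.seq (runs_dropVar m [] [] [] [] [] [] _ t N ?_)
    (Runs.seq (runs_clear _ _ rfl ?_ rfl) (runs_pour (by simp) _ _ rfl ?_ ?_)))))
  · simp only [space_stk, List.length_nil]
    omega
  · simp only [space_stk, List.length_nil, List.length_append, length_natCode]
    omega
  · simpa using main N 0 (by omega)
  · simp only [space_stk, space_memCode_pushVar, List.length_reverse, List.length_nil]
    omega
  · simp only [space_stk, List.length_reverse, List.length_nil]
    omega
  · have := space_update (memCode m) A []
    simp only [update_stk_var, space_stk, List.length_reverse, List.length_nil] at this ⊢
    omega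
  · simp only [memStk, assignMem, ← update_memCode, update_stk_var, stk_new, List.reverse_reverse,
      update_stk_new, Function.update_self, List.append_nil, Function.update_idem]
    rfl

/-- The program of a command realizes every bounded execution. -/
theorem Exec.runs {B : ℕ} {c : Cmd V} {m m' : V → List ℕ} (h : Exec B c m m') (hm : Fits B m)
    (hs : c.totalSpace B ≤ s) : Runs s c.comp (memStk m) (memStk m') := by
  have hsp : ∀ {m : V → List ℕ}, Fits B m → space (memCode m) ≤ _ := fun h => h.space_le
  have hdrop : ∀ (m : V → List ℕ) (x : ℕ), space (memCode m) + x + 1 ≤ s →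
      Runs s (dropNum (.inr .work)) (stk (memCode m) [] [] (natCode x) [] [] [] []) (memStk m) :=
    fun m x h => runs_dropNum _ x _ (r := []) (by simp) (by simpa [space_stk, add_assoc] using h)
      (by simp [memStk])
  have heval : ∀ (e : Expr V) (m : V → List ℕ), Fits B m → space (memCode m) + e.sp B ≤ s →
      Runs s e.comp (memStk m) (stk (memCode m) [] [] (natCode (e.eval m)) [] [] [] []) := by
    intro e m hm h
    have := Expr.runs (s := s) m [] [] [] [] e hm.below (by simpa [space_stk] using h)
    simpa [memStk] using this
  have hloop : ∀ (e : Expr V) (p : StackProg (V ⊕ Aux)) (m : V → List ℕ), e.eval m = 0 →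
      space (memCode m) + 1 ≤ s →
      Runs s (count (.inr .work) p .skip)
        (stk (memCode m) [] [] (natCode (e.eval m)) [] [] [] []) (memStk m) := by
    intro e p m he h
    refine runs_count_zero (r := []) (by simp [he]) (by simpa [space_stk, he] using h) ?_
    rw [update_stk_work]
    exact Runs.skip (by simp only [space_stk, List.length_nil]; omega)
  -- the body of a loop ends with the evaluation of the condition, so a loop is also described from
  -- the moment at which its condition has been evaluated
  suffices H : Runs s c.comp (memStk m) (memStk m') ∧ ∀ e d, c = Cmd.loop e d →
      Runs s (count (.inr .work) (.seq (dropNum (.inr .work)) (.seq d.comp e.comp)) .skip)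
        (stk (memCode m) [] [] (natCode (e.eval m)) [] [] [] []) (memStk m') from H.1
  induction h with
  | assign hn hb => exact ⟨runs_assign _ _ _ _ _ hm hn hb hs, by simp⟩
  | seq h1 h2 ih1 ih2 =>
    simp only [totalSpace, sp] at hs
    exact ⟨Runs.seq (ih1 hm (by simp only [totalSpace]; omega)).1
      (ih2 (h1.fits hm) (by simp only [totalSpace]; omega)).1, by simp⟩
  | loop_done he =>
    simp only [totalSpace, sp] at hs
    have := hsp hm
    refine ⟨Runs.seq (heval _ _ hm (by omega)) (hloop _ _ _ he (by omega)), ?_⟩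
    rintro e d ⟨⟩
    exact hloop _ _ _ he (by omega)
  | @loop_cont e c m₁ m₂ m₃ he h1 h2 ih1 ih2 =>
    have hs' := hs
    simp only [totalSpace, sp] at hs
    have h3 := hsp hm
    have h4 := hsp (h1.fits hm)
    have h5 := e.eval_le_bd hm.below
    have key : Runs s (count (.inr .work) (.seq (dropNum (.inr .work)) (.seq c.comp e.comp)) .skip)
        (stk (memCode m₁) [] [] (natCode (e.eval m₁)) [] [] [] []) (memStk m₃) := by
      have ih2' := (ih2 (h1.fits hm) hs').2 e c rfl
      obtain ⟨x, hx⟩ := Nat.exists_eq_succ_of_ne_zero he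
      rw [hx] at h5 ⊢
      refine runs_count_succ (r := natCode x) (by simp [natCode_succ])
        (by simp only [space_stk, List.length_nil, length_natCode]; omega)
        (Runs.seq (S₁ := memStk m₁) ?_ (Runs.seq (ih1 hm (by simp only [totalSpace]; omega)).1
          (heval e m₂ (h1.fits hm) (by omega)))) ih2'
      rw [update_stk_work]
      exact hdrop _ _ (by omega)
    refine ⟨Runs.seq (heval _ _ hm (by omega)) key, ?_⟩
    rintro e d ⟨⟩
    exact key
  | cond_skip he =>
    simp only [totalSpace, sp] at hs
    have := hsp hm
    exact ⟨Runs.seq (heval _ _ hm (by omega)) (hloop _ _ _ he (by omega)), by simp⟩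
  | @cond_exec e c m₁ m₂ he h1 ih1 =>
    simp only [totalSpace, sp] at hs
    have h3 := hsp hm
    have h4 := hsp (h1.fits hm)
    have h5 := e.eval_le_bd hm.below
    refine ⟨Runs.seq (heval e m₁ hm (by omega)) ?_, by simp⟩
    obtain ⟨x, hx⟩ := Nat.exists_eq_succ_of_ne_zero he
    rw [hx] at h5 ⊢
    have hpush := Runs.push (s := s) (S := memStk m₂) (.inr .work) false (by
      simp only [memStk, space_stk, List.length_nil]
      omega)
    refine runs_count_succ (r := natCode x) (by simp [natCode_succ])
      (by simp only [space_stk, List.length_nil, length_natCode]; omega)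
      (Runs.seq (S₁ := memStk m₁) ?_
        (Runs.seq (ih1 hm (by simp only [totalSpace]; omega)).1 hpush))
      (runs_count_zero (r := []) (by simp [memStk, natCode]) ?_ ?_)
    · rw [update_stk_work]
      exact hdrop _ _ (by omega)
    · simp only [memStk, update_stk_work, stk_work, space_stk, List.length_nil, List.length_cons]
      omega
    · simp only [memStk, update_stk_work]
      refine Runs.skip ?_
      simp only [space_stk, List.length_nil]
      omega

end Cmd

/-! ### Input and output -/

/-- The program of a round: the number of units of the input word is stored in the variable `x`,
the command `c` is executed, and if the value of the expression `e` is `y + 1`, then the code of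
`y` is the output. -/
def roundProg (x : V) (c : Cmd V) (e : Expr V) : StackProg (V ⊕ Aux) :=
  .seq (clear (.inl x)) (.seq (push (.inl x) false) (.seq (moveUnits (.inr .inp) (.inl x))
    (.seq c.comp (.seq e.comp (.loop (.inr .work) (fun _ => false) fun y =>
      if y then .seq (push (.inr .out) false) (moveUnits (.inr .work) (.inr .out)) else .skip)))))

/-- The output word for the value of the output expression. -/
def outWord : ℕ → List Bool
  | 0 => []
  | y + 1 => natCode y

/-- A bound for the space of a round. -/
def roundSpace [Fintype V] (c : Cmd V) (e : Expr V) (B : ℕ) : ℕ :=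
  c.totalSpace B + e.sp B + e.bd B + B + 3

omit [DecidableEq V] in
theorem exists_polynomial_roundSpace [Fintype V] (c : Cmd V) (e : Expr V) :
    ∃ p : Polynomial ℕ, ∀ B, p.eval B = roundSpace c e B := by
  obtain ⟨p, hp⟩ := c.exists_polynomial_sp
  obtain ⟨q, hq⟩ := e.exists_polynomial_sp
  obtain ⟨r, hr⟩ := e.exists_polynomial_bd
  exact ⟨(Fintype.card V : Polynomial ℕ) * (.X * (.X + 1)) + p + q + r + .X + 3, by
    simp [roundSpace, Cmd.totalSpace, hp, hq, hr]⟩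

/-- A word with `n` units that is the input of a round: a single bit, or the code of `n`. -/
inductive IsInput : List Bool → ℕ → Prop
  | bit : IsInput [true] 1
  | code (n : ℕ) : IsInput (natCode n) n

theorem round_roundProg [Fintype V] {B : ℕ} {x : V} {c : Cmd V} {e : Expr V}
    {m m' : V → List ℕ} {word : List Bool} {n : ℕ} (hw : IsInput word n) (hn : n ≤ B) (hB : 1 ≤ B)
    (hm : Cmd.Fits B m) (h : Cmd.Exec B c (Function.update m x [n]) m') :
    ((roundProg x c e).toOnlineTM (.inr .inp) (.inr .out)).Round (roundSpace c e B)
      (none, Cmd.memStk m) word (outWord (e.eval m')) (none, Cmd.memStk m') := by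
  have hm1 : Cmd.Fits B (Function.update m x [n]) := hm.update x (by simpa using hB) (by simpa)
  have hm2 := h.fits hm1
  have hs := hm.space_le
  have hs1 := hm1.space_le
  have hs2 := hm2.space_le
  have hlen : word.length ≤ B + 1 := by
    cases hw <;> simp; all_goals omega
  have hbd := e.eval_le_bd hm2.below
  have hx1 : memCode (Function.update m x [n]) = Function.update (memCode m) x (natCode n) := by
    rw [← update_memCode]
    simp
  have hx0 := space_update (memCode m) x []
  have hx0' := space_update (memCode m) x (natCode n)
  have hx0'' := space_update (memCode m) x (natCode 0)
  simp only [List.length_nil, length_natCode] at hx0 hx0' hx0''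
  have ht : roundSpace c e B = c.totalSpace B + e.sp B + e.bd B + B + 3 := rfl
  have htt : c.totalSpace B = Fintype.card V * (B * (B + 1)) + c.sp B := rfl
  have hinp : Function.update (Cmd.memStk m) (.inr .inp) (word ++ Cmd.memStk m (.inr .inp)) =
      stk (memCode m) word [] [] [] [] [] [] := by simp [Cmd.memStk]
  have hout : Cmd.memStk m' = Function.update (stk (memCode m') [] (outWord (e.eval m'))
      [] [] [] [] []) (.inr .out) [] := by simp [Cmd.memStk]
  rw [hout]
  refine Runs.round ?_ ?_ (by simp) ?_
  · rw [hinp]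
    simp only [space_stk, List.length_nil]
    omega
  · rw [hinp]
    refine Runs.seq (runs_clear _ _ rfl ?_ rfl) (Runs.seq (S₁ := stk (Function.update (memCode m) x
      (natCode 0)) word [] [] [] [] [] []) ?_ (Runs.seq
        (S₁ := Cmd.memStk (Function.update m x [n])) ?_
      (Runs.seq (h.runs hm1 (by omega)) (Runs.seq (Expr.runs m' [] [] [] [] e hm2.below ?_) ?_))))
    · simp only [space_stk, List.length_nil]
      omega
    · have := Runs.push (s := roundSpace c e B) (S := stk (Function.update (memCode m) x [])
        word [] [] [] [] [] []) (.inl x) false (by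
          simp only [space_stk, List.length_nil]
          omega)
      simpa [natCode] using this
    · cases hw with
      | bit =>
        refine runs_moveUnits_nil (by simp) 1 _ (by simp) ?_ ?_
        · simp only [space_stk, List.length_nil, List.length_cons] at hlen ⊢
          omega
        · simp [Cmd.memStk, hx1, natCode]
      | code n =>
        refine runs_moveUnits (by simp) n _ (r := []) (by simp) ?_ ?_
        · simp only [space_stk, List.length_nil, length_natCode] at hlen ⊢
          omega
        · simp [Cmd.memStk, hx1, units_natCode]
    · simp only [space_stk, List.length_nil]
      omega
    · cases he : e.eval m' with
      | zero =>
        refine Runs.loop_done (y := false) (r := []) (by simp [natCode]) ?_ rfl ?_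
        · simp only [space_stk, List.length_nil, List.length_append, length_natCode]
          omega
        · rw [update_stk_work]
          refine Runs.skip ?_
          simp only [space_stk, List.length_nil]
          omega
      | succ y =>
        refine Runs.loop_done (y := true) (r := natCode y) (by simp [natCode_succ]) ?_ rfl ?_
        · simp only [space_stk, List.length_nil, List.length_append, length_natCode]
          omega
        · rw [update_stk_work]
          refine Runs.seq (Runs.push _ _ ?_) (runs_moveUnits (by simp) y _ (r := []) (by simp) ?_
            (by simp [outWord, natCode]))
          · simp only [space_stk, List.length_nil, length_natCode]
            omega
          · simp only [update_stk_out, stk_out, space_stk, List.length_nil, length_natCode,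
              List.length_cons]
            omega
  · simp only [space_stk, List.length_nil]
    have : (outWord (e.eval m')).length ≤ e.bd B + 1 := by
      cases he : e.eval m' with
      | zero => simp [outWord]
      | succ y => simp [outWord]; omega
    omega

end StackProg

/-! ### One-player games and positional strategies -/

open Filter in
/-- The largest number that occurs infinitely often in the sequence `e` exists and is even. -/
def ParityWin (e : ℕ → ℕ) : Prop :=
  ∃ d, Even d ∧ (∃ᶠ i in atTop, e i = d) ∧ ∀ᶠ i in atTop, e i ≤ d

/-- The winning condition of player 2 on the sequence of the colours of the moves. -/
def Objective.Wins : Objective → (ℕ → ℕ) → Prop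
  | .reachability, e => ∃ i, Even (e i)
  | .buchi, e => ParityWin e
  | .parity, e => ParityWin e

open Filter in
theorem parityWin_tail (e : ℕ → ℕ) (t : ℕ) : ParityWin (fun i => e (i + t)) ↔ ParityWin e := by
  unfold ParityWin
  refine exists_congr fun d => and_congr_right fun _ => and_congr ?_ ?_
  · have := map_add_atTop_eq_nat t
    conv_rhs => rw [← this, frequently_map]
  · have := map_add_atTop_eq_nat t
    conv_rhs => rw [← this, eventually_map]

theorem Objective.Wins.of_tail {o : Objective} {e : ℕ → ℕ} {t : ℕ}
    (h : o.Wins fun i => e (i + t)) : o.Wins e := by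
  cases o with
  | reachability =>
    obtain ⟨i, hi⟩ := h
    exact ⟨_, hi⟩
  | buchi => exact (parityWin_tail e t).1 h
  | parity => exact (parityWin_tail e t).1 h

/-- Player 2 can move from the states in `W` to `T` along allowed moves, by a positional strategy
that decreases a rank. -/
theorem exists_attractor {Q B : Type*} [Nonempty B] (step : Q → B → Q) (Al : Q → B → Prop)
    (T : Q → Prop) : ∃ (g : Q → B) (rank : Q → ℕ) (W : Q → Prop), (∀ q, T q → W q) ∧
      (∀ q b, Al q b → W (step q b) → W q) ∧
      ∀ q, W q → ¬ T q → Al q (g q) ∧ W (step q (g q)) ∧ rank (step q (g q)) < rank q := by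
  classical
  let R : ℕ → Q → Prop := fun n => Nat.rec (motive := fun _ => Q → Prop) T
    (fun _ r q => ∃ b, Al q b ∧ r (step q b)) n
  have hex : ∀ q, ∃ b, (∃ n, R n q) → ¬ T q → Al q b ∧ (∃ n, R n (step q b)) ∧
      sInf {n | R n (step q b)} < sInf {n | R n q} := by
    intro q
    by_cases hq : (∃ n, R n q) ∧ ¬ T q
    · have hmem : sInf {n | R n q} ∈ {n | R n q} := Nat.sInf_mem hq.1
      cases hn : sInf {n | R n q} with
      | zero =>
        rw [hn] at hmem
        exact absurd hmem hq.2
      | succ n =>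
        rw [hn] at hmem
        obtain ⟨b, hb, hr⟩ := hmem
        exact ⟨b, fun _ _ => ⟨hb, ⟨n, hr⟩, Nat.lt_succ_of_le (Nat.sInf_le hr)⟩⟩
    · exact ⟨Classical.arbitrary B, fun h1 h2 => absurd ⟨h1, h2⟩ hq⟩
  choose g hg using hex
  exact ⟨g, fun q => sInf {n | R n q}, fun q => ∃ n, R n q, fun q hq => ⟨0, hq⟩,
    fun q b hb ⟨n, hn⟩ => ⟨n + 1, b, hb, hn⟩, hg⟩

section orbit

variable {Q : Type*} (f : Q → Q)

theorem exists_lt_iterate_eq [Fintype Q] {P : ℕ} (hP : Fintype.card Q ≤ P) (x : Q) (i : ℕ) :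
    ∃ j < P, f^[j] x = f^[i] x := by
  induction i using Nat.strong_induction_on with
  | _ i ih =>
    by_cases hi : i < P
    · exact ⟨i, hi, rfl⟩
    obtain ⟨p, q, hpq, h⟩ := Fintype.exists_ne_map_eq_of_card_lt
      (fun j : Fin (P + 1) => f^[j] x) (by simpa using Nat.lt_succ_of_le hP)
    wlog hlt : p < q generalizing p q
    · exact this q p hpq.symm h.symm (lt_of_le_of_ne (not_lt.1 hlt) hpq.symm)
    have hlt' : (p : ℕ) < q := hlt
    have hq := q.2
    obtain ⟨j, hj, hj'⟩ := ih (i - q + p) (by omega)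
    refine ⟨j, hj, hj'.trans ?_⟩
    rw [Function.iterate_add_apply]
    have : i = (i - q) + q := by omega
    conv_rhs => rw [this, Function.iterate_add_apply]
    exact congrArg _ h

theorem exists_window_iterate_eq [Fintype Q] {P : ℕ} (hP : Fintype.card Q ≤ P) (x : Q) {i : ℕ}
    (hi : P ≤ i) : ∃ j < P, f^[P + j] x = f^[i] x := by
  obtain ⟨j, hj, h⟩ := exists_lt_iterate_eq f hP (f^[P] x) (i - P)
  refine ⟨j, hj, ?_⟩
  rw [← Function.iterate_add_apply, ← Function.iterate_add_apply] at h
  rw [add_comm, h, Nat.sub_add_cancel hi]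

open Filter in
theorem frequently_iterate_eq [Fintype Q] {P : ℕ} (hP : Fintype.card Q ≤ P) (x : Q) {j : ℕ}
    (hj : P ≤ j) : ∃ᶠ i in atTop, f^[i] x = f^[j] x := by
  obtain ⟨p, q, hpq, h⟩ := Fintype.exists_ne_map_eq_of_card_lt
    (fun j : Fin (P + 1) => f^[j] x) (by simpa using Nat.lt_succ_of_le hP)
  wlog hlt : p < q generalizing p q
  · exact this q p hpq.symm h.symm (lt_of_le_of_ne (not_lt.1 hlt) hpq.symm)
  have hlt' : (p : ℕ) < q := hlt
  have hp := p.2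
  have hq := q.2
  have hper : ∀ n, f^[j + n * (q - p)] x = f^[j] x := by
    intro n
    induction n with
    | zero => simp
    | succ n ih =>
      have h1 : j + (n + 1) * (q - p) = (j - p + n * (q - p)) + q := by
        rw [Nat.succ_mul]; omega
      have h2 : j + n * (q - p) = (j - p + n * (q - p)) + p := by omega
      rw [← ih, h1, h2, Function.iterate_add_apply _ _ (q : ℕ),
        Function.iterate_add_apply _ _ (p : ℕ)]
      exact congrArg _ h.symm
  rw [frequently_atTop]
  intro N
  refine ⟨j + N * (q - p), ?_, hper N⟩
  have : N * 1 ≤ N * (q - p) := Nat.mul_le_mul_left N (by omega)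
  omega

/-- On a finite set, the parity condition along the orbit of `x` is decided by a window: it holds if
an even colour dominates the orbit between the times `P` and `2 * P`. -/
theorem parityWin_orbit_iff [Fintype Q] {P : ℕ} (hP : Fintype.card Q ≤ P) (c : Q → ℕ) (x : Q) :
    ParityWin (fun i => c (f^[i] x)) ↔
      ∃ i < P, Even (c (f^[P + i] x)) ∧ ∀ j < P, c (f^[P + j] x) ≤ c (f^[P + i] x) := by
  constructor
  · rintro ⟨d, hd, hfr, hev⟩
    obtain ⟨i, hi, hid⟩ := Filter.frequently_atTop.1 hfr P
    dsimp only at hid hev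
    obtain ⟨j, hj, hji⟩ := exists_window_iterate_eq f hP x hi
    refine ⟨j, hj, by rw [hji, hid]; exact hd, fun j' _ => ?_⟩
    rw [hji, hid]
    obtain ⟨l, hl, hl'⟩ := ((frequently_iterate_eq f hP x (Nat.le_add_right P j')).and_eventually
      hev).exists
    rwa [hl] at hl'
  · rintro ⟨i, hi, hev, hmax⟩
    refine ⟨_, hev, (frequently_iterate_eq f hP x (Nat.le_add_right P i)).mono
      fun l hl => congrArg c hl, Filter.eventually_atTop.2 ⟨P, fun l hl => ?_⟩⟩
    obtain ⟨j, hj, hji⟩ := exists_window_iterate_eq f hP x hl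
    dsimp only
    rw [← hji]
    exact hmax j hj

end orbit

section positional

variable {Q B : Type*} (step : Q → B → Q) (col : Q → B → ℕ)

/-- The colours of the moves if player 2 uses the positional strategy `g` from the state `q`. -/
def orbitCol (g : Q → B) (q : Q) (i : ℕ) : ℕ :=
  col ((fun q => step q (g q))^[i] q) (g ((fun q => step q (g q))^[i] q))

theorem orbitCol_succ (g : Q → B) (q : Q) (i : ℕ) :
    orbitCol step col g (step q (g q)) i = orbitCol step col g q (i + 1) := rfl

open Filter in
/-- Positional determinacy of one-player parity games: a rank decreases until player 2 can stay
among colours at most `d`, and then a second rank decreases until the move of colour `d`. -/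
theorem exists_positional_parityWin [Finite Q] {qs : ℕ → Q} {bs : ℕ → B}
    (hqs : ∀ i, qs (i + 1) = step (qs i) (bs i))
    (h : ParityWin fun i => col (qs i) (bs i)) :
    ∃ g : Q → B, ParityWin (orbitCol step col g (qs 0)) := by
  classical
  have : Nonempty B := ⟨bs 0⟩
  obtain ⟨d, hd, hfr, hev⟩ := h
  obtain ⟨t, ht⟩ := eventually_atTop.1 hev
  obtain ⟨q, hq⟩ : ∃ q, ∃ᶠ i in atTop, qs i = q ∧ col (qs i) (bs i) = d := by
    by_contra hcon
    push Not at hcon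
    have : ∀ᶠ i in atTop, ∀ q, ¬ (qs i = q ∧ col (qs i) (bs i) = d) :=
      eventually_all.2 fun q => not_frequently.1 (by simpa using hcon q)
    exact hfr (this.mono fun i hi hid => hi _ ⟨rfl, hid⟩)
  obtain ⟨r, hr, hrq, hrd⟩ := frequently_atTop.1 hq t
  obtain ⟨g₁, rk₁, W₁, hT₁, hW₁, hg₁⟩ :=
    exists_attractor step (fun q b => col q b ≤ d) (fun x => x = q)
  obtain ⟨g₂, rk₂, W₂, hT₂, hW₂, hg₂⟩ := exists_attractor step (fun _ _ => True) W₁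
  -- states visited after time `t` can reach `q` with colours at most `d`
  have hin : ∀ i, t ≤ i → W₁ (qs i) := by
    intro i hi
    obtain ⟨l, hl, hlq, -⟩ := frequently_atTop.1 hq i
    obtain ⟨n, rfl⟩ := Nat.exists_eq_add_of_le hl
    clear hl
    induction n generalizing i with
    | zero => exact hT₁ _ hlq
    | succ n ih =>
      refine hW₁ _ _ (ht i hi) ?_
      rw [← hqs]
      refine ih (i + 1) (by omega) ?_
      rwa [show i + 1 + n = i + (n + 1) by ring]
  have hin₂ : ∀ n i, i + n = t → W₂ (qs i) := by
    intro n
    induction n with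
    | zero => exact fun i hi => hT₂ _ (hin i hi.ge)
    | succ n ih =>
      intro i hi
      refine hW₂ _ (bs i) trivial ?_
      rw [← hqs]
      exact ih (i + 1) (by omega)
  let g : Q → B := fun x => if x = q then bs r else if W₁ x then g₁ x else g₂ x
  have hstay : ∀ x, W₁ x → W₁ (step x (g x)) ∧ col x (g x) ≤ d := by
    intro x hx
    by_cases hxq : x = q
    · subst hxq
      simp only [g, if_true]
      refine ⟨?_, ?_⟩
      · rw [← hrq, ← hqs]
        exact hin _ (by omega)
      · rw [← hrq, hrd]
    · simp only [g, hxq, hx, if_true, if_false]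
      exact ⟨(hg₁ x hx hxq).2.1, (hg₁ x hx hxq).1⟩
  set F : Q → Q := fun x => step x (g x) with hF
  have hstay' : ∀ n x, W₁ x → W₁ (F^[n] x) := by
    intro n
    induction n with
    | zero => exact fun x hx => hx
    | succ n ih => exact fun x hx => ih _ (hstay x hx).1
  have hreach : ∀ n x, rk₁ x = n → W₁ x → ∃ l, F^[l] x = q := by
    intro n
    induction n using Nat.strong_induction_on with
    | _ n ih =>
      intro x hxn hx
      by_cases hxq : x = q
      · exact ⟨0, hxq⟩
      obtain ⟨-, h2, h3⟩ := hg₁ x hx hxq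
      have hgx : F x = step x (g₁ x) := by simp [hF, g, hxq, hx]
      obtain ⟨l, hl⟩ := ih _ (hxn ▸ h3) _ rfl h2
      exact ⟨l + 1, by rw [Function.iterate_succ_apply, hgx, hl]⟩
  have hreach₂ : ∀ n x, rk₂ x = n → W₂ x → ∃ l, W₁ (F^[l] x) := by
    intro n
    induction n using Nat.strong_induction_on with
    | _ n ih =>
      intro x hxn hx
      by_cases hx₁ : W₁ x
      · exact ⟨0, hx₁⟩
      obtain ⟨-, h2, h3⟩ := hg₂ x hx hx₁
      have hxq : x ≠ q := fun h => hx₁ (hT₁ _ h)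
      have hgx : F x = step x (g₂ x) := by simp [hF, g, hxq, hx₁]
      obtain ⟨l, hl⟩ := ih _ (hxn ▸ h3) _ rfl h2
      exact ⟨l + 1, by rw [Function.iterate_succ_apply, hgx]; exact hl⟩
  obtain ⟨l, hl⟩ := hreach₂ _ _ rfl (hin₂ t 0 (by omega))
  have hlate : ∀ i, l ≤ i → W₁ (F^[i] (qs 0)) := by
    intro i hi
    obtain ⟨n, rfl⟩ := Nat.exists_eq_add_of_le hi
    rw [add_comm, Function.iterate_add_apply]
    exact hstay' n _ hl
  refine ⟨g, d, hd, frequently_atTop.2 fun N => ?_, eventually_atTop.2 ⟨l, fun i hi => ?_⟩⟩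
  · obtain ⟨n, hn⟩ := hreach _ _ rfl (hlate (l + N) (by omega))
    refine ⟨n + (l + N), by omega, ?_⟩
    have hq' : F^[n + (l + N)] (qs 0) = q := by rw [Function.iterate_add_apply, hn]
    change col (F^[n + (l + N)] (qs 0)) (g (F^[n + (l + N)] (qs 0))) = d
    rw [hq']
    simp only [g, if_true]
    rw [← hrq, hrd]
  · exact (hstay _ (hlate i hi)).2

theorem exists_positional_reach {qs : ℕ → Q} {bs : ℕ → B}
    (hqs : ∀ i, qs (i + 1) = step (qs i) (bs i)) {n : ℕ} (h : Even (col (qs n) (bs n))) :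
    ∃ g : Q → B, ∃ i, Even (orbitCol step col g (qs 0) i) := by
  classical
  have : Nonempty B := ⟨bs 0⟩
  obtain ⟨g₁, rk, W, hT, hW, hg⟩ :=
    exists_attractor step (fun _ _ => True) (fun q => ∃ b, Even (col q b))
  have hin : ∀ m i, i + m = n → W (qs i) := by
    intro m
    induction m with
    | zero => rintro i rfl; exact hT _ ⟨_, h⟩
    | succ m ih =>
      intro i hi
      refine hW _ (bs i) trivial ?_
      rw [← hqs]
      exact ih (i + 1) (by omega)
  let g : Q → B := fun x => if hx : ∃ b, Even (col x b) then hx.choose else g₁ x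
  refine ⟨g, ?_⟩
  have key : ∀ m x, rk x = m → W x → ∃ i, Even (orbitCol step col g x i) := by
    intro m
    induction m using Nat.strong_induction_on with
    | _ m ih =>
      intro x hxm hx
      by_cases hxT : ∃ b, Even (col x b)
      · refine ⟨0, ?_⟩
        have : g x = hxT.choose := by simp only [g, dif_pos hxT]
        change Even (col x (g x))
        rw [this]
        exact hxT.choose_spec
      · obtain ⟨-, h2, h3⟩ := hg x hx hxT
        have hgx : g x = g₁ x := by simp only [g, dif_neg hxT]
        obtain ⟨i, hi⟩ := ih _ (hxm ▸ h3) _ rfl h2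
        refine ⟨i + 1, ?_⟩
        rw [← orbitCol_succ, hgx]
        exact hi
  exact key _ _ rfl (hin n 0 (by omega))

/-- A winning path of a one-player game yields a winning positional strategy. -/
theorem exists_positional_wins [Finite Q] (o : Objective) {qs : ℕ → Q} {bs : ℕ → B}
    (hqs : ∀ i, qs (i + 1) = step (qs i) (bs i))
    (h : o.Wins fun i => col (qs i) (bs i)) :
    ∃ g : Q → B, o.Wins (orbitCol step col g (qs 0)) := by
  cases o with
  | reachability =>
    obtain ⟨n, hn⟩ := h
    exact exists_positional_reach step col hqs hn
  | buchi => exact exists_positional_parityWin step col hqs h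
  | parity => exact exists_positional_parityWin step col hqs h

end positional

/-- The beginning of the window of an orbit that decides the winning condition. -/
def Objective.base (o : Objective) (P : ℕ) : ℕ :=
  match o with
  | .reachability => 0
  | .buchi => P
  | .parity => P

theorem Objective.wins_orbit_iff {Q : Type*} [Fintype Q] (o : Objective) (f : Q → Q) {P : ℕ}
    (hP : Fintype.card Q ≤ P) (c : Q → ℕ) (x : Q)
    (hc : o = .reachability → ∀ q, c q = 1 ∨ c q = 2) :
    o.Wins (fun i => c (f^[i] x)) ↔ ∃ i < P, Even (c (f^[o.base P + i] x)) ∧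
      ∀ j < P, c (f^[o.base P + j] x) ≤ c (f^[o.base P + i] x) := by
  cases o with
  | buchi => exact parityWin_orbit_iff f hP c x
  | parity => exact parityWin_orbit_iff f hP c x
  | reachability =>
    simp only [Objective.Wins, Objective.base, Nat.zero_add]
    constructor
    · rintro ⟨i, hi⟩
      obtain ⟨j, hj, hji⟩ := exists_lt_iterate_eq f hP x i
      refine ⟨j, hj, by rwa [hji], fun l _ => ?_⟩
      have h1 := hc rfl (f^[i] x)
      have h2 := hc rfl (f^[l] x)
      have h3 : c (f^[i] x) ≠ 1 := fun h => by rw [h] at hi; exact absurd hi (by decide)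
      rw [hji]
      omega
    · rintro ⟨i, _, hi, _⟩
      exact ⟨i, hi⟩

/-! ### Plays against a transducer -/

section plays

open Filter

theorem parityWin_iff_of_bounded {c : ℕ → ℕ} {C : ℕ} (hC : ∀ i, c i ≤ C) :
    (∃ d, Even d ∧ (∃ᶠ j in atTop, c j = d) ∧ ∀ d', (∃ᶠ j in atTop, c j = d') → d' ≤ d) ↔
      ParityWin c := by
  refine exists_congr fun d => and_congr_right fun _ => and_congr_right fun _ => ?_
  constructor
  · intro h
    have : ∀ᶠ i in atTop, ∀ d' ∈ Finset.Ioc d C, c i ≠ d' := by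
      rw [Filter.eventually_all_finset]
      intro d' hd'
      refine not_frequently.1 fun hf => ?_
      have := h d' (by simpa using hf)
      rw [Finset.mem_Ioc] at hd'
      omega
    refine this.mono fun i hi => ?_
    by_contra hlt
    exact hi (c i) (Finset.mem_Ioc.2 ⟨by omega, hC i⟩) rfl
  · intro h d' hd'
    obtain ⟨i, hi, hi'⟩ := (hd'.and_eventually h).exists
    exact hi ▸ hi'

/-- Merging the colours of two successive vertices does not affect the parity condition. -/
theorem parityWin_max_iff (c : ℕ → ℕ) :
    ParityWin (fun i => max (c (2 * i + 2)) (c (2 * i + 3))) ↔ ParityWin c := by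
  refine exists_congr fun d => and_congr_right fun _ => ?_
  constructor
  · rintro ⟨hf, he⟩
    obtain ⟨N, hN⟩ := eventually_atTop.1 he
    refine ⟨frequently_atTop.2 fun M => ?_, eventually_atTop.2 ⟨2 * N + 2, fun j hj => ?_⟩⟩
    · obtain ⟨i, hi, hid⟩ := frequently_atTop.1 hf M
      rcases max_choice (c (2 * i + 2)) (c (2 * i + 3)) with h | h
      · exact ⟨2 * i + 2, by omega, h ▸ hid⟩
      · exact ⟨2 * i + 3, by omega, h ▸ hid⟩
    · have := hN ((j - 2) / 2) (by omega)
      rw [max_le_iff] at this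
      rcases Nat.mod_two_eq_zero_or_one j with h | h
      · have h' : 2 * ((j - 2) / 2) + 2 = j := by omega
        exact h' ▸ this.1
      · have h' : 2 * ((j - 2) / 2) + 3 = j := by omega
        exact h' ▸ this.2
  · rintro ⟨hf, he⟩
    obtain ⟨N, hN⟩ := eventually_atTop.1 he
    refine ⟨frequently_atTop.2 fun M => ?_, eventually_atTop.2 ⟨N, fun i hi =>
      max_le (hN _ (by omega)) (hN _ (by omega))⟩⟩
    obtain ⟨j, hj, hjd⟩ := frequently_atTop.1 hf (2 * (M + N) + 2)
    refine ⟨(j - 2) / 2, by omega, le_antisymm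
      (max_le (hN _ (by omega)) (hN _ (by omega))) ?_⟩
    rw [le_max_iff]
    rcases Nat.mod_two_eq_zero_or_one j with h | h
    · have h' : 2 * ((j - 2) / 2) + 2 = j := by omega
      left; rw [h', hjd]
    · have h' : 2 * ((j - 2) / 2) + 3 = j := by omega
      right; rw [h', hjd]

namespace Game

variable {V₁ V₂ A B M : Type*} (G : Game V₁ V₂ A B)

/-- The player 2 vertices of the play generated by `w`. -/
def pos₂ (w : ℕ → A × B) (i : ℕ) : V₂ := G.E₁ (G.pos w i) (w i).1

/-- The larger colour of the two vertices that are entered after the `i`-th vertex of player 2. -/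
def moveCol (w : ℕ → A × B) (i : ℕ) : ℕ :=
  max (G.color (.inl (G.pos w (i + 1)))) (G.color (.inr (G.pos₂ w (i + 1))))

theorem vertex_even (w : ℕ → A × B) (i : ℕ) : G.vertex w (2 * i) = .inl (G.pos w i) := by
  simp [vertex]

theorem vertex_odd (w : ℕ → A × B) (i : ℕ) : G.vertex w (2 * i + 1) = .inr (G.pos₂ w i) := by
  have h : (2 * i + 1) / 2 = i := by omega
  simp [vertex, h, pos₂, Nat.add_mod]

theorem moveCol_eq (w : ℕ → A × B) (i : ℕ) : G.moveCol w i =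
    max (G.color (G.vertex w (2 * i + 2))) (G.color (G.vertex w (2 * i + 3))) := by
  rw [show 2 * i + 2 = 2 * (i + 1) by ring, show 2 * i + 3 = 2 * (i + 1) + 1 by ring,
    vertex_even, vertex_odd]
  rfl

variable {G}

theorem winningPlay_parity_iff [Finite V₁] [Finite V₂] (w : ℕ → A × B) :
    G.WinningPlay .parity w ↔ ParityWin (G.moveCol w) := by
  obtain ⟨C, hC⟩ := (Set.finite_range G.color).bddAbove
  have h1 := parityWin_iff_of_bounded (c := fun j => G.color (G.vertex w j)) (C := C)
    fun i => hC ⟨_, rfl⟩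
  have h2 := parityWin_max_iff fun j => G.color (G.vertex w j)
  have h3 : G.moveCol w = fun i => max (G.color (G.vertex w (2 * i + 2)))
      (G.color (G.vertex w (2 * i + 3))) := funext (G.moveCol_eq w)
  rw [h3, h2, ← h1]
  rfl

theorem winningPlay_buchi_iff [Finite V₁] [Finite V₂] (hG : G.HasKind .buchi) (w : ℕ → A × B) :
    G.WinningPlay .buchi w ↔ G.WinningPlay .parity w := by
  constructor
  · rintro ⟨v, hv, hf⟩
    refine ⟨2, by decide, hf.mono fun j hj => hj ▸ hv, fun d' hd' => ?_⟩
    obtain ⟨j, hj⟩ := hd'.exists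
    rcases hG (G.vertex w j) with h | h <;> omega
  · rintro ⟨d, hd, hf, -⟩
    have hd2 : d = 2 := by
      obtain ⟨j, hj⟩ := hf.exists
      rcases hG (G.vertex w j) with h | h
      · rw [h] at hj
        exact absurd (hj ▸ hd) (by decide)
      · omega
    by_contra hcon
    have : ∀ᶠ j in atTop, ∀ v, G.color v = 2 → G.vertex w j ≠ v := by
      refine eventually_all.2 fun v => ?_
      by_cases hv : G.color v = 2
      · refine (not_frequently.1 fun hf => hcon ⟨v, hv, hf⟩).mono fun j hj _ => hj
      · exact Eventually.of_forall fun j h => absurd h hv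
    exact hf (this.mono fun j hj hj' => hj _ (hj'.trans hd2) rfl)

/-- In a reachability game, a final vertex occurs in the play up to the `i`-th vertex of
player 2. -/
def Visited (G : Game V₁ V₂ A B) (o : Objective) (w : ℕ → A × B) (i : ℕ) : Prop :=
  o = .reachability ∧ ∃ j ≤ 2 * i + 1, G.color (G.vertex w j) = 2

theorem Visited.mono {o : Objective} {w : ℕ → A × B} {i i' : ℕ} (h : G.Visited o w i)
    (hi : i ≤ i') : G.Visited o w i' := by
  obtain ⟨ho, j, hj, hc⟩ := h
  exact ⟨ho, j, by omega, hc⟩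

theorem moveCol_mem (hG : G.HasKind .reachability) (w : ℕ → A × B) (i : ℕ) :
    G.moveCol w i = 1 ∨ G.moveCol w i = 2 := by
  rw [moveCol_eq]
  have h1 := hG (G.vertex w (2 * i + 2))
  have h2 := hG (G.vertex w (2 * i + 3))
  omega

theorem visited_of_even (hG : G.HasKind .reachability) {w : ℕ → A × B} {i : ℕ}
    (h : Even (G.moveCol w i)) : G.Visited .reachability w (i + 1) := by
  have h2 : G.moveCol w i = 2 := by
    rcases moveCol_mem hG w i with h' | h'
    · rw [h'] at h
      exact absurd h (by decide)
    · exact h'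
  rw [moveCol_eq] at h2
  rcases max_choice (G.color (G.vertex w (2 * i + 2))) (G.color (G.vertex w (2 * i + 3)))
    with h' | h'
  · exact ⟨rfl, _, by omega, h' ▸ h2⟩
  · exact ⟨rfl, _, by omega, h' ▸ h2⟩

theorem winningPlay_of_wins [Finite V₁] [Finite V₂] {o : Objective} (hG : G.HasKind o)
    {w : ℕ → A × B} {t : ℕ} (h : o.Wins fun i => G.moveCol w (i + t)) : G.WinningPlay o w := by
  replace h := h.of_tail
  cases o with
  | reachability =>
    obtain ⟨i, hi⟩ := h
    obtain ⟨-, j, -, hj⟩ := visited_of_even hG hi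
    exact ⟨j, hj⟩
  | buchi => exact (winningPlay_buchi_iff hG w).2 ((winningPlay_parity_iff w).2 h)
  | parity => exact (winningPlay_parity_iff w).2 h

theorem wins_of_winningPlay [Finite V₁] [Finite V₂] {o : Objective} (hG : G.HasKind o)
    {w : ℕ → A × B} (h : G.WinningPlay o w) (t : ℕ) :
    G.Visited o w t ∨ o.Wins fun i => G.moveCol w (i + t) := by
  cases o with
  | reachability =>
    obtain ⟨j, hj⟩ := h
    by_cases hjt : j ≤ 2 * t + 1
    · exact .inl ⟨rfl, j, hjt, hj⟩
    · refine .inr ⟨(j - 2) / 2 - t, ?_⟩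
      dsimp only
      rw [show (j - 2) / 2 - t + t = (j - 2) / 2 by omega]
      have h2 : G.moveCol w ((j - 2) / 2) = 2 := by
        have := moveCol_mem hG w ((j - 2) / 2)
        have hle : 2 ≤ G.moveCol w ((j - 2) / 2) := by
          rw [moveCol_eq, le_max_iff]
          rcases Nat.mod_two_eq_zero_or_one j with h | h
          · have h' : 2 * ((j - 2) / 2) + 2 = j := by omega
            left; rw [h', hj]
          · have h' : 2 * ((j - 2) / 2) + 3 = j := by omega
            right; rw [h', hj]
        omega
      rw [h2]
      decide
  | buchi => exact .inr ((parityWin_tail _ t).2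
      ((winningPlay_parity_iff w).1 ((winningPlay_buchi_iff hG w).1 h)))
  | parity => exact .inr ((parityWin_tail _ t).2 ((winningPlay_parity_iff w).1 h))

/-- The moves of player 2 in the product of a game with a transducer: from a vertex of player 2 and
a state of the transducer whose output has just been played. -/
def prodStep (G : Game V₁ V₂ A B) (T : Transducer A B M) (q : V₂ × M) (y : B) : V₂ × M :=
  (G.E₁ (G.E₂ q.1 y) (T.label (T.next q.2 y)), T.next q.2 y)

/-- The larger colour of the two vertices that are entered by a move in the product. -/
def prodCol (G : Game V₁ V₂ A B) (T : Transducer A B M) (q : V₂ × M) (y : B) : ℕ :=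
  max (G.color (.inl (G.E₂ q.1 y))) (G.color (.inr (G.prodStep T q y).1))

/-- In the product, player 2 has a winning path from the state `q`. -/
def Winnable (G : Game V₁ V₂ A B) (o : Objective) (T : Transducer A B M) (q : V₂ × M) : Prop :=
  ∃ (qs : ℕ → V₂ × M) (bs : ℕ → B), qs 0 = q ∧ (∀ i, qs (i + 1) = G.prodStep T (qs i) (bs i)) ∧
    o.Wins fun i => G.prodCol T (qs i) (bs i)

/-- In the product, the positional strategy `g` wins from the state `q`. -/
def GoodAt (G : Game V₁ V₂ A B) (o : Objective) (T : Transducer A B M) (g : V₂ × M → B)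
    (q : V₂ × M) : Prop :=
  o.Wins (orbitCol (G.prodStep T) (G.prodCol T) g q)

theorem Winnable.exists_goodAt [Finite V₂] [Finite M] {o : Objective} {T : Transducer A B M}
    {q : V₂ × M} (h : G.Winnable o T q) : ∃ g, G.GoodAt o T g q := by
  obtain ⟨qs, bs, rfl, hqs, hw⟩ := h
  exact exists_positional_wins _ _ o hqs hw

theorem Winnable.of_step {o : Objective} {T : Transducer A B M} {q : V₂ × M} {y : B}
    (h : G.Winnable o T (G.prodStep T q y)) : G.Winnable o T q := by
  obtain ⟨qs, bs, hq, hqs, hw⟩ := h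
  refine ⟨fun i => Nat.casesOn i q qs, fun i => Nat.casesOn i y bs, rfl, ?_,
    Objective.Wins.of_tail (t := 1) hw⟩
  rintro (_ | i)
  · exact hq
  · exact hqs i

end Game

namespace Transducer

variable {A B M : Type*}

/-- The state of a transducer started in the state `m` after the first `i` letters of a word. -/
def stateAt (T : Transducer A B M) (m : M) (w : ℕ → A × B) : ℕ → M
  | 0 => m
  | i + 1 => T.next (T.stateAt m w i) (w i).2

theorem foldl_wordPrefix (T : Transducer A B M) (m : M) (w : ℕ → A × B) (i : ℕ) :
    ((wordPrefix w i).map Prod.snd).foldl T.next m = T.stateAt m w i := by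
  induction i with
  | zero => rfl
  | succ i ih =>
    rw [wordPrefix, List.range_succ] at *
    simp only [List.map_append, List.foldl_append, ih]
    rfl

theorem agrees_iff (T : Transducer A B M) (w : ℕ → A × B) :
    T.Agrees w ↔ ∀ i, (w i).1 = T.label (T.stateAt T.init w i) := by
  simp only [Agrees, out, foldl_wordPrefix]

theorem stateAt_congr (T : Transducer A B M) (m : M) {w w' : ℕ → A × B} {i : ℕ}
    (h : ∀ j < i, w j = w' j) : T.stateAt m w i = T.stateAt m w' i := by
  induction i with
  | zero => rfl
  | succ i ih => rw [stateAt, stateAt, ih fun j hj => h j (by omega), h i (by omega)]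

/-- Started in the state `m`, the transducer outputs the first `i` letters of player 1. -/
def AgreesUpTo (T : Transducer A B M) (m : M) (w : ℕ → A × B) (i : ℕ) : Prop :=
  ∀ j < i, (w j).1 = T.label (T.stateAt m w j)

end Transducer

end plays

/-! ### The strategy of player 2 -/

/-- A successor in mixed radix notation: the last digit increases, or there is a carry. -/
theorem succ_div_mod (n : ℕ) {m : ℕ} (hm : 0 < m) :
    (n % m + 1 < m ∧ (n + 1) / m = n / m ∧ (n + 1) % m = n % m + 1) ∨
      (n % m + 1 = m ∧ (n + 1) / m = n / m + 1 ∧ (n + 1) % m = 0) := by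
  have h1 := Nat.mod_add_div n m
  have h2 := Nat.mod_lt n hm
  rcases Nat.lt_or_ge (n % m + 1) m with h | h
  · have h3 : n + 1 = (n % m + 1) + m * (n / m) := by omega
    refine .inl ⟨h, ?_, ?_⟩
    · conv_lhs => rw [h3]
      rw [Nat.add_mul_div_left _ _ hm, Nat.div_eq_of_lt h, zero_add]
    · conv_lhs => rw [h3]
      rw [Nat.add_mul_mod_self_left, Nat.mod_eq_of_lt h]
  · have h3 : n + 1 = m * (n / m + 1) := by rw [Nat.mul_succ]; omega
    refine .inr ⟨by omega, ?_, ?_⟩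
    · conv_lhs => rw [h3]
      rw [Nat.mul_div_cancel_left _ hm]
    · conv_lhs => rw [h3]
      rw [Nat.mul_mod_right]

/-- An enumeration of the transducers with `k` states, up to the initial state, and of the
positional strategies of player 2 in their products with a game. -/
structure Hyps (V₂ A B : Type*) (k : ℕ) where
  numT : ℕ
  numG : ℕ
  trans : ℕ → KTransducer A B k
  strat : ℕ → V₂ × Fin k → B
  numG_pos : 0 < numG
  trans_surj : ∀ T : KTransducer A B k, ∃ t < numT,
    (trans t).next = T.next ∧ (trans t).label = T.label
  strat_surj : ∀ g, ∃ i < numG, strat i = g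

/-- What player 2 keeps in mind at a vertex of player 1: the vertex, the number of the current
hypothesis, and, for every initial state of the current transducer, the state that it has reached
since it is considered, or `none` if it has been contradicted. -/
structure MemState (V₁ : Type*) (k : ℕ) where
  vtx : V₁
  hyp : ℕ
  cand : Fin k → Option (Fin k)

namespace Hyps

variable {V₁ V₂ A B : Type*} {k : ℕ} [NeZero k] (H : Hyps V₂ A B k)

/-- The number of the transducer of the hypothesis `h`. -/
def tIdx (h : ℕ) : ℕ := h / H.numG / k

/-- The initial state of the transducer that the hypothesis `h` refers to. -/
def jIdx (h : ℕ) : Fin k := Fin.ofNat k (h / H.numG)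

/-- The number of the positional strategy of the hypothesis `h`. -/
def gIdx (h : ℕ) : ℕ := h % H.numG

/-- The number of all hypotheses. -/
def total : ℕ := H.numT * k * H.numG

variable [DecidableEq A]

/-- The candidates after the action `x` of player 1, if the hypothesis `h` is adopted. -/
def candAt (st : MemState V₁ k) (x : A) (h : ℕ) (i : Fin k) : Option (Fin k) :=
  (if H.tIdx h = H.tIdx st.hyp then st.cand i else some i).filter
    fun m => (H.trans (H.tIdx h)).label m = x

variable (G : Game V₁ V₂ A B) (o : Objective)

/-- The hypothesis `h` is not contradicted, and its positional strategy wins if it is true. -/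
def OkAt (st : MemState V₁ k) (x : A) (h : ℕ) : Prop :=
  ∃ m, H.candAt st x h (H.jIdx h) = some m ∧
    G.GoodAt o (H.trans (H.tIdx h)) (H.strat (H.gIdx h)) (G.E₁ st.vtx x, m)

theorem exists_hyp (st : MemState V₁ k) (x : A) :
    ∃ h, st.hyp ≤ h ∧ (H.total ≤ h ∨ H.OkAt G o st x h) :=
  ⟨max st.hyp H.total, le_max_left _ _, .inl (le_max_right _ _)⟩

open Classical in
/-- The hypothesis that is adopted after the action `x` of player 1. -/
noncomputable def nextHyp (st : MemState V₁ k) (x : A) : ℕ := Nat.find (H.exists_hyp G o st x)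

theorem le_nextHyp (st : MemState V₁ k) (x : A) : st.hyp ≤ H.nextHyp G o st x := by
  classical exact (Nat.find_spec (H.exists_hyp G o st x)).1

theorem nextHyp_spec (st : MemState V₁ k) (x : A) :
    H.total ≤ H.nextHyp G o st x ∨ H.OkAt G o st x (H.nextHyp G o st x) := by
  classical exact (Nat.find_spec (H.exists_hyp G o st x)).2

theorem not_okAt_of_lt (st : MemState V₁ k) (x : A) {h : ℕ} (h₁ : st.hyp ≤ h)
    (h₂ : h < H.nextHyp G o st x) : h < H.total ∧ ¬ H.OkAt G o st x h := by
  classical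
  have := Nat.find_min (H.exists_hyp G o st x) h₂
  push Not at this
  exact this h₁

theorem nextHyp_eq_of_okAt (st : MemState V₁ k) (x : A) (h : H.OkAt G o st x st.hyp) :
    H.nextHyp G o st x = st.hyp := by
  by_contra hne
  have := H.le_nextHyp G o st x
  exact (H.not_okAt_of_lt G o st x le_rfl (by omega)).2 h

open Classical in
/-- The answer of player 2 to the action `x` under the adopted hypothesis `h`. -/
noncomputable def answerAt (d : B) (st : MemState V₁ k) (x : A) (h : ℕ) : B :=
  if H.total ≤ h then d
  else H.strat (H.gIdx h) (G.E₁ st.vtx x, (H.candAt st x h (H.jIdx h)).getD 0)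

/-- The answer of player 2 to the action `x`; when the hypotheses are exhausted, it is `d`. -/
noncomputable def answer (d : B) (st : MemState V₁ k) (x : A) : B :=
  H.answerAt G d st x (H.nextHyp G o st x)

/-- The memory of player 2 after the answer to the action `x`. -/
noncomputable def nextState (d : B) (st : MemState V₁ k) (x : A) : MemState V₁ k where
  vtx := G.E₂ (G.E₁ st.vtx x) (H.answer G o d st x)
  hyp := H.nextHyp G o st x
  cand := fun i => (H.candAt st x (H.nextHyp G o st x) i).map fun m =>
    (H.trans (H.tIdx (H.nextHyp G o st x))).next m (H.answer G o d st x)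

/-- The memory of player 2 at the beginning. -/
def initState : MemState V₁ k := ⟨G.init, 0, some⟩

/-- The strategy of player 2, which determines its memory from the actions of player 1. -/
noncomputable def strategy (d : B) : Strategy₂ A B := fun α x =>
  H.answer G o d (α.foldl (fun st p => H.nextState G o d st p.1) (initState G)) x

/-- The memory of player 2 after `i` rounds. -/
noncomputable def stateSeq (d : B) (w : ℕ → A × B) : ℕ → MemState V₁ k
  | 0 => initState G
  | i + 1 => H.nextState G o d (stateSeq d w i) (w i).1

variable {G o} {d : B} {w : ℕ → A × B}

theorem agrees_strategy_iff : (H.strategy G o d).Agrees w ↔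
    ∀ i, (w i).2 = H.answer G o d (H.stateSeq G o d w i) (w i).1 := by
  have : ∀ i, (wordPrefix w i).foldl (fun st p => H.nextState G o d st p.1) (initState G) =
      H.stateSeq G o d w i := by
    intro i
    induction i with
    | zero => rfl
    | succ i ih =>
      rw [wordPrefix, List.range_succ] at *
      simp only [List.map_append, List.foldl_append, ih]
      rfl
  simp only [Strategy₂.Agrees, strategy, this]

variable (hw : (H.strategy G o d).Agrees w)

include hw

theorem vtx_stateSeq (i : ℕ) : (H.stateSeq G o d w i).vtx = G.pos w i := by
  induction i with
  | zero => rfl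
  | succ i ih =>
    have := (H.agrees_strategy_iff).1 hw i
    simp only [stateSeq, nextState, Game.pos, ih, ← this]

omit hw [DecidableEq A] [NeZero k] in
theorem tIdx_mono {h h' : ℕ} (hh : h ≤ h') : H.tIdx h ≤ H.tIdx h' :=
  Nat.div_le_div_right (Nat.div_le_div_right hh)

omit hw [NeZero k] in
theorem candAt_congr (st : MemState V₁ k) (x : A) {h h' : ℕ} (hh : H.tIdx h = H.tIdx h') :
    H.candAt st x h = H.candAt st x h' := by
  funext i
  simp only [candAt, hh]

omit hw

variable (G o d w)

/-- What is known in round `i` when the hypotheses before `h` have been discarded: smaller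
transducers that agree with the history cannot be beaten any more; all states that the current
transducer can have reached are candidates; the candidates that have been discarded cannot be
beaten; and for the current candidate, the strategies that have been discarded are not good. -/
structure Inv (i h : ℕ) : Prop where
  refuted : ∀ t < H.tIdx h, ∀ m₀, (H.trans t).AgreesUpTo m₀ w (i + 1) →
    ¬ G.Winnable o (H.trans t) (G.pos₂ w i, (H.trans t).stateAt m₀ w i)
  cover : ∀ m₀, (H.trans (H.tIdx h)).AgreesUpTo m₀ w (i + 1) →
    ∃ j, H.candAt (H.stateSeq G o d w i) (w i).1 h j = some ((H.trans (H.tIdx h)).stateAt m₀ w i)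
  below : ∀ j < H.jIdx h, ∀ m, H.candAt (H.stateSeq G o d w i) (w i).1 h j = some m →
    ¬ G.Winnable o (H.trans (H.tIdx h)) (G.pos₂ w i, m)
  current : ∀ m, H.candAt (H.stateSeq G o d w i) (w i).1 h (H.jIdx h) = some m →
    G.GoodAt o (H.trans (H.tIdx h)) (H.strat (H.gIdx h)) (G.pos₂ w i, m) ∨
      ∀ g < H.gIdx h, ¬ G.GoodAt o (H.trans (H.tIdx h)) (H.strat g) (G.pos₂ w i, m)

variable {G o d w}

theorem inv_zero : H.Inv G o d w 0 0 := by
  have ht : H.tIdx 0 = 0 := by simp [tIdx]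
  refine ⟨fun t h => ?_, fun m₀ h => ⟨m₀, ?_⟩, fun j hj => ?_, fun m _ => .inr fun g hg => ?_⟩
  · rw [ht] at h
    omega
  · have := h 0 (by omega)
    simp only [candAt, stateSeq, initState, if_true]
    rw [Option.filter_some, if_pos]
    · rfl
    · simpa [Transducer.stateAt] using this.symm
  · have : (j : ℕ) < (H.jIdx 0 : Fin k) := hj
    simp [jIdx, Fin.ofNat] at this
  · simp [gIdx] at hg

include hw

theorem okAt_iff (i h : ℕ) : H.OkAt G o (H.stateSeq G o d w i) (w i).1 h ↔
    ∃ m, H.candAt (H.stateSeq G o d w i) (w i).1 h (H.jIdx h) = some m ∧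
      G.GoodAt o (H.trans (H.tIdx h)) (H.strat (H.gIdx h)) (G.pos₂ w i, m) := by
  simp only [OkAt, H.vtx_stateSeq hw, Game.pos₂]

theorem Inv.succ [Finite V₂] {i h : ℕ} (hI : H.Inv G o d w i h)
    (hle : (H.stateSeq G o d w i).hyp ≤ h)
    (hok : ¬ H.OkAt G o (H.stateSeq G o d w i) (w i).1 h) : H.Inv G o d w i (h + 1) := by
  have hk : 0 < k := Nat.pos_of_neZero k
  rw [H.okAt_iff hw] at hok
  push Not at hok
  -- the strategies up to the current one are not good for the current candidate
  have hnot : ∀ m, H.candAt (H.stateSeq G o d w i) (w i).1 h (H.jIdx h) = some m →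
      ∀ g ≤ H.gIdx h, ¬ G.GoodAt o (H.trans (H.tIdx h)) (H.strat g) (G.pos₂ w i, m) := by
    intro m hm g hg
    rcases hg.lt_or_eq with hg | rfl
    · exact (hI.current m hm).resolve_left (hok m hm) g hg
    · exact hok m hm
  rcases succ_div_mod h H.numG_pos with ⟨h1, h2, h3⟩ | ⟨h1, h2, h3⟩
  · have ht : H.tIdx (h + 1) = H.tIdx h := by simp only [tIdx, h2]
    have hj : H.jIdx (h + 1) = H.jIdx h := by simp only [jIdx, h2]
    have hg : H.gIdx (h + 1) = H.gIdx h + 1 := h3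
    have hc := H.candAt_congr (H.stateSeq G o d w i) (w i).1 ht
    refine ⟨by rw [ht]; exact hI.refuted, by rw [hc, ht]; exact hI.cover,
      by rw [hc, ht, hj]; exact hI.below, ?_⟩
    rw [hc, ht, hj, hg]
    exact fun m hm => .inr fun g hg => hnot m hm g (by omega)
  · -- the strategies are exhausted, so the current candidate cannot be beaten
    have hnw : ∀ m, H.candAt (H.stateSeq G o d w i) (w i).1 h (H.jIdx h) = some m →
        ¬ G.Winnable o (H.trans (H.tIdx h)) (G.pos₂ w i, m) := by
      intro m hm hwin
      obtain ⟨g, hg⟩ := hwin.exists_goodAt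
      obtain ⟨n, hn, rfl⟩ := H.strat_surj g
      refine hnot m hm n ?_ hg
      have : H.gIdx h + 1 = H.numG := h1
      omega
    have hg0 : H.gIdx (h + 1) = 0 := h3
    have hjv : ∀ n, (H.jIdx n : ℕ) = n / H.numG % k := fun n => rfl
    rcases succ_div_mod (h / H.numG) hk with ⟨h4, h5, h6⟩ | ⟨h4, h5, h6⟩
    · have ht : H.tIdx (h + 1) = H.tIdx h := by simp only [tIdx, h2, h5]
      have hj : (H.jIdx (h + 1) : ℕ) = H.jIdx h + 1 := by rw [hjv, hjv, h2, h6]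
      have hc := H.candAt_congr (H.stateSeq G o d w i) (w i).1 ht
      refine ⟨by rw [ht]; exact hI.refuted, by rw [hc, ht]; exact hI.cover, ?_, ?_⟩
      · rw [hc, ht]
        intro j hjlt m hm
        have hjlt' : (j : ℕ) < (H.jIdx (h + 1) : ℕ) := hjlt
        rcases Nat.lt_or_ge (j : ℕ) (H.jIdx h) with hlt | hge
        · exact hI.below j hlt m hm
        · have : j = H.jIdx h := Fin.ext (by omega)
          subst this
          exact hnw m hm
      · rw [hg0]
        exact fun m _ => .inr fun g hg => absurd hg (Nat.not_lt_zero g)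
    · have ht : H.tIdx (h + 1) = H.tIdx h + 1 := by simp only [tIdx, h2, h5]
      have hj : (H.jIdx (h + 1) : ℕ) = 0 := by rw [hjv, h2, h6]
      have hlast : (H.jIdx h : ℕ) + 1 = k := by rw [hjv, h4]
      refine ⟨?_, ?_, ?_, ?_⟩
      · intro t htlt m₀ hm₀ hwin
        rw [ht] at htlt
        rcases Nat.lt_or_ge t (H.tIdx h) with hlt | hge
        · exact hI.refuted t hlt m₀ hm₀ hwin
        · have : t = H.tIdx h := by omega
          subst this
          obtain ⟨j, hj⟩ := hI.cover m₀ hm₀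
          rcases Nat.lt_or_ge (j : ℕ) (H.jIdx h) with hlt | hge
          · exact hI.below j hlt _ hj hwin
          · have : j = H.jIdx h := Fin.ext (by have := j.2; omega)
            subst this
            exact hnw _ hj hwin
      · intro m₀ hm₀
        have hne : H.tIdx (h + 1) ≠ H.tIdx (H.stateSeq G o d w i).hyp := by
          have := H.tIdx_mono hle
          omega
        refine ⟨(H.trans (H.tIdx (h + 1))).stateAt m₀ w i, ?_⟩
        simp only [candAt, if_neg hne]
        rw [Option.filter_some, if_pos]
        simpa using (hm₀ i (by omega)).symm
      · intro j hjlt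
        have hjlt' : (j : ℕ) < (H.jIdx (h + 1) : ℕ) := hjlt
        omega
      · rw [hg0]
        exact fun m _ => .inr fun g hg => absurd hg (Nat.not_lt_zero g)

theorem Inv.nextHyp [Finite V₂] {i : ℕ} (hI : H.Inv G o d w i (H.stateSeq G o d w i).hyp) :
    H.Inv G o d w i (H.nextHyp G o (H.stateSeq G o d w i) (w i).1) := by
  have : ∀ n, (H.stateSeq G o d w i).hyp + n ≤ H.nextHyp G o (H.stateSeq G o d w i) (w i).1 →
      H.Inv G o d w i ((H.stateSeq G o d w i).hyp + n) := by
    intro n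
    induction n with
    | zero => exact fun _ => hI
    | succ n ih =>
      intro hn
      exact (ih (by omega)).succ H hw (by omega)
        (H.not_okAt_of_lt G o _ _ (by omega) (by omega)).2
  have h1 := H.le_nextHyp G o (H.stateSeq G o d w i) (w i).1
  have := this (H.nextHyp G o (H.stateSeq G o d w i) (w i).1 - (H.stateSeq G o d w i).hyp)
    (by omega)
  rwa [Nat.add_sub_cancel' h1] at this

/-- If the adopted hypothesis `h` is fine in round `i`, then player 2 follows its positional
strategy in the product. -/
theorem snd_eq_of_okAt {i m} (hT : H.nextHyp G o (H.stateSeq G o d w i) (w i).1 < H.total)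
    (hm : H.candAt (H.stateSeq G o d w i) (w i).1 (H.nextHyp G o (H.stateSeq G o d w i) (w i).1)
      (H.jIdx (H.nextHyp G o (H.stateSeq G o d w i) (w i).1)) = some m) :
    (w i).2 = H.strat (H.gIdx (H.nextHyp G o (H.stateSeq G o d w i) (w i).1))
      (G.pos₂ w i, m) := by
  rw [(H.agrees_strategy_iff).1 hw i, answer, answerAt, if_neg (not_le.2 hT), hm,
    H.vtx_stateSeq hw]
  rfl

/-- A candidate in round `i + 1` comes from a candidate in round `i` by a move in the product. -/
theorem candAt_succ {i : ℕ} {j m'} {x : A}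
    (hc : H.candAt (H.stateSeq G o d w (i + 1)) x (H.stateSeq G o d w (i + 1)).hyp j = some m') :
    ∃ m, H.candAt (H.stateSeq G o d w i) (w i).1 (H.stateSeq G o d w (i + 1)).hyp j = some m ∧
      m' = (H.trans (H.tIdx (H.stateSeq G o d w (i + 1)).hyp)).next m (w i).2 ∧
      (H.trans (H.tIdx (H.stateSeq G o d w (i + 1)).hyp)).label m' = x := by
  simp only [candAt, if_true, Option.filter_eq_some_iff] at hc
  obtain ⟨hc, hx⟩ := hc
  have hc' : (H.candAt (H.stateSeq G o d w i) (w i).1 (H.stateSeq G o d w (i + 1)).hyp j).map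
      (fun m => (H.trans (H.tIdx (H.stateSeq G o d w (i + 1)).hyp)).next m
        (H.answer G o d (H.stateSeq G o d w i) (w i).1)) = some m' := hc
  rw [← (H.agrees_strategy_iff).1 hw i, Option.map_eq_some_iff] at hc'
  obtain ⟨m, hm, rfl⟩ := hc'
  exact ⟨m, hm, rfl, by simpa using hx⟩

omit [NeZero k] [DecidableEq A] hw in
theorem prodStep_pos₂ (T : KTransducer A B k) (m : Fin k) {i : ℕ}
    (h : (w (i + 1)).1 = T.label (T.next m (w i).2)) :
    G.prodStep T (G.pos₂ w i, m) (w i).2 = (G.pos₂ w (i + 1), T.next m (w i).2) := by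
  rw [Game.prodStep, Game.pos₂, Game.pos₂, Game.pos, h]

omit [NeZero k] [DecidableEq A] hw in
theorem prodCol_pos₂ (T : KTransducer A B k) (m : Fin k) {i : ℕ}
    (h : (w (i + 1)).1 = T.label (T.next m (w i).2)) :
    G.prodCol T (G.pos₂ w i, m) (w i).2 = G.moveCol w i := by
  rw [Game.prodCol, prodStep_pos₂ T m h]
  rfl

omit [DecidableEq A] [NeZero k] hw in
theorem GoodAt.step {T : KTransducer A B k} {g : V₂ × Fin k → B} {q : V₂ × Fin k}
    (h : G.GoodAt o T g q) (hq : o = .reachability → ¬ Even (G.prodCol T q (g q))) :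
    G.GoodAt o T g (G.prodStep T q (g q)) := by
  have hs : (fun i => orbitCol (G.prodStep T) (G.prodCol T) g q (i + 1)) =
      orbitCol (G.prodStep T) (G.prodCol T) g (G.prodStep T q (g q)) := rfl
  cases o with
  | reachability =>
    obtain ⟨i, hi⟩ := h
    cases i with
    | zero => exact absurd hi (hq rfl)
    | succ i => exact ⟨i, hi⟩
  | buchi =>
    change ParityWin _
    rw [← hs, parityWin_tail]
    exact h
  | parity =>
    change ParityWin _
    rw [← hs, parityWin_tail]
    exact h

variable (G o d w) in
/-- In round `i` a hypothesis is adopted that is not contradicted. -/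
def Fine (i : ℕ) : Prop :=
  H.nextHyp G o (H.stateSeq G o d w i) (w i).1 < H.total ∧
    H.OkAt G o (H.stateSeq G o d w i) (w i).1 (H.nextHyp G o (H.stateSeq G o d w i) (w i).1)

/-- As long as the hypothesis adopted in a fine round is not contradicted, its positional strategy
remains good. -/
theorem goodAt_succ (hG : G.HasKind o) {i : ℕ} (hf : H.Fine G o d w i)
    (hv : ¬ G.Visited o w (i + 1)) {m'}
    (hc : H.candAt (H.stateSeq G o d w (i + 1)) (w (i + 1)).1 (H.stateSeq G o d w (i + 1)).hyp
      (H.jIdx (H.stateSeq G o d w (i + 1)).hyp) = some m') :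
    ∃ m, H.candAt (H.stateSeq G o d w i) (w i).1 (H.stateSeq G o d w (i + 1)).hyp
        (H.jIdx (H.stateSeq G o d w (i + 1)).hyp) = some m ∧
      (G.pos₂ w (i + 1), m') =
        G.prodStep (H.trans (H.tIdx (H.stateSeq G o d w (i + 1)).hyp)) (G.pos₂ w i, m)
          (H.strat (H.gIdx (H.stateSeq G o d w (i + 1)).hyp) (G.pos₂ w i, m)) ∧
      G.moveCol w i =
        G.prodCol (H.trans (H.tIdx (H.stateSeq G o d w (i + 1)).hyp)) (G.pos₂ w i, m)
          (H.strat (H.gIdx (H.stateSeq G o d w (i + 1)).hyp) (G.pos₂ w i, m)) ∧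
      G.GoodAt o (H.trans (H.tIdx (H.stateSeq G o d w (i + 1)).hyp))
        (H.strat (H.gIdx (H.stateSeq G o d w (i + 1)).hyp)) (G.pos₂ w (i + 1), m') := by
  obtain ⟨m, hm, rfl, hx⟩ := H.candAt_succ hw hc
  obtain ⟨hT, hok⟩ := hf
  rw [H.okAt_iff hw] at hok
  obtain ⟨m₁, hm₁, hg⟩ := hok
  have hmm : m₁ = m := Option.some_injective _ (hm₁.symm.trans hm)
  subst hmm
  have hy : (w i).2 = H.strat (H.gIdx (H.stateSeq G o d w (i + 1)).hyp) (G.pos₂ w i, m₁) :=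
    H.snd_eq_of_okAt hw hT hm₁
  have hstep := prodStep_pos₂ (G := G) _ m₁ hx.symm
  have hcol := prodCol_pos₂ (G := G) _ m₁ hx.symm
  rw [hy] at hstep hcol
  refine ⟨m₁, hm, ?_, hcol.symm, ?_⟩
  · rw [hy]; exact hstep.symm
  · rw [hy]
    have hg' : G.GoodAt o (H.trans (H.tIdx (H.stateSeq G o d w (i + 1)).hyp))
      (H.strat (H.gIdx (H.stateSeq G o d w (i + 1)).hyp)) (G.pos₂ w i, m₁) := hg
    have := GoodAt.step hg' (by
      rintro rfl hev
      refine hv (Game.visited_of_even hG ?_)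
      rw [← hcol]
      exact hev)
    rw [hstep] at this
    exact this

theorem Inv.next_round (hG : G.HasKind o) {i : ℕ}
    (hI : H.Inv G o d w i (H.nextHyp G o (H.stateSeq G o d w i) (w i).1))
    (hf : H.Fine G o d w i) (hv : ¬ G.Visited o w (i + 1)) :
    H.Inv G o d w (i + 1) (H.stateSeq G o d w (i + 1)).hyp := by
  have hstep : ∀ (T : KTransducer A B k) (m : Fin k),
      (w (i + 1)).1 = T.label (T.next m (w i).2) →
      ¬ G.Winnable o T (G.pos₂ w i, m) →
      ¬ G.Winnable o T (G.pos₂ w (i + 1), T.next m (w i).2) := by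
    intro T m h hn hwin
    rw [← prodStep_pos₂ T m h] at hwin
    exact hn hwin.of_step
  refine ⟨fun t ht m₀ hm₀ => ?_, fun m₀ hm₀ => ?_, fun j hj m' hc => ?_, fun m' hc => ?_⟩
  · exact hstep _ _ (hm₀ (i + 1) (by omega))
      (hI.refuted t ht m₀ fun l hl => hm₀ l (by omega))
  · obtain ⟨j, hj⟩ := hI.cover m₀ fun l hl => hm₀ l (by omega)
    refine ⟨j, ?_⟩
    have hc : (H.stateSeq G o d w (i + 1)).cand j =
        (H.candAt (H.stateSeq G o d w i) (w i).1 (H.stateSeq G o d w (i + 1)).hyp j).map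
      (fun m => (H.trans (H.tIdx (H.stateSeq G o d w (i + 1)).hyp)).next m
        (H.answer G o d (H.stateSeq G o d w i) (w i).1)) := rfl
    have hj' : H.candAt (H.stateSeq G o d w i) (w i).1 (H.stateSeq G o d w (i + 1)).hyp j =
      some ((H.trans (H.tIdx (H.stateSeq G o d w (i + 1)).hyp)).stateAt m₀ w i) := hj
    rw [hj', ← (H.agrees_strategy_iff).1 hw i, Option.map_some] at hc
    simp only [candAt, if_true, hc]
    rw [Option.filter_some, if_pos]
    · rfl
    · simpa [Transducer.stateAt] using (hm₀ (i + 1) (by omega)).symm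
  · obtain ⟨m, hm, rfl, hx⟩ := H.candAt_succ hw hc
    exact hstep _ _ hx.symm (hI.below j hj m hm)
  · obtain ⟨m, -, -, -, hg⟩ := H.goodAt_succ hw hG hf hv hc
    exact .inl hg

omit [DecidableEq A] hw [NeZero k] in
theorem pos_congr {w w' : ℕ → A × B} {i : ℕ} (h : ∀ j < i, w j = w' j) :
    G.pos w i = G.pos w' i := by
  induction i with
  | zero => rfl
  | succ i ih => rw [Game.pos, Game.pos, ih fun j hj => h j (by omega), h i (by omega)]

omit [DecidableEq A] hw [NeZero k] in
theorem Visited.congr {w w' : ℕ → A × B} {i : ℕ} (h : ∀ j < i + 1, w j = w' j)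
    (hv : G.Visited o w i) : G.Visited o w' i := by
  obtain ⟨ho, j, hj, hc⟩ := hv
  refine ⟨ho, j, hj, ?_⟩
  rw [← hc, Game.vertex, Game.vertex, pos_congr (G := G) fun l hl => (h l (by omega)).symm,
    h (j / 2) (by omega)]

omit [DecidableEq A] hw [NeZero k] in
theorem agreesUpTo_of_eq {T T' : KTransducer A B k} (hn : T.next = T'.next)
    (hl : T.label = T'.label) (m : Fin k) (i : ℕ) : T.stateAt m w i = T'.stateAt m w i ∧
      (T.AgreesUpTo m w i ↔ T'.AgreesUpTo m w i) := by
  have : ∀ i, T.stateAt m w i = T'.stateAt m w i := by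
    intro i
    induction i with
    | zero => rfl
    | succ i ih => rw [Transducer.stateAt, Transducer.stateAt, ih, hn]
  exact ⟨this i, by simp only [Transducer.AgreesUpTo, this, hl]⟩

omit [DecidableEq A] [NeZero k] hw in
theorem wordAppend_wordPrefix (β : ℕ → A × B) {n j : ℕ} (hj : j < n) :
    wordAppend (wordPrefix w n) β j = w j := by
  have : j < (wordPrefix w n).length := by simpa [wordPrefix] using hj
  rw [wordAppend, dif_pos this]
  simp [wordPrefix]

omit [DecidableEq A] [NeZero k] hw in
theorem agreesFin_wordPrefix {T : KTransducer A B k} (hT : T.Agrees w) (n : ℕ) :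
    T.AgreesFin (wordPrefix w n) := by
  intro i hi
  have hi' : i < n := by simpa [wordPrefix] using hi
  have h1 : (wordPrefix w n).take i = wordPrefix w i := by
    simp [wordPrefix, ← List.map_take, List.take_range, Nat.min_eq_left hi'.le]
  rw [h1]
  have h2 : (wordPrefix w n)[i] = w i := by simp [wordPrefix]
  rw [h2]
  exact hT i

omit [DecidableEq A] [NeZero k] hw in
/-- A winning continuation that agrees with a transducer is a winning path in the product. -/
theorem winnable_of_winningPlay [Finite V₁] [Finite V₂] (hG : G.HasKind o) {T : KTransducer A B k}
    {m₀ : Fin k} (hT : ∀ i, (w i).1 = T.label (T.stateAt m₀ w i)) (hwin : G.WinningPlay o w)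
    {i : ℕ} (hv : ¬ G.Visited o w i) :
    G.Winnable o T (G.pos₂ w i, T.stateAt m₀ w i) := by
  refine ⟨fun r => (G.pos₂ w (r + i), T.stateAt m₀ w (r + i)), fun r => (w (r + i)).2,
    by simp, fun r => ?_, ?_⟩
  · dsimp only
    rw [prodStep_pos₂ T _ (hT (r + i + 1)), Nat.add_right_comm r 1 i]
    rfl
  · have := (Game.wins_of_winningPlay hG hwin i).resolve_left hv
    convert this using 2 with r
    exact prodCol_pos₂ T _ (hT (r + i + 1))

omit hw in
/-- By liveness, the hypotheses are never exhausted. -/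
theorem Inv.lt_total [Finite V₁] [Finite V₂] (hG : G.HasKind o) (hlive : G.IsTransducerLive o k)
    {T : KTransducer A B k} (hT : T.Agrees w) {i h : ℕ} (hI : H.Inv G o d w i h)
    (hv : ¬ G.Visited o w i) : h < H.total := by
  by_contra hle
  obtain ⟨β, ⟨T', hT'⟩, hwin⟩ := hlive (wordPrefix w (i + 1)) ⟨T, agreesFin_wordPrefix hT _⟩
  set w' := wordAppend (wordPrefix w (i + 1)) β with hw'
  have hww : ∀ j < i + 1, w' j = w j := fun j hj => wordAppend_wordPrefix β hj
  obtain ⟨t, ht, hn, hl⟩ := H.trans_surj T'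
  have htot : H.tIdx H.total = H.numT := by
    rw [tIdx, total, Nat.mul_div_cancel _ H.numG_pos,
      Nat.mul_div_cancel _ (Nat.pos_of_neZero k)]
  have htlt : t < H.tIdx h := by
    have := H.tIdx_mono (not_lt.1 hle)
    omega
  rw [Transducer.agrees_iff] at hT'
  have hst : ∀ j ≤ i + 1, (H.trans t).stateAt T'.init w j = T'.stateAt T'.init w' j := by
    intro j hj
    rw [(agreesUpTo_of_eq hn hl T'.init j).1]
    exact Transducer.stateAt_congr _ _ fun l hlj => (hww l (by omega)).symm
  refine hI.refuted t htlt T'.init (fun j hj => ?_) ?_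
  · rw [hst j (by omega), ← hww j hj, hl]
    exact hT' j
  · have hwin' := winnable_of_winningPlay (T := H.trans t) (m₀ := T'.init) (w := w') hG
      (fun j => by rw [(agreesUpTo_of_eq hn hl T'.init j).1, hl]; exact hT' j) hwin
      (i := i) (fun h => hv (Visited.congr hww h))
    have hp : G.pos₂ w i = G.pos₂ w' i := by
      rw [Game.pos₂, Game.pos₂, hww i (by omega),
        pos_congr (G := G) fun l hl => (hww l (by omega)).symm]
    rw [hp, hst i (by omega), ← (agreesUpTo_of_eq hn hl T'.init i).1]
    exact hwin'

section against

variable [Finite V₁] [Finite V₂] (hG : G.HasKind o) (hlive : G.IsTransducerLive o k)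
  {T : KTransducer A B k} (hT : T.Agrees w)

include hG hlive hT

theorem inv_and_fine {i : ℕ} (hv : ¬ G.Visited o w i) :
    H.Inv G o d w i (H.nextHyp G o (H.stateSeq G o d w i) (w i).1) ∧ H.Fine G o d w i := by
  have key : ∀ {i}, H.Inv G o d w i (H.stateSeq G o d w i).hyp → ¬ G.Visited o w i →
      H.Inv G o d w i (H.nextHyp G o (H.stateSeq G o d w i) (w i).1) ∧ H.Fine G o d w i := by
    intro i hI hv
    have h1 := hI.nextHyp H hw
    have h2 := h1.lt_total H hG hlive hT hv
    exact ⟨h1, h2, (H.nextHyp_spec G o _ _).resolve_left (not_le.2 h2)⟩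
  induction i with
  | zero => exact key H.inv_zero hv
  | succ i ih =>
    obtain ⟨h1, h2⟩ := ih fun h => hv (h.mono (by omega))
    exact key (h1.next_round H hw hG h2 hv) hv

omit hG hlive hT hw [Finite V₁] [Finite V₂] in
theorem hyp_mono : Monotone fun i => (H.stateSeq G o d w i).hyp :=
  monotone_nat_of_le_succ fun _ => H.le_nextHyp G o _ _

/-- If the hypothesis adopted in round `i` is kept for `n` rounds, then the play follows the orbit
of its positional strategy, which is good. -/
theorem exists_orbit {i : ℕ} {N : ℕ → Prop} (hN : ∀ r, N (r + 1) → N r) (h0 : N 0)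
    (hv : ∀ r, N r → ¬ G.Visited o w (i + r))
    (hc : ∀ r, N r → (H.stateSeq G o d w (i + r + 1)).hyp = (H.stateSeq G o d w (i + 1)).hyp) :
    ∃ q, G.GoodAt o (H.trans (H.tIdx (H.stateSeq G o d w (i + 1)).hyp))
        (H.strat (H.gIdx (H.stateSeq G o d w (i + 1)).hyp)) q ∧
      ∀ r, N (r + 1) → orbitCol
        (G.prodStep (H.trans (H.tIdx (H.stateSeq G o d w (i + 1)).hyp)))
        (G.prodCol (H.trans (H.tIdx (H.stateSeq G o d w (i + 1)).hyp)))
        (H.strat (H.gIdx (H.stateSeq G o d w (i + 1)).hyp)) q r = G.moveCol w (i + r) := by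
  set h := (H.stateSeq G o d w (i + 1)).hyp with hh
  obtain ⟨m, hm, hg⟩ := (H.okAt_iff hw i h).1 (H.inv_and_fine hw hG hlive hT (hv 0 h0)).2.2
  refine ⟨_, hg, ?_⟩
  set F : V₂ × Fin k → V₂ × Fin k :=
    fun q => G.prodStep (H.trans (H.tIdx h)) q (H.strat (H.gIdx h) q) with hF
  have horb : ∀ r, N r → ∃ m', H.candAt (H.stateSeq G o d w (i + r)) (w (i + r)).1 h (H.jIdx h) =
      some m' ∧ F^[r] (G.pos₂ w i, m) = (G.pos₂ w (i + r), m') ∧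
      ∀ r', r = r' + 1 → orbitCol (G.prodStep (H.trans (H.tIdx h)))
        (G.prodCol (H.trans (H.tIdx h))) (H.strat (H.gIdx h)) (G.pos₂ w i, m) r' =
          G.moveCol w (i + r') := by
    intro r
    induction r with
    | zero => exact fun _ => ⟨m, hm, rfl, by simp⟩
    | succ r ih =>
      intro hr
      obtain ⟨m₁, hm₁, hF₁, -⟩ := ih (hN r hr)
      have hf := (H.inv_and_fine hw hG hlive hT (hv _ hr)).2
      have hf₀ := (H.inv_and_fine hw hG hlive hT (hv _ (hN r hr))).2
      have h1 : (H.stateSeq G o d w (i + r + 1)).hyp = h := hc r (hN r hr)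
      have h2 : H.nextHyp G o (H.stateSeq G o d w (i + (r + 1))) (w (i + (r + 1))).1 = h :=
        hc _ hr
      obtain ⟨m₂, hm₂, -⟩ := (H.okAt_iff hw _ _).1 hf.2
      rw [h2] at hm₂
      obtain ⟨m₃, hm₃, hs, hcol, -⟩ := H.goodAt_succ hw hG hf₀ (hv _ hr) (i := i + r)
        (m' := m₂) (by rw [h1]; exact hm₂)
      rw [h1] at hm₃ hs hcol
      have : m₃ = m₁ := Option.some_injective _ (hm₃.symm.trans hm₁)
      subst this
      refine ⟨m₂, hm₂, ?_, fun r' hr' => ?_⟩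
      · rw [Function.iterate_succ_apply', hF₁]
        exact hs.symm
      · have : r' = r := by omega
        subst this
        rw [hcol, orbitCol]
        change G.prodCol _ (F^[r'] _) (H.strat _ (F^[r'] _)) = _
        rw [hF₁]
  exact fun r hr => (horb (r + 1) hr).choose_spec.2.2 r rfl

theorem winningPlay_of_not_visited (hv : ∀ i, ¬ G.Visited o w i) : G.WinningPlay o w := by
  have hfine := fun i => (H.inv_and_fine hw hG hlive hT (hv i)).2
  -- the number of the hypothesis is bounded, so it does not change from some round on
  obtain ⟨i₀, hi₀⟩ : ∃ i₀, ∀ r, (H.stateSeq G o d w (i₀ + r + 1)).hyp =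
      (H.stateSeq G o d w (i₀ + 1)).hyp := by
    have hbdd : BddAbove (Set.range fun i => (H.stateSeq G o d w (i + 1)).hyp) :=
      ⟨H.total, by rintro _ ⟨i, rfl⟩; exact (hfine i).1.le⟩
    obtain ⟨i₀, h0⟩ := Nat.sSup_mem (Set.range_nonempty _) hbdd
    refine ⟨i₀, fun r => le_antisymm ?_ (H.hyp_mono (by omega))⟩
    dsimp only at h0
    rw [h0]
    exact le_csSup hbdd ⟨i₀ + r, rfl⟩
  obtain ⟨q, hq, horb⟩ := H.exists_orbit hw hG hlive hT (i := i₀) (N := fun _ => True)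
    (fun _ h => h) trivial (fun r _ => hv _) (fun r _ => hi₀ r)
  refine Game.winningPlay_of_wins hG (t := i₀) ?_
  exact (congrArg o.Wins (funext fun r => (horb r trivial).trans (by rw [add_comm]))).mp hq

omit hT hlive [Finite V₁] [Finite V₂] in
theorem lt_of_hyp_ne {i : ℕ} (hf : H.Fine G o d w i) (hf' : H.Fine G o d w (i + 1))
    (hv : ¬ G.Visited o w (i + 1))
    (hne : (H.stateSeq G o d w (i + 2)).hyp ≠ (H.stateSeq G o d w (i + 1)).hyp) :
    (H.stateSeq G o d w (i + 1)).hyp / H.numG < (H.stateSeq G o d w (i + 2)).hyp / H.numG := by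
  have hle : (H.stateSeq G o d w (i + 1)).hyp ≤ (H.stateSeq G o d w (i + 2)).hyp :=
    H.hyp_mono (by omega)
  refine lt_of_le_of_ne (Nat.div_le_div_right hle) fun heq => ?_
  have ht : H.tIdx (H.stateSeq G o d w (i + 2)).hyp = H.tIdx (H.stateSeq G o d w (i + 1)).hyp := by
    rw [tIdx, tIdx, heq]
  have hj : H.jIdx (H.stateSeq G o d w (i + 2)).hyp = H.jIdx (H.stateSeq G o d w (i + 1)).hyp := by
    rw [jIdx, jIdx, heq]
  obtain ⟨m', hm', -⟩ := (H.okAt_iff hw _ _).1 hf'.2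
  have hm : H.candAt (H.stateSeq G o d w (i + 1)) (w (i + 1)).1 (H.stateSeq G o d w (i + 2)).hyp
    (H.jIdx (H.stateSeq G o d w (i + 2)).hyp) = some m' := hm'
  rw [hj, H.candAt_congr _ _ ht] at hm
  obtain ⟨-, -, -, -, hg⟩ := H.goodAt_succ hw hG hf hv hm
  exact hne (H.nextHyp_eq_of_okAt G o _ _ ((H.okAt_iff hw _ _).2 ⟨m', hm, hg⟩))

end against

omit hw in
/-- In a reachability game, a hypothesis is kept for fewer than `P` rounds, and whenever it is given
up, its positional strategies are all given up. -/
theorem visited_of_reachability [Finite V₁] [Fintype V₂] {P : ℕ}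
    (hP : Fintype.card (V₂ × Fin k) ≤ P)
    (hw : (H.strategy G .reachability d).Agrees w)
    (hG : G.HasKind .reachability) (hlive : G.IsTransducerLive .reachability k)
    {T : KTransducer A B k} (hT : T.Agrees w) :
    G.Visited .reachability w (H.numT * k * P) := by
  have key : ∀ r, ¬ G.Visited .reachability w (r * P) →
      r ≤ (H.stateSeq G .reachability d w (r * P + 1)).hyp / H.numG := by
    intro r
    induction r with
    | zero => exact fun _ => Nat.zero_le _
    | succ r ih =>
      intro hv
      rw [Nat.succ_mul] at hv ⊢
      have hv' : ∀ s, s ≤ P → ¬ G.Visited .reachability w (r * P + s) :=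
        fun s hs h => hv (h.mono (by omega))
      have hr := ih (hv' 0 (Nat.zero_le _))
      have hmono := fun {i j : ℕ} (h : i ≤ j) =>
        H.hyp_mono (G := G) (o := .reachability) (d := d) (w := w) h
      dsimp only at hmono
      -- the hypothesis changes within the next `P` rounds
      obtain ⟨s, hs, hne⟩ : ∃ s < P, (H.stateSeq G .reachability d w (r * P + s + 2)).hyp ≠
          (H.stateSeq G .reachability d w (r * P + s + 1)).hyp := by
        by_contra hcon
        push Not at hcon
        have hconst : ∀ s ≤ P, (H.stateSeq G .reachability d w (r * P + s + 1)).hyp =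
            (H.stateSeq G .reachability d w (r * P + 1)).hyp := by
          intro s
          induction s with
          | zero => exact fun _ => rfl
          | succ s ihs =>
            intro hs
            rw [← ihs (by omega), ← hcon s (by omega)]
            rfl
        obtain ⟨q, ⟨i, hi⟩, horb⟩ := H.exists_orbit hw hG hlive hT (i := r * P)
          (N := fun s => s ≤ P) (fun _ h => by omega) (Nat.zero_le _) hv' hconst
        obtain ⟨j, hj, hji⟩ := exists_lt_iterate_eq _ hP q i
        rw [orbitCol, ← hji] at hi
        have hev := horb j hj
        rw [orbitCol] at hev
        rw [hev] at hi
        exact hv' (j + 1) hj (Game.visited_of_even hG hi)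
      have hlt := H.lt_of_hyp_ne hw hG
        (H.inv_and_fine hw hG hlive hT (hv' s hs.le)).2
        (H.inv_and_fine hw hG hlive hT (hv' (s + 1) hs)).2 (hv' (s + 1) hs) hne
      have h1 : (H.stateSeq G .reachability d w (r * P + 1)).hyp / H.numG ≤
          (H.stateSeq G .reachability d w (r * P + s + 1)).hyp / H.numG :=
        Nat.div_le_div_right (hmono (by omega))
      have h2 : (H.stateSeq G .reachability d w (r * P + s + 2)).hyp / H.numG ≤
          (H.stateSeq G .reachability d w (r * P + P + 1)).hyp / H.numG :=
        Nat.div_le_div_right (hmono (by omega))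
      omega
  by_contra hv
  have h1 := key _ hv
  have h2 : (H.stateSeq G .reachability d w (H.numT * k * P + 1)).hyp < H.total :=
    (H.inv_and_fine hw hG hlive hT hv).2.1
  have h3 := Nat.div_lt_of_lt_mul (h2.trans_eq (Nat.mul_comm _ _))
  omega

omit hw in
theorem isWinningStrategy [Finite V₁] [Finite V₂] (hG : G.HasKind o)
    (hlive : G.IsTransducerLive o k) : G.IsWinningStrategy o k (H.strategy G o d) := by
  intro T w hT hw
  by_cases hv : ∃ i, G.Visited o w i
  · obtain ⟨i, rfl, j, -, hj⟩ := hv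
    exact ⟨j, hj⟩
  · exact H.winningPlay_of_not_visited hw hG hlive hT fun i hi => hv ⟨i, hi⟩

end Hyps

/-! ### Mixed radix notation -/

namespace Radix

variable (rad : ℕ → ℕ)

/-- The weight of the `i`-th digit. -/
def weight (i : ℕ) : ℕ := ∏ j ∈ Finset.range i, rad j

/-- The `i`-th digit of `h`. -/
def digit (h i : ℕ) : ℕ := h / weight rad i % rad i

/-- All digits of `h` before the `i`-th one have their largest possible value. -/
def Carry (h i : ℕ) : Prop := ∀ j < i, digit rad h j + 1 = rad j

theorem weight_succ (i : ℕ) : weight rad (i + 1) = weight rad i * rad i :=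
  Finset.prod_range_succ _ _

variable {rad}

theorem succ_div_weight (hr : ∀ i, 0 < rad i) (h i : ℕ) :
    (Carry rad h i → (h + 1) / weight rad i = h / weight rad i + 1) ∧
      (¬ Carry rad h i → (h + 1) / weight rad i = h / weight rad i) := by
  induction i with
  | zero => exact ⟨fun _ => by simp [weight], fun hn => absurd (fun j hj => by omega) hn⟩
  | succ i ih =>
    have hc : Carry rad h (i + 1) ↔ Carry rad h i ∧ digit rad h i + 1 = rad i := by
      constructor
      · exact fun hc => ⟨fun j hj => hc j (by omega), hc i (by omega)⟩
      · rintro ⟨h1, h2⟩ j hj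
        rcases Nat.lt_succ_iff_lt_or_eq.1 hj with hj | rfl
        · exact h1 j hj
        · exact h2
    rw [hc, weight_succ, ← Nat.div_div_eq_div_mul, ← Nat.div_div_eq_div_mul]
    by_cases h1 : Carry rad h i
    · rw [ih.1 h1]
      rcases succ_div_mod (h / weight rad i) (hr i) with ⟨h2, h3, -⟩ | ⟨h2, h3, -⟩
      · exact ⟨fun hh => absurd hh.2 (by unfold digit; omega), fun _ => h3⟩
      · exact ⟨fun _ => h3, fun hh => absurd ⟨h1, h2⟩ hh⟩
    · rw [ih.2 h1]
      exact ⟨fun hh => absurd hh.1 h1, fun _ => rfl⟩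

open Classical in
theorem digit_succ (hr : ∀ i, 0 < rad i) (h i : ℕ) :
    digit rad (h + 1) i = if Carry rad h i then
      (if digit rad h i + 1 = rad i then 0 else digit rad h i + 1) else digit rad h i := by
  split_ifs with h1 h2
  · rw [digit, (succ_div_weight hr h i).1 h1]
    rcases succ_div_mod (h / weight rad i) (hr i) with ⟨h3, -, -⟩ | ⟨-, -, h3⟩
    · exact absurd h2 (by unfold digit; omega)
    · exact h3
  · rw [digit, (succ_div_weight hr h i).1 h1]
    rcases succ_div_mod (h / weight rad i) (hr i) with ⟨-, -, h3⟩ | ⟨h3, -, -⟩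
    · exact h3
    · exact absurd h3 h2
  · rw [digit, (succ_div_weight hr h i).2 h1, digit]

theorem digit_lt (hr : ∀ i, 0 < rad i) (h i : ℕ) : digit rad h i < rad i := Nat.mod_lt _ (hr i)

end Radix

/-! ### The enumeration of the hypotheses -/

/-- The radices of the digits of a hypothesis: `n₂ * k` digits for the positional strategy, one for
the initial state, `k * b` for the transitions and the others for the labels of the transducer. -/
def hypRad (n₂ a b k i : ℕ) : ℕ :=
  if i < n₂ * k then b else if i < n₂ * k + 1 + k * b then k else a

section hyps

open Radix

variable {n₂ a b k : ℕ}

theorem weight_hypRad_strat {i : ℕ} (hi : i ≤ n₂ * k) :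
    weight (hypRad n₂ a b k) i = b ^ i := by
  induction i with
  | zero => rfl
  | succ i ih =>
    rw [weight_succ, ih (by omega), hypRad, if_pos (by omega), pow_succ]

theorem weight_hypRad_next {i : ℕ} (hi : i ≤ k * b) :
    weight (hypRad n₂ a b k) (n₂ * k + 1 + i) = b ^ (n₂ * k) * k * k ^ i := by
  induction i with
  | zero =>
    rw [add_zero, weight_succ, weight_hypRad_strat le_rfl, hypRad, if_neg (by omega),
      if_pos (by omega)]
    simp
  | succ i ih =>
    rw [← add_assoc, weight_succ, ih (by omega), hypRad, if_neg (by omega), if_pos (by omega),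
      pow_succ, mul_assoc]

theorem weight_hypRad_label (i : ℕ) :
    weight (hypRad n₂ a b k) (n₂ * k + 1 + k * b + i) =
      b ^ (n₂ * k) * k * k ^ (k * b) * a ^ i := by
  induction i with
  | zero => rw [add_zero, weight_hypRad_next le_rfl]; simp
  | succ i ih =>
    rw [← add_assoc, weight_succ, ih, hypRad, if_neg (by omega), if_neg (by omega),
      pow_succ, mul_assoc]

theorem mod_pow_div_pow_mod (n r : ℕ) {i L : ℕ} (hi : i < L) :
    n % r ^ L / r ^ i % r = n / r ^ i % r := by
  obtain ⟨c, rfl⟩ := Nat.exists_eq_add_of_lt hi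
  rw [add_assoc, pow_add, Nat.mod_mul_right_div_self,
    Nat.mod_mod_of_dvd _ (dvd_pow_self r (by omega))]

theorem digit_strat (h : ℕ) {i : ℕ} (hi : i < n₂ * k) :
    digit (hypRad n₂ a b k) h i = h % b ^ (n₂ * k) / b ^ i % b := by
  rw [digit, weight_hypRad_strat hi.le, hypRad, if_pos hi, mod_pow_div_pow_mod h b hi]

theorem digit_init (h : ℕ) : digit (hypRad n₂ a b k) h (n₂ * k) = h / b ^ (n₂ * k) % k := by
  rw [digit, weight_hypRad_strat le_rfl, hypRad, if_neg (by omega), if_pos (by omega)]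

theorem digit_next (h : ℕ) {i : ℕ} (hi : i < k * b) :
    digit (hypRad n₂ a b k) h (n₂ * k + 1 + i) = h / b ^ (n₂ * k) / k / k ^ i % k := by
  rw [digit, weight_hypRad_next hi.le, hypRad, if_neg (by omega), if_pos (by omega),
    Nat.div_div_eq_div_mul, Nat.div_div_eq_div_mul, mul_assoc]

theorem digit_label (h i : ℕ) : digit (hypRad n₂ a b k) h (n₂ * k + 1 + k * b + i) =
    h / b ^ (n₂ * k) / k / k ^ (k * b) / a ^ i % a := by
  rw [digit, weight_hypRad_label, hypRad, if_neg (by omega), if_neg (by omega),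
    Nat.div_div_eq_div_mul, Nat.div_div_eq_div_mul, Nat.div_div_eq_div_mul]
  simp only [mul_assoc]

/-- Every function is a table of digits. -/
theorem exists_digits {r L : ℕ} (f : Fin L → Fin r) :
    ∃ n < r ^ L, ∀ i : Fin L, n / r ^ (i : ℕ) % r = f i := by
  refine ⟨finFunctionFinEquiv f, (finFunctionFinEquiv f).2, fun i => ?_⟩
  conv_rhs => rw [← finFunctionFinEquiv.symm_apply_apply f]
  rfl

/-- The enumeration of the hypotheses by the digits of their numbers. -/
def digitHyps (n₂ a b k : ℕ) (ha : 0 < a) (hb : 0 < b) (hk : 0 < k) :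
    Hyps (Fin n₂) (Fin a) (Fin b) k where
  numT := k ^ (k * b) * a ^ k
  numG := b ^ (n₂ * k)
  trans t :=
    { init := ⟨0, hk⟩
      next := fun m y => ⟨t / k ^ ((finProdFinEquiv (m, y) : Fin _) : ℕ) % k, Nat.mod_lt _ hk⟩
      label := fun m => ⟨t / k ^ (k * b) / a ^ (m : ℕ) % a, Nat.mod_lt _ ha⟩ }
  strat i q := ⟨i / b ^ ((finProdFinEquiv q : Fin _) : ℕ) % b, Nat.mod_lt _ hb⟩
  numG_pos := Nat.pow_pos hb
  trans_surj T := by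
    obtain ⟨s, hs, hs'⟩ := exists_digits fun i : Fin (k * b) =>
      T.next (finProdFinEquiv.symm i).1 (finProdFinEquiv.symm i).2
    obtain ⟨l, hl, hl'⟩ := exists_digits T.label
    refine ⟨s + k ^ (k * b) * l, ?_, ?_, ?_⟩
    · calc s + k ^ (k * b) * l < k ^ (k * b) + k ^ (k * b) * l := by omega
        _ = k ^ (k * b) * (l + 1) := by ring
        _ ≤ k ^ (k * b) * a ^ k := Nat.mul_le_mul_left _ hl
    · funext m y
      refine Fin.ext ?_
      have h1 := hs' (finProdFinEquiv (m, y))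
      simp only [Equiv.symm_apply_apply] at h1
      rw [← h1]
      dsimp only
      have h2 : (s + k ^ (k * b) * l) % k ^ (k * b) = s := by
        rw [Nat.add_mul_mod_self_left, Nat.mod_eq_of_lt hs]
      have h3 := mod_pow_div_pow_mod (s + k ^ (k * b) * l) k (finProdFinEquiv (m, y)).2
      rw [h2] at h3
      exact h3.symm
    · funext m
      refine Fin.ext ?_
      dsimp only
      rw [Nat.add_mul_div_left _ _ (Nat.pow_pos hk), Nat.div_eq_of_lt hs, zero_add, hl' m]
  strat_surj g := by
    obtain ⟨i, hi, hi'⟩ := exists_digits fun j : Fin (n₂ * k) => g (finProdFinEquiv.symm j)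
    refine ⟨i, hi, funext fun q => Fin.ext ?_⟩
    have := hi' (finProdFinEquiv q)
    rw [Equiv.symm_apply_apply] at this
    exact this

section digitHyps

variable [NeZero k] (ha : 0 < a) (hb : 0 < b)

local notation "H" => digitHyps n₂ a b k ha hb (Nat.pos_of_neZero k)

theorem digitHyps_next (h : ℕ) (m : Fin k) (y : Fin b) :
    digit (hypRad n₂ a b k) h (n₂ * k + 1 + (y + b * m)) =
      ((Hyps.trans H (Hyps.tIdx H h)).next m y : ℕ) :=
  digit_next h (finProdFinEquiv (m, y)).2

theorem digitHyps_label (h : ℕ) (m : Fin k) :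
    digit (hypRad n₂ a b k) h (n₂ * k + 1 + k * b + m) =
      ((Hyps.trans H (Hyps.tIdx H h)).label m : ℕ) :=
  digit_label h m

theorem digitHyps_strat (h : ℕ) (q : Fin n₂ × Fin k) :
    digit (hypRad n₂ a b k) h (finProdFinEquiv q : Fin _) =
      ((Hyps.strat H (Hyps.gIdx H h) q : Fin b) : ℕ) :=
  digit_strat h (finProdFinEquiv q).2

theorem digitHyps_jIdx (h : ℕ) :
    digit (hypRad n₂ a b k) h (n₂ * k) = (Hyps.jIdx H h : ℕ) :=
  digit_init h

theorem hypRad_pos (ha : 0 < a) (hb : 0 < b) (i : ℕ) : 0 < hypRad n₂ a b k i := by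
  have := Nat.pos_of_neZero k
  unfold hypRad
  split_ifs <;> assumption

open Classical in
theorem digitHyps_tIdx_succ (h : ℕ) : Hyps.tIdx H (h + 1) =
    Hyps.tIdx H h + if Carry (hypRad n₂ a b k) h (n₂ * k + 1) then 1 else 0 := by
  have hw : ∀ n, Hyps.tIdx H n = n / weight (hypRad n₂ a b k) (n₂ * k + 1) := by
    intro n
    have h1 := weight_hypRad_next (n₂ := n₂) (a := a) (b := b) (k := k) (Nat.zero_le _)
    rw [add_zero, pow_zero, mul_one] at h1
    rw [h1, ← Nat.div_div_eq_div_mul]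
    rfl
  rw [hw, hw]
  have := succ_div_weight (fun i => hypRad_pos (n₂ := n₂) (k := k) ha hb i) h (n₂ * k + 1)
  split_ifs with hc
  · exact this.1 hc
  · exact this.2 hc

theorem digitHyps_total_le_succ {h : ℕ} (hh : h < Hyps.total H) : Hyps.total H ≤ h + 1 ↔
    Carry (hypRad n₂ a b k) h (n₂ * k + 1 + k * b + k) := by
  have hw : Hyps.total H = weight (hypRad n₂ a b k) (n₂ * k + 1 + k * b + k) := by
    rw [weight_hypRad_label]
    simp only [Hyps.total, digitHyps]
    ring
  rw [hw] at hh ⊢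
  have := succ_div_weight (fun i => hypRad_pos (n₂ := n₂) (k := k) ha hb i) h
    (n₂ * k + 1 + k * b + k)
  rw [Nat.div_eq_of_lt hh] at this
  constructor
  · intro hle
    by_contra hc
    have h1 := this.2 hc
    rw [Nat.div_eq_zero_iff] at h1
    omega
  · intro hc
    by_contra hlt
    have h1 := this.1 hc
    rw [Nat.div_eq_of_lt (by omega)] at h1
    omega

end digitHyps

end hyps

/-! ### Conditions and tables in expressions and commands -/

namespace StackProg

variable {V : Type} [DecidableEq V]

/-- The entry of the array `v` at the index `i`, or `0` out of range. -/
def val (m : V → List ℕ) (v : V) (i : ℕ) : ℕ := (m v).getD i 0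

@[simp]
theorem val_pushVar_self (m : V → List ℕ) (v : V) (x : ℕ) : val (pushVar m v x) v 0 = x := by
  simp [val, pushVar]

@[simp]
theorem val_pushVar_of_ne (m : V → List ℕ) {u v : V} (h : u ≠ v) (x i : ℕ) :
    val (pushVar m v x) u i = val m u i := by
  simp [val, pushVar, h]

theorem val_update_of_ne (m : V → List ℕ) {u v : V} (h : u ≠ v) (l : List ℕ) (i : ℕ) :
    val (Function.update m v l) u i = val m u i := by
  simp [val, h]

theorem val_update_self (m : V → List ℕ) (v : V) (x : ℕ) :
    val (Function.update m v [x]) v 0 = x := by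
  simp [val]

omit [DecidableEq V] in
theorem Cmd.Fits.val_le {B : ℕ} {m : V → List ℕ} (h : Cmd.Fits B m) (v : V) (i : ℕ) :
    val m v i ≤ B :=
  h.below.getD v i

namespace Expr

@[simp] theorem eval_lit (n : ℕ) (m : V → List ℕ) : (lit n).eval m = n := rfl

@[simp] theorem eval_get (A : V) (e : Expr V) (m : V → List ℕ) :
    (get A e).eval m = val m A (e.eval m) := rfl

@[simp] theorem eval_add (e f : Expr V) (m : V → List ℕ) :
    (add e f).eval m = e.eval m + f.eval m := rfl

@[simp] theorem eval_mul (e f : Expr V) (m : V → List ℕ) :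
    (mul e f).eval m = e.eval m * f.eval m := rfl

@[simp] theorem eval_sub (e f : Expr V) (m : V → List ℕ) :
    (sub e f).eval m = e.eval m - f.eval m := rfl

instance : Add (Expr V) := ⟨add⟩

instance : Mul (Expr V) := ⟨mul⟩

instance : Sub (Expr V) := ⟨sub⟩

instance (n : ℕ) : OfNat (Expr V) n := ⟨lit n⟩

@[simp] theorem eval_ofNat (n : ℕ) (m : V → List ℕ) :
    (no_index (OfNat.ofNat n : Expr V)).eval m = n := rfl

@[simp] theorem eval_hAdd (e f : Expr V) (m : V → List ℕ) :
    (e + f).eval m = e.eval m + f.eval m := rfl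

@[simp] theorem eval_hMul (e f : Expr V) (m : V → List ℕ) :
    (e * f).eval m = e.eval m * f.eval m := rfl

@[simp] theorem eval_hSub (e f : Expr V) (m : V → List ℕ) :
    (e - f).eval m = e.eval m - f.eval m := rfl

/-- An expression is used as a condition that holds if the value is not zero. -/
def Holds (e : Expr V) (m : V → List ℕ) : Prop := e.eval m ≠ 0

instance (e : Expr V) (m : V → List ℕ) : Decidable (e.Holds m) :=
  inferInstanceAs (Decidable (e.eval m ≠ 0))

/-- The negation of a condition. -/
def not (e : Expr V) : Expr V := sub (lit 1) e

/-- The conjunction of two conditions. -/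
def and (e f : Expr V) : Expr V := mul e f

/-- The condition that one value is at most another one. -/
def le (e f : Expr V) : Expr V := not (sub e f)

/-- The condition that two values are equal. -/
def eq (e f : Expr V) : Expr V := and (le e f) (le f e)

/-- The value of `e` if the condition `c` holds, and the value of `f` otherwise. -/
def ite (c e f : Expr V) : Expr V := add (mul (not (not c)) e) (mul (not c) f)

/-- The condition that `body` holds for all values less than `n` of the first entry of `i`. -/
def all (cap acc i : V) (n body : Expr V) : Expr V :=
  loop cap acc i n (lit 1) (mul (get acc (lit 0)) body)

@[simp] theorem holds_not (e : Expr V) (m : V → List ℕ) : (not e).Holds m ↔ ¬ e.Holds m := by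
  simp only [Holds, not, eval_sub, eval_lit]
  omega

@[simp] theorem holds_and (e f : Expr V) (m : V → List ℕ) :
    (and e f).Holds m ↔ e.Holds m ∧ f.Holds m :=
  mul_ne_zero_iff

@[simp] theorem holds_le (e f : Expr V) (m : V → List ℕ) :
    (le e f).Holds m ↔ e.eval m ≤ f.eval m := by
  simp only [Holds, le, not, eval_sub, eval_lit]
  omega

@[simp] theorem holds_eq (e f : Expr V) (m : V → List ℕ) :
    (eq e f).Holds m ↔ e.eval m = f.eval m := by
  simp only [eq, holds_and, holds_le, le_antisymm_iff]

theorem holds_get (A : V) (e : Expr V) (m : V → List ℕ) :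
    (get A e).Holds m ↔ val m A (e.eval m) ≠ 0 := Iff.rfl

@[simp] theorem eval_ite (c e f : Expr V) (m : V → List ℕ) :
    (ite c e f).eval m = if c.Holds m then e.eval m else f.eval m := by
  simp only [ite, not, eval_add, eval_mul, eval_sub, eval_lit]
  by_cases h : c.Holds m
  · rw [if_pos h, Nat.sub_eq_zero_of_le (Nat.pos_of_ne_zero h)]
    simp
  · rw [if_neg h, not_not.1 h]
    simp

/-- A loop without cut-off computes an iteration. -/
theorem eval_loop {cap acc i : V} {n init body : Expr V} {m : V → List ℕ} (f : ℕ → ℕ)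
    (hi : cap ≠ i) (ha : cap ≠ acc) (h0 : init.eval m = f 0)
    (hs : ∀ j < n.eval m, body.eval (pushVar (pushVar m i j) acc (f j)) = f (j + 1))
    (hf : ∀ j < n.eval m, f (j + 1) ≤ val m cap 0) :
    (loop cap acc i n init body).eval m = f (n.eval m) := by
  have : ∀ N ≤ n.eval m, Nat.rec (motive := fun _ => ℕ) (init.eval m) (fun j r =>
      min ((pushVar (pushVar m i j) acc r cap).getD 0 0)
        (body.eval (pushVar (pushVar m i j) acc r))) N = f N := by
    intro N
    induction N with
    | zero => exact fun _ => h0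
    | succ N ih =>
      intro hN
      dsimp only
      rw [ih (by omega), hs N (by omega)]
      refine min_eq_right ?_
      have := hf N (by omega)
      rwa [← val_pushVar_of_ne m hi N, ← val_pushVar_of_ne _ ha (f N)] at this
  exact this _ le_rfl

theorem holds_all {cap acc i : V} {n body : Expr V} {m : V → List ℕ} (p : ℕ → Prop)
    (hi : cap ≠ i) (ha : cap ≠ acc) (hcap : 0 < val m cap 0)
    (hs : ∀ j < n.eval m, ∀ r, body.Holds (pushVar (pushVar m i j) acc r) ↔ p j) :
    (all cap acc i n body).Holds m ↔ ∀ j < n.eval m, p j := by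
  have : ∀ N ≤ n.eval m, Nat.rec (motive := fun _ => ℕ) ((lit 1 : Expr V).eval m) (fun j r =>
      min ((pushVar (pushVar m i j) acc r cap).getD 0 0)
        ((mul (get acc (lit 0)) body).eval (pushVar (pushVar m i j) acc r))) N ≠ 0 ↔
      ∀ j < N, p j := by
    intro N
    induction N with
    | zero => simp
    | succ N ih =>
      intro hN
      dsimp only
      generalize Nat.rec (motive := fun _ => ℕ) _ _ N = r at ih ⊢
      have h1 : (pushVar (pushVar m i N) acc r cap).getD 0 0 = val m cap 0 := by
        rw [← val_pushVar_of_ne m hi N, ← val_pushVar_of_ne _ ha r]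
        rfl
      have h2 := hs N (by omega) r
      rw [h1, eval_mul, eval_get, eval_lit, val_pushVar_self]
      have h3 : min (val m cap 0) (r * body.eval (pushVar (pushVar m i N) acc r)) ≠ 0 ↔
          r ≠ 0 ∧ body.Holds (pushVar (pushVar m i N) acc r) := by
        rw [Holds, ← mul_ne_zero_iff]
        omega
      rw [h3, ih (by omega), h2]
      constructor
      · rintro ⟨h4, h5⟩ j hj
        rcases Nat.lt_succ_iff_lt_or_eq.1 hj with hj | rfl
        · exact h4 j hj
        · exact h5
      · exact fun h4 => ⟨fun j hj => h4 j (by omega), h4 N (by omega)⟩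
  exact this _ le_rfl

end Expr

namespace Cmd

/-- An assignment replaces an array by the table of a function. -/
theorem exec_assign_ite {B : ℕ} {A t : V} {n body : Expr V} {m : V → List ℕ} (N : ℕ) (f : ℕ → ℕ)
    (hn : n.eval m = N) (hf : ∀ j < N, body.eval (pushVar m t j) = f j) (hN : N ≤ B)
    (hB : ∀ j < N, f j ≤ B) :
    ∃ m', Exec B (assign A t n body) m m' ∧ (∀ j, val m' A j = if j < N then f j else 0) ∧
      ∀ v ≠ A, ∀ i, val m' v i = val m v i := by
  subst hn
  refine ⟨_, .assign hN fun j hj => by rw [hf j hj]; exact hB j hj, fun j => ?_, fun v hv i => ?_⟩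
  · split_ifs with hj
    · rw [← hf j hj]
      simp [val, assignMem, hj]
    · simp [val, assignMem, List.getElem?_eq_none (l := List.range (n.eval m)) (by simpa using hj)]
  · exact val_update_of_ne m hv _ i

theorem exec_assign {B : ℕ} {A t : V} {n body : Expr V} {m : V → List ℕ} (N : ℕ) (f : ℕ → ℕ)
    (hn : n.eval m = N) (hf : ∀ j < N, body.eval (pushVar m t j) = f j) (hN : N ≤ B)
    (hB : ∀ j < N, f j ≤ B) :
    ∃ m', Exec B (assign A t n body) m m' ∧ (∀ j < N, val m' A j = f j) ∧
      ∀ v ≠ A, ∀ i, val m' v i = val m v i := by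
  obtain ⟨m', h1, h2, h3⟩ := exec_assign_ite (A := A) N f hn hf hN hB
  exact ⟨m', h1, fun j hj => by rw [h2, if_pos hj], h3⟩

/-- The assignment of a single number. -/
def set (v t : V) (e : Expr V) : Cmd V := assign v t (.lit 1) e

theorem exec_set {B : ℕ} {v t : V} {e : Expr V} {m : V → List ℕ} (x : ℕ)
    (he : e.eval (pushVar m t 0) = x) (hx : x ≤ B) (hB : 1 ≤ B) :
    ∃ m', Exec B (set v t e) m m' ∧ val m' v 0 = x ∧
      ∀ u ≠ v, ∀ i, val m' u i = val m u i := by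
  obtain ⟨m', h1, h2, h3⟩ := exec_assign (B := B) (A := v) (t := t) (n := .lit 1) (body := e)
    (m := m) 1 (fun _ => x) rfl (fun j hj => by obtain rfl : j = 0 := by omega
                                                exact he) hB (fun _ _ => hx)
  exact ⟨m', h1, h2 0 one_pos, h3⟩

theorem exec_cond_of {B : ℕ} {e : Expr V} {c : Cmd V} {m m' : V → List ℕ} (he : e.Holds m)
    (h : Exec B c m m') : Exec B (cond e c) m m' := .cond_exec he h

theorem exec_cond_of_not {B : ℕ} {e : Expr V} {c : Cmd V} {m : V → List ℕ} (he : ¬ e.Holds m) :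
    Exec B (cond e c) m m := .cond_skip (not_not.1 he)

end Cmd

end StackProg

/-! ### The program of the machine -/

namespace GameProg

open StackProg Expr Cmd

/-- The variables of the program. `num` holds the numbers of the code of the game, and `ord` and
`par` hold, for every vertex, the rank of its colour among the colours that occur and the parity of
its colour. The digits of the current hypothesis are in `hyp`, and `cand` holds the states of the
candidates, where the number of states stands for a contradicted candidate. -/
inductive Var
  | num | cnt | mode | old | inp | idx | par | ord | rank | pr | fresh | cap | vtx | pos | hyp
  | exh | cand | cur | good | quo | rem | sn | su | sv | nx | eo | ep | orb | ans | chg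
  | t | acc | cyc | acc' | cyc'
  deriving DecidableEq

open Var

instance : Fintype Var where
  elems := {num, cnt, mode, old, inp, idx, par, ord, rank, pr, fresh, cap, vtx, pos, hyp, exh,
    cand, cur, good, quo, rem, sn, su, sv, nx, eo, ep, orb, ans, chg, t, acc, cyc, acc', cyc'}
  complete x := by cases x <;> decide

/-- The first entry of an array. -/
abbrev fst (v : Var) : Expr Var := get v 0

/-- The number of states of the transducers. -/
abbrev nK : Expr Var := get num 0

/-- The number of actions of player 1. -/
abbrev nA : Expr Var := get num 1

/-- The number of actions of player 2. -/
abbrev nB : Expr Var := get num 2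

/-- The number of vertices of player 1. -/
abbrev n1 : Expr Var := get num 3

/-- The number of vertices of player 2. -/
abbrev n2 : Expr Var := get num 4

/-- The assignment of a table, whose index is the first entry of `t`. -/
abbrev tab (A : Var) (n body : Expr Var) : Cmd Var := assign A t n body

/-- The assignment of a number. -/
abbrev put (v : Var) (e : Expr Var) : Cmd Var := set v t e

/-- The condition that `body` holds for all values less than `n` of the first entry of `cyc`. -/
abbrev allCyc (n body : Expr Var) : Expr Var := all cap acc cyc n body

/-- The condition that `body` holds for all values less than `n` of the first entry of `cyc'`. -/
abbrev allCyc' (n body : Expr Var) : Expr Var := all cap acc' cyc' n body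

/-- The position of the labels of the transducer in the digits of a hypothesis. -/
abbrev labelPos : Expr Var := n2 * nK + 1 + nK * nB

/-- The radix of the digit of a hypothesis at the position `e`. -/
def radix (e : Expr Var) : Expr Var :=
  ite (le (e + 1) (n2 * nK)) nB (ite (le (e + 1) labelPos) nK nA)

/-- The digits of the current hypothesis before the position `n` are as large as possible. -/
def carries (n : Expr Var) : Expr Var :=
  allCyc n (eq (get hyp (fst cyc) + 1) (radix (fst cyc)))

/-- The positional strategy of the current hypothesis wins from the current candidate: after the
first `base` moves in the product, an even colour occurs that is not exceeded later on. -/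
def wins (base : Expr Var) : Expr Var :=
  not (allCyc (n2 * nK) (not (and (eq (get ep (get orb (base + fst cyc))) 0)
    (allCyc' (n2 * nK)
      (le (get eo (get orb (base + fst cyc'))) (get eo (get orb (base + fst cyc))))))))

/-- The number of moves in the product after which the colours are considered. -/
def baseExpr : Objective → Expr Var
  | .reachability => 0
  | .buchi => n2 * nK
  | .parity => n2 * nK

/-- The moves in the product of the game and the transducer of the current hypothesis, if player 2
uses the positional strategy of the hypothesis. -/
def moves : Cmd Var :=
  .seq (tab sn (n2 * nK) (get hyp (n2 * nK + 1 + (get hyp (fst t) + nB * get rem (fst t)))))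
  (.seq (tab su (n2 * nK) (get num (6 + n1 * nA + (get quo (fst t) * nB + get hyp (fst t)))))
  (.seq (tab sv (n2 * nK)
    (get num (6 + (get su (fst t) * nA + get hyp (labelPos + get sn (fst t))))))
  (tab nx (n2 * nK) (get sn (fst t) + nK * get sv (fst t)))))

/-- The ranks and the parities of the colours of these moves. -/
def moveCols : Cmd Var :=
  .seq (tab eo (n2 * nK) (ite (le (get ord (n1 + get sv (fst t))) (get ord (get su (fst t))))
    (get ord (get su (fst t))) (get ord (n1 + get sv (fst t)))))
  (tab ep (n2 * nK) (ite (le (get ord (n1 + get sv (fst t))) (get ord (get su (fst t))))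
    (get par (get su (fst t))) (get par (n1 + get sv (fst t)))))

/-- The test whether the current hypothesis can be adopted. -/
def check (o : Objective) : Cmd Var :=
  .seq (put cur (ite (le (get cand (get hyp (n2 * nK)) + 1) nK) (get cand (get hyp (n2 * nK))) 0))
  (.seq moves (.seq moveCols
  (.seq (tab orb (n2 * nK + n2 * nK)
    (loop cap acc cyc (fst t) (fst cur + nK * fst pos) (get nx (fst acc))))
  (put good (ite (and (le (get cand (get hyp (n2 * nK)) + 1) nK) (wins (baseExpr o))) 1 0)))))

/-- The transition to the next hypothesis. -/
def advance : Cmd Var :=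
  .seq (put chg (ite (carries (n2 * nK + 1)) 1 0))
  (.seq (put exh (ite (carries (labelPos + nK)) 1 0))
  (.seq (tab hyp (labelPos + nK) (ite (carries (fst t))
    (ite (eq (get hyp (fst t) + 1) (radix (fst t))) 0 (get hyp (fst t) + 1)) (get hyp (fst t))))
  (tab cand nK (ite (fst chg) (ite (eq (get hyp (labelPos + fst t)) (fst inp)) (fst t) nK)
    (get cand (fst t))))))

/-- A round of the play. -/
def play (o : Objective) : Cmd Var :=
  .seq (put pos (get num (6 + (fst vtx * nA + fst inp))))
  (.seq (tab cand nK (ite (and (le (get cand (fst t) + 1) nK)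
    (eq (get hyp (labelPos + get cand (fst t))) (fst inp))) (get cand (fst t)) nK))
  (.seq (check o)
  (.seq (.loop (and (not (fst good)) (not (fst exh))) (.seq advance (check o)))
  (.seq (put ans (ite (fst exh) 0 (get hyp (fst cur + nK * fst pos))))
  (.seq (tab cand nK (ite (le (get cand (fst t) + 1) nK)
    (get hyp (n2 * nK + 1 + (fst ans + nB * get cand (fst t)))) nK))
  (put vtx (get num (6 + n1 * nA + (fst pos * nB + fst ans)))))))))

/-- The preparation of the play after the code of the game has been read. -/
def startPlay : Cmd Var :=
  .seq (put cap (n2 * nK + 1))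
  (.seq (tab quo (n2 * nK)
    (loop cap acc cyc n2 0 (ite (le (nK * fst cyc) (fst t)) (fst cyc) (fst acc))))
  (.seq (tab rem (n2 * nK) (fst t - nK * get quo (fst t)))
  (.seq (put vtx (get num 5))
  (.seq (tab hyp (labelPos + nK) 0)
  (.seq (tab cand nK (fst t))
  (put exh 0))))))

/-- Reading a bit of the numbers at the beginning of the code. -/
def readNumber : Cmd Var :=
  .seq (tab num (fst cnt + 1) (ite (eq (fst t) (fst cnt)) (get num (fst t) + fst inp)
    (get num (fst t))))
  (.seq (put cnt (fst cnt + (1 - fst inp)))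
  (put mode (ite (and (le 6 (fst cnt)) (eq (fst cnt) (6 + n1 * nA + n2 * nB))) 1 0)))

/-- Reading the bit in front of a characteristic sequence. -/
def readHeader : Cmd Var :=
  .seq (put idx 0)
  (.seq (put mode (ite (fst inp) 2 3))
  (cond (not (fst inp)) startPlay))

/-- Reading a bit of a characteristic sequence. -/
def readBlock : Cmd Var :=
  .seq (tab par (n1 + n2) (ite (and (eq (fst t) (fst idx)) (fst inp)) (fst pr)
    (get par (fst t))))
  (.seq (tab ord (n1 + n2) (ite (and (eq (fst t) (fst idx)) (fst inp)) (fst rank)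
    (get ord (fst t))))
  (.seq (put fresh (ite (fst inp) 1 (fst fresh)))
  (.seq (put idx (fst idx + 1))
  (cond (eq (fst idx) (n1 + n2))
    (.seq (put mode 1)
    (.seq (put rank (fst rank + fst fresh))
    (.seq (put pr (1 - fst pr))
    (put fresh 0))))))))

/-- The program of a round. The variable `old` holds the phase in which the round starts. -/
def round (o : Objective) : Cmd Var :=
  .seq (put old (fst mode))
  (.seq (cond (eq (fst old) 0) readNumber)
  (.seq (cond (eq (fst old) 1) readHeader)
  (.seq (cond (eq (fst old) 2) readBlock)
  (cond (eq (fst old) 3) (play o)))))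

/-- There is an output in the rounds of the play only. -/
def output : Expr Var := ite (eq (fst old) 3) (fst ans + 1) 0

end GameProg

/-! ### Rounds of the play -/

/-- The number of colours less than `c` that occur in the game. -/
noncomputable def Game.rankOf {V₁ V₂ A B : Type*} (G : Game V₁ V₂ A B) (c : ℕ) : ℕ :=
  open Classical in ((Finset.range c).filter fun d => ∃ z, G.color z = d).card

theorem Game.rankOf_le_iff {V₁ V₂ A B : Type*} (G : Game V₁ V₂ A B) (z z' : V₁ ⊕ V₂) :
    G.rankOf (G.color z) ≤ G.rankOf (G.color z') ↔ G.color z ≤ G.color z' := by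
  classical
  have key : ∀ x y, G.color x < G.color y → G.rankOf (G.color x) < G.rankOf (G.color y) := by
    intro x y h
    refine Finset.card_lt_card ⟨fun d hd => ?_, fun hsub => ?_⟩
    · simp only [Finset.mem_filter, Finset.mem_range] at hd ⊢
      exact ⟨by omega, hd.2⟩
    · have := @hsub (G.color x) (Finset.mem_filter.2 ⟨Finset.mem_range.2 h, x, rfl⟩)
      simp at this
  constructor
  · intro h
    by_contra hlt
    have := key z' z (by omega)
    omega
  · intro h
    rcases h.lt_or_eq with h | h
    · exact (key z z' h).le
    · rw [h]

theorem Game.rankOf_succ {V₁ V₂ A B : Type*} (G : Game V₁ V₂ A B) (c : ℕ)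
    [Decidable (∃ z, G.color z = c)] :
    G.rankOf (c + 1) = G.rankOf c + if ∃ z, G.color z = c then 1 else 0 := by
  classical
  rw [rankOf, Finset.range_add_one, Finset.filter_insert]
  split_ifs with h
  · rw [Finset.card_insert_of_notMem (by simp)]; rfl
  · rfl

theorem Game.rankOf_le {V₁ V₂ A B : Type*} [Fintype V₁] [Fintype V₂] (G : Game V₁ V₂ A B)
    (c : ℕ) : G.rankOf c ≤ Fintype.card V₁ + Fintype.card V₂ := by
  classical
  rw [← Fintype.card_sum, ← Finset.card_univ]
  refine (Finset.card_le_card ?_).trans (Finset.card_image_le (f := G.color))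
  intro d hd
  simp only [Finset.mem_filter] at hd
  simpa using hd.2

namespace GameProg

open StackProg Expr Cmd Var Radix

variable {n₁ n₂ a b k : ℕ}

/-- The memory holds the numbers at the beginning of the code of the game. -/
structure NumEnv (G : Game (Fin n₁) (Fin n₂) (Fin a) (Fin b)) (k : ℕ) (m : Var → List ℕ) :
    Prop where
  k_eq : val m num 0 = k
  a_eq : val m num 1 = a
  b_eq : val m num 2 = b
  n₁_eq : val m num 3 = n₁
  n₂_eq : val m num 4 = n₂
  init_eq : val m num 5 = G.init
  E₁_eq : ∀ (u : Fin n₁) (x : Fin a), val m num (6 + (u * a + x)) = G.E₁ u x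
  E₂_eq : ∀ (v : Fin n₂) (y : Fin b), val m num (6 + n₁ * a + (v * b + y)) = G.E₂ v y

/-- The memory holds the ranks and the parities of the colours. -/
structure ColEnv (G : Game (Fin n₁) (Fin n₂) (Fin a) (Fin b)) (m : Var → List ℕ) : Prop where
  ord₁ : ∀ u : Fin n₁, val m ord u = G.rankOf (G.color (.inl u))
  ord₂ : ∀ v : Fin n₂, val m ord (n₁ + v) = G.rankOf (G.color (.inr v))
  par₁ : ∀ u : Fin n₁, val m par u = G.color (.inl u) % 2
  par₂ : ∀ v : Fin n₂, val m par (n₁ + v) = G.color (.inr v) % 2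

/-- The part of the memory that does not change during the play. -/
structure Env (G : Game (Fin n₁) (Fin n₂) (Fin a) (Fin b)) (k : ℕ) (m : Var → List ℕ) : Prop
    extends NumEnv G k m, ColEnv G m where
  cap_eq : val m cap 0 = n₂ * k + 1
  quo_eq : ∀ q : Fin n₂ × Fin k, val m quo (finProdFinEquiv q : Fin _) = q.1
  rem_eq : ∀ q : Fin n₂ × Fin k, val m rem (finProdFinEquiv q : Fin _) = q.2
  mode_eq : val m mode 0 = 3

variable {G : Game (Fin n₁) (Fin n₂) (Fin a) (Fin b)} {m m' : Var → List ℕ}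

theorem NumEnv.congr (h : NumEnv G k m) (hn : ∀ i, val m' num i = val m num i) :
    NumEnv G k m' := by
  constructor <;> simp only [hn, h.k_eq, h.a_eq, h.b_eq, h.n₁_eq, h.n₂_eq, h.init_eq, h.E₁_eq,
    h.E₂_eq, implies_true]

theorem ColEnv.congr (h : ColEnv G m) (ho : ∀ i, val m' ord i = val m ord i)
    (hp : ∀ i, val m' par i = val m par i) : ColEnv G m' := by
  constructor <;> simp only [ho, hp, h.ord₁, h.ord₂, h.par₁, h.par₂, implies_true]

theorem Env.frame (h : Env G k m) {A : Var}
    (hf : ∀ v ≠ A, ∀ i, val m' v i = val m v i)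
    (hA : ∀ v ∈ [num, ord, par, cap, quo, rem, mode], v ≠ A := by decide) :
    Env G k m' := by
  have hf' : ∀ v ∈ [num, ord, par, cap, quo, rem, mode], ∀ i,
      val m' v i = val m v i := fun v hv => hf v (hA v hv)
  simp only [List.forall_mem_cons, List.not_mem_nil, false_imp_iff, implies_true, and_true] at hf'
  obtain ⟨h1, h2, h3, h4, h5, h6, h7⟩ := hf'
  exact { h.toNumEnv.congr h1, h.toColEnv.congr h2 h3 with
    cap_eq := by rw [h4, h.cap_eq]
    quo_eq := by simp only [h5, h.quo_eq, implies_true]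
    rem_eq := by simp only [h6, h.rem_eq, implies_true]
    mode_eq := by rw [h7, h.mode_eq] }

/-- A bound for all lengths and values during the computation. -/
def Bound (n₁ n₂ a b k B : ℕ) : Prop :=
  2 * (n₂ * k) + k * b + n₁ * a + n₂ * b + n₁ + n₂ + a + b + k + 10 ≤ B

variable [NeZero k] (ha : 0 < a) (hb : 0 < b)

local notation "H" => digitHyps n₂ a b k ha hb (Nat.pos_of_neZero k)

/-- The memory during the search for a hypothesis: `h` is the current one. -/
structure Search (G : Game (Fin n₁) (Fin n₂) (Fin a) (Fin b)) (st : MemState (Fin n₁) k)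
    (x : Fin a) (h : ℕ) (m : Var → List ℕ) : Prop extends Env G k m where
  inp_eq : val m inp 0 = x
  old_eq : val m old 0 = 3
  pos_eq : val m pos 0 = G.E₁ st.vtx x
  hyp_eq : ∀ i < n₂ * k + 1 + k * b + k, val m hyp i = digit (hypRad n₂ a b k) h i
  cand_eq : ∀ i : Fin k, val m cand i =
    (Hyps.candAt H st x h i).elim k ((↑) : Fin k → ℕ)
  exh_eq : val m exh 0 = if Hyps.total H ≤ h then 1 else 0

variable (n₂) in
/-- The state of the current candidate, or `0` if it has been contradicted. -/
def curState (st : MemState (Fin n₁) k) (x : Fin a) (h : ℕ) : Fin k :=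
  (Hyps.candAt H st x h (Hyps.jIdx H h)).getD 0

/-- The move in the product from a state. -/
def prodMove (G : Game (Fin n₁) (Fin n₂) (Fin a) (Fin b)) (h : ℕ)
    (q : Fin n₂ × Fin k) : Fin n₂ × Fin k :=
  G.prodStep (Hyps.trans H (Hyps.tIdx H h)) q (Hyps.strat H (Hyps.gIdx H h) q)

variable {ha hb} {st : MemState (Fin n₁) k} {x : Fin a} {h : ℕ}

theorem Search.frame (hS : Search ha hb G st x h m) {A : Var}
    (hf : ∀ v ≠ A, ∀ i, val m' v i = val m v i)
    (hA : ∀ v ∈ [num, ord, par, cap, quo, rem, mode, inp, old, pos,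
      hyp, cand, exh], v ≠ A := by decide) :
    Search ha hb G st x h m' := by
  have hf' : ∀ v ∈ [num, ord, par, cap, quo, rem, mode, inp, old, pos,
      hyp, cand, exh], ∀ i,
      val m' v i = val m v i := fun v hv => hf v (hA v hv)
  simp only [List.forall_mem_cons, List.not_mem_nil, false_imp_iff, implies_true, and_true] at hf'
  obtain ⟨h1, h2, h3, h4, h5, h6, h7, h8, h9, h10, h11, h12, h13⟩ := hf'
  exact { hS.toEnv.frame hf fun v hv => hA v (by
            simp only [List.mem_cons, List.not_mem_nil, or_false] at hv ⊢; tauto) with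
    inp_eq := by rw [h8, hS.inp_eq]
    old_eq := by rw [h9, hS.old_eq]
    pos_eq := by rw [h10, hS.pos_eq]
    hyp_eq := by simpa only [h11] using hS.hyp_eq
    cand_eq := by simp only [h12, hS.cand_eq, implies_true]
    exh_eq := by rw [h13, hS.exh_eq] }

theorem Search.next (hS : Search ha hb G st x h m) (s : Fin k) (y : Fin b) :
    val m hyp (n₂ * k + 1 + (y + b * s)) = ((Hyps.trans H (Hyps.tIdx H h)).next s y : ℕ) := by
  rw [← digitHyps_next, hS.hyp_eq]
  have := (finProdFinEquiv (s, y)).2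
  simp only [finProdFinEquiv_apply_val] at this
  omega

theorem Search.label (hS : Search ha hb G st x h m) (s : Fin k) :
    val m hyp (n₂ * k + 1 + k * b + s) = ((Hyps.trans H (Hyps.tIdx H h)).label s : ℕ) := by
  rw [← digitHyps_label, hS.hyp_eq]
  omega

theorem Search.strat (hS : Search ha hb G st x h m) (q : Fin n₂ × Fin k) :
    val m hyp (finProdFinEquiv q : Fin _) =
      ((Hyps.strat H (Hyps.gIdx H h) q : Fin b) : ℕ) := by
  rw [← digitHyps_strat, hS.hyp_eq]
  omega

theorem Search.jIdx (hS : Search ha hb G st x h m) :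
    val m hyp (n₂ * k) = (Hyps.jIdx H h : ℕ) := by
  rw [← digitHyps_jIdx ha hb, hS.hyp_eq]
  omega

omit [NeZero k] in
theorem exists_prod_index {j : ℕ} (hj : j < n₂ * k) :
    ∃ q : Fin n₂ × Fin k, j = (finProdFinEquiv q : Fin _) :=
  ⟨finProdFinEquiv.symm ⟨j, hj⟩, by rw [Equiv.apply_symm_apply]⟩

theorem exec_moves {B : ℕ} (hB : Bound n₁ n₂ a b k B) (hS : Search ha hb G st x h m) :
    ∃ m', Exec B moves m m' ∧ Search ha hb G st x h m' ∧ val m' cur 0 = val m cur 0 ∧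
      ∀ q : Fin n₂ × Fin k,
        val m' su (finProdFinEquiv q : Fin _) =
          G.E₂ q.1 (Hyps.strat H (Hyps.gIdx H h) q) ∧
        val m' sv (finProdFinEquiv q : Fin _) = (prodMove ha hb G h q).1 ∧
        val m' nx (finProdFinEquiv q : Fin _) =
          (finProdFinEquiv (prodMove ha hb G h q) : Fin _) := by
  unfold Bound at hB
  obtain ⟨m1, e1, v1, f1⟩ := exec_assign (B := B) (A := sn) (t := t) (n := n2 * nK)
    (body := get hyp (n2 * nK + 1 + (get hyp (fst t) + nB * get rem (fst t)))) (m := m)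
    (n₂ * k) (fun j => val m hyp (n₂ * k + 1 + (val m hyp j + b * val m rem j)))
    (by simp [hS.n₂_eq, hS.k_eq]) (by simp [hS.n₂_eq, hS.k_eq, hS.b_eq]) (by omega) (by
      intro j hj
      obtain ⟨q, rfl⟩ := exists_prod_index hj
      rw [hS.rem_eq, hS.strat, hS.next]
      omega)
  have S1 := hS.frame f1
  have w1 : ∀ q : Fin n₂ × Fin k, val m1 sn (finProdFinEquiv q : Fin _) =
      (Hyps.trans H (Hyps.tIdx H h)).next q.2 (Hyps.strat H (Hyps.gIdx H h) q) := by
    intro q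
    rw [v1 _ (Fin.is_lt _), hS.rem_eq, hS.strat, hS.next]
  obtain ⟨m2, e2, v2, f2⟩ := exec_assign (B := B) (A := su) (t := t) (n := n2 * nK)
    (body := get num (6 + n1 * nA + (get quo (fst t) * nB + get hyp (fst t)))) (m := m1)
    (n₂ * k) (fun j => val m1 num (6 + n₁ * a + (val m1 quo j * b + val m1 hyp j)))
    (by simp [S1.n₂_eq, S1.k_eq]) (by simp [S1.n₁_eq, S1.a_eq, S1.b_eq]) (by omega) (by
      intro j hj
      obtain ⟨q, rfl⟩ := exists_prod_index hj
      rw [S1.quo_eq, S1.strat, S1.E₂_eq]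
      omega)
  have S2 := S1.frame f2
  have w2 : ∀ q : Fin n₂ × Fin k, val m2 su (finProdFinEquiv q : Fin _) =
      G.E₂ q.1 (Hyps.strat H (Hyps.gIdx H h) q) := by
    intro q
    rw [v2 _ (Fin.is_lt _), S1.quo_eq, S1.strat, S1.E₂_eq]
  obtain ⟨m3, e3, v3, f3⟩ := exec_assign (B := B) (A := sv) (t := t) (n := n2 * nK)
    (body := get num (6 + (get su (fst t) * nA + get hyp (labelPos + get sn (fst t))))) (m := m2)
    (n₂ * k) (fun j => val m2 num (6 + (val m2 su j * a +
      val m2 hyp (n₂ * k + 1 + k * b + val m2 sn j))))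
    (by simp [S2.n₂_eq, S2.k_eq]) (by simp [S2.n₂_eq, S2.k_eq, S2.a_eq, S2.b_eq]) (by omega) (by
      intro j hj
      obtain ⟨q, rfl⟩ := exists_prod_index hj
      rw [w2, f2 sn (by decide), w1, S2.label, S2.E₁_eq]
      omega)
  have S3 := S2.frame f3
  have w3 : ∀ q : Fin n₂ × Fin k, val m3 sv (finProdFinEquiv q : Fin _) =
      (prodMove ha hb G h q).1 := by
    intro q
    rw [v3 _ (Fin.is_lt _), w2, f2 sn (by decide), w1, S2.label, S2.E₁_eq]
    rfl
  have w4 : ∀ q : Fin n₂ × Fin k, val m3 sn (finProdFinEquiv q : Fin _) +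
      k * val m3 sv (finProdFinEquiv q : Fin _) =
      (finProdFinEquiv (prodMove ha hb G h q) : Fin _) := by
    intro q
    rw [w3, f3 sn (by decide), f2 sn (by decide), w1]
    rfl
  obtain ⟨m4, e4, v4, f4⟩ := exec_assign (B := B) (A := nx) (t := t) (n := n2 * nK)
    (body := get sn (fst t) + nK * get sv (fst t)) (m := m3)
    (n₂ * k) (fun j => val m3 sn j + k * val m3 sv j)
    (by simp [S3.n₂_eq, S3.k_eq]) (by simp [S3.k_eq]) (by omega) (by
      intro j hj
      obtain ⟨q, rfl⟩ := exists_prod_index hj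
      rw [w4]
      have := (finProdFinEquiv (prodMove ha hb G h q)).2
      omega)
  refine ⟨m4, .seq e1 (.seq e2 (.seq e3 e4)), S3.frame f4, ?_, fun q => ⟨?_, ?_, ?_⟩⟩
  · rw [f4 _ (by decide), f3 _ (by decide), f2 _ (by decide), f1 _ (by decide)]
  · rw [f4 _ (by decide), f3 _ (by decide), w2]
  · rw [f4 _ (by decide), w3]
  · rw [v4 _ (Fin.is_lt _), w4]

/-- The colour of the move in the product from a state. -/
def moveColour (ha : 0 < a) (hb : 0 < b) (G : Game (Fin n₁) (Fin n₂) (Fin a) (Fin b)) (h : ℕ)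
    (q : Fin n₂ × Fin k) : ℕ :=
  let H' := digitHyps n₂ a b k ha hb (Nat.pos_of_neZero k)
  G.prodCol (H'.trans (H'.tIdx h)) q (H'.strat (H'.gIdx h) q)

theorem moveColour_eq (q : Fin n₂ × Fin k) : moveColour ha hb G h q =
    max (G.color (.inl (G.E₂ q.1 (Hyps.strat H (Hyps.gIdx H h) q))))
      (G.color (.inr (prodMove ha hb G h q).1)) := rfl

theorem exec_moveCols {B : ℕ} (hB : Bound n₁ n₂ a b k B) (hS : Search ha hb G st x h m)
    (hm : ∀ q : Fin n₂ × Fin k,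
        val m su (finProdFinEquiv q : Fin _) =
          G.E₂ q.1 (Hyps.strat H (Hyps.gIdx H h) q) ∧
        val m sv (finProdFinEquiv q : Fin _) = (prodMove ha hb G h q).1) :
    ∃ m', Exec B moveCols m m' ∧ Search ha hb G st x h m' ∧ val m' cur 0 = val m cur 0 ∧
      (∀ j, val m' nx j = val m nx j) ∧
      ∀ q : Fin n₂ × Fin k,
        val m' eo (finProdFinEquiv q : Fin _) = G.rankOf (moveColour ha hb G h q) ∧
        val m' ep (finProdFinEquiv q : Fin _) = moveColour ha hb G h q % 2 := by
  unfold Bound at hB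
  have w1 : ∀ q : Fin n₂ × Fin k,
      (if val m ord (n₁ + val m sv (finProdFinEquiv q : Fin _)) ≤
          val m ord (val m su (finProdFinEquiv q : Fin _))
        then val m ord (val m su (finProdFinEquiv q : Fin _))
        else val m ord (n₁ + val m sv (finProdFinEquiv q : Fin _))) =
      G.rankOf (moveColour ha hb G h q) := by
    intro q
    rw [(hm q).1, (hm q).2, hS.ord₁, hS.ord₂, moveColour_eq]
    split_ifs with hle
    · rw [max_eq_left ((G.rankOf_le_iff _ _).1 hle)]
    · rw [max_eq_right]
      by_contra hlt
      exact hle ((G.rankOf_le_iff _ _).2 (by omega))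
  have w2 : ∀ q : Fin n₂ × Fin k,
      (if val m ord (n₁ + val m sv (finProdFinEquiv q : Fin _)) ≤
          val m ord (val m su (finProdFinEquiv q : Fin _))
        then val m par (val m su (finProdFinEquiv q : Fin _))
        else val m par (n₁ + val m sv (finProdFinEquiv q : Fin _))) =
      moveColour ha hb G h q % 2 := by
    intro q
    rw [(hm q).1, (hm q).2, hS.ord₁, hS.ord₂, hS.par₁, hS.par₂, moveColour_eq]
    split_ifs with hle
    · rw [max_eq_left ((G.rankOf_le_iff _ _).1 hle)]
    · rw [max_eq_right]
      by_contra hlt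
      exact hle ((G.rankOf_le_iff _ _).2 (by omega))
  obtain ⟨m1, e1, v1, f1⟩ := exec_assign (B := B) (A := eo) (t := t) (n := n2 * nK)
    (body := ite (le (get ord (n1 + get sv (fst t))) (get ord (get su (fst t))))
      (get ord (get su (fst t))) (get ord (n1 + get sv (fst t)))) (m := m)
    (n₂ * k) (fun j => if val m ord (n₁ + val m sv j) ≤ val m ord (val m su j)
      then val m ord (val m su j) else val m ord (n₁ + val m sv j))
    (by simp [hS.n₂_eq, hS.k_eq]) (by simp [hS.n₁_eq]) (by omega) (by
      intro j hj
      obtain ⟨q, rfl⟩ := exists_prod_index hj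
      have := G.rankOf_le (moveColour ha hb G h q)
      simp only [Fintype.card_fin] at this
      rw [w1]
      omega)
  have S1 := hS.frame f1
  obtain ⟨m2, e2, v2, f2⟩ := exec_assign (B := B) (A := ep) (t := t) (n := n2 * nK)
    (body := ite (le (get ord (n1 + get sv (fst t))) (get ord (get su (fst t))))
      (get par (get su (fst t))) (get par (n1 + get sv (fst t)))) (m := m1)
    (n₂ * k) (fun j => if val m ord (n₁ + val m sv j) ≤ val m ord (val m su j)
      then val m par (val m su j) else val m par (n₁ + val m sv j))
    (by simp [S1.n₂_eq, S1.k_eq]) (by simp [S1.n₁_eq, f1]) (by omega) (by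
      intro j hj
      obtain ⟨q, rfl⟩ := exists_prod_index hj
      rw [w2]
      omega)
  refine ⟨m2, .seq e1 e2, S1.frame f2, ?_, fun j => ?_, fun q => ⟨?_, ?_⟩⟩
  · rw [f2 _ (by decide), f1 _ (by decide)]
  · rw [f2 _ (by decide), f1 _ (by decide)]
  · rw [f2 _ (by decide), v1 _ (Fin.is_lt _), w1]
  · rw [v2 _ (Fin.is_lt _), w2]

end GameProg

/-! ### The search for a hypothesis -/

namespace GameProg

open StackProg Expr Cmd Var Radix

variable {n₁ n₂ a b k : ℕ} {G : Game (Fin n₁) (Fin n₂) (Fin a) (Fin b)} {m m' : Var → List ℕ}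
  [NeZero k] {ha : 0 < a} {hb : 0 < b} {st : MemState (Fin n₁) k} {x : Fin a} {h : ℕ}

local notation "H" => digitHyps n₂ a b k ha hb (Nat.pos_of_neZero k)

theorem exists_color_eq_moveColour (q : Fin n₂ × Fin k) :
    ∃ z, G.color z = moveColour ha hb G h q := by
  rw [moveColour_eq]
  rcases max_choice (G.color (.inl (G.E₂ q.1 (Hyps.strat H (Hyps.gIdx H h) q))))
    (G.color (.inr (prodMove ha hb G h q).1)) with hz | hz
  · exact ⟨_, hz.symm⟩
  · exact ⟨_, hz.symm⟩

theorem rankOf_moveColour_le_iff (q q' : Fin n₂ × Fin k) :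
    G.rankOf (moveColour ha hb G h q) ≤ G.rankOf (moveColour ha hb G h q') ↔
      moveColour ha hb G h q ≤ moveColour ha hb G h q' := by
  obtain ⟨z, hz⟩ := exists_color_eq_moveColour (G := G) (ha := ha) (hb := hb) (h := h) q
  obtain ⟨z', hz'⟩ := exists_color_eq_moveColour (G := G) (ha := ha) (hb := hb) (h := h) q'
  rw [← hz, ← hz', G.rankOf_le_iff]

theorem goodAt_iff (o : Objective) (hG : G.HasKind o) (q : Fin n₂ × Fin k) :
    G.GoodAt o (Hyps.trans H (Hyps.tIdx H h)) (Hyps.strat H (Hyps.gIdx H h)) q ↔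
      ∃ i < n₂ * k, Even (moveColour ha hb G h
          ((prodMove ha hb G h)^[o.base (n₂ * k) + i] q)) ∧
        ∀ j < n₂ * k, moveColour ha hb G h ((prodMove ha hb G h)^[o.base (n₂ * k) + j] q) ≤
          moveColour ha hb G h ((prodMove ha hb G h)^[o.base (n₂ * k) + i] q) := by
  refine Objective.wins_orbit_iff o (prodMove ha hb G h) (by simp) (moveColour ha hb G h) q ?_
  rintro rfl q
  obtain ⟨z, hz⟩ := exists_color_eq_moveColour (G := G) (ha := ha) (hb := hb) (h := h) q
  rw [← hz]
  exact hG z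

theorem holds_wins (base : Expr Var) {β : ℕ} (hS : Search ha hb G st x h m)
    (hbase : ∀ m', (∀ i, val m' num i = val m num i) → base.eval m' = β) :
    (wins base).Holds m ↔ ∃ i < n₂ * k, val m ep (val m orb (β + i)) = 0 ∧
      ∀ j < n₂ * k, val m eo (val m orb (β + j)) ≤ val m eo (val m orb (β + i)) := by
  rw [wins, holds_not, holds_all (fun i => ¬ (val m ep (val m orb (β + i)) = 0 ∧
      ∀ j < n₂ * k, val m eo (val m orb (β + j)) ≤ val m eo (val m orb (β + i))))
      (by decide) (by decide) (by rw [hS.cap_eq]; omega)]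
  · simp [hS.n₂_eq, hS.k_eq]
  · intro i hi r
    rw [holds_not, holds_and, holds_all (fun j => val m eo (val m orb (β + j)) ≤
      val m eo (val m orb (β + i))) (by decide) (by decide) (by simp [hS.cap_eq])]
    · simp [hS.n₂_eq, hS.k_eq, hbase]
    · intro j hj r'
      simp [hbase]

theorem elim_succ_le_iff (c : Option (Fin k)) :
    c.elim k ((↑) : Fin k → ℕ) + 1 ≤ k ↔ ∃ s, c = some s := by
  cases c with
  | none => simp
  | some s => simp

theorem exec_check {B : ℕ} (o : Objective) (hG : G.HasKind o) (hB : Bound n₁ n₂ a b k B)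
    (hS : Search ha hb G st x h m) [Decidable (Hyps.OkAt H G o st x h)] :
    ∃ m', Exec B (check o) m m' ∧ Search ha hb G st x h m' ∧
      val m' cur 0 = curState n₂ ha hb st x h ∧
      val m' good 0 = if Hyps.OkAt H G o st x h then 1 else 0 := by
  have hB' := hB
  unfold Bound at hB'
  have hk : 0 < k := Nat.pos_of_neZero k
  have hcand : ∀ {m}, Search ha hb G st x h m → val m cand (val m hyp (n₂ * k)) =
      (Hyps.candAt H st x h (Hyps.jIdx H h)).elim k ((↑) : Fin k → ℕ) := fun hS => by
    rw [hS.jIdx, hS.cand_eq]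
  obtain ⟨m1, e1, v1, f1⟩ := exec_set (B := B) (v := cur) (t := t)
    (e := ite (le (get cand (get hyp (n2 * nK)) + 1) nK) (get cand (get hyp (n2 * nK))) 0) (m := m)
    (curState n₂ ha hb st x h) (by
      simp only [eval_ite, holds_le, eval_hAdd, eval_get, eval_hMul, eval_ofNat, ne_eq,
        reduceCtorEq, not_false_eq_true, val_pushVar_of_ne, hS.n₂_eq, hS.k_eq, hcand hS, elim_succ_le_iff]
      unfold curState
      cases Hyps.candAt H st x h (Hyps.jIdx H h) <;> simp) (by
      have := (curState n₂ ha hb st x h).2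
      omega) (by omega)
  obtain ⟨m2, e2, S2, c2, w2⟩ := exec_moves hB (hS.frame f1)
  obtain ⟨m3, e3, S3, c3, n3, w3⟩ := exec_moveCols hB S2 fun q => ⟨(w2 q).1, (w2 q).2.1⟩
  have hcur : val m3 cur 0 = curState n₂ ha hb st x h := by rw [c3, c2, v1]
  set q : Fin n₂ × Fin k := (G.E₁ st.vtx x, curState n₂ ha hb st x h)
  obtain ⟨m4, e4, v4, f4⟩ := exec_assign (B := B) (A := orb) (t := t) (n := n2 * nK + n2 * nK)
    (body := loop cap acc cyc (fst t) (fst cur + nK * fst pos) (get nx (fst acc))) (m := m3)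
    (n₂ * k + n₂ * k) (fun j => (finProdFinEquiv ((prodMove ha hb G h)^[j] q) : Fin _))
    (by simp [S3.n₂_eq, S3.k_eq]) (by
      intro j hj
      rw [eval_loop (fun j => (finProdFinEquiv ((prodMove ha hb G h)^[j] q) : Fin _))
        (by decide) (by decide)]
      · simp
      · simp [hcur, S3.k_eq, S3.pos_eq, q]
      · intro i hi
        rw [Function.iterate_succ_apply', ← (w2 _).2.2, ← n3]
        simp
      · intro i hi
        have := (finProdFinEquiv ((prodMove ha hb G h)^[i + 1] q)).2
        simp only [ne_eq, reduceCtorEq, not_false_eq_true, val_pushVar_of_ne, S3.cap_eq]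
        omega) (by omega) (by
      intro j hj
      have := (finProdFinEquiv ((prodMove ha hb G h)^[j] q)).2
      omega)
  -- the condition is evaluated with an index in front of the array `t`
  have f5 : ∀ v ≠ t, ∀ i, val (pushVar m4 t 0) v i = val m4 v i := fun v hv i =>
    val_pushVar_of_ne m4 hv 0 i
  have S4 := S3.frame f4
  have S5 := S4.frame f5
  have hwins : (wins (baseExpr o)).Holds (pushVar m4 t 0) ↔
      G.GoodAt o (Hyps.trans H (Hyps.tIdx H h)) (Hyps.strat H (Hyps.gIdx H h)) q := by
    have hbase : o.base (n₂ * k) ≤ n₂ * k := by cases o <;> simp [Objective.base]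
    rw [holds_wins (β := o.base (n₂ * k)) _ S5, goodAt_iff o hG]
    · have h1 : ∀ i < n₂ * k, val (pushVar m4 t 0) ep
          (val (pushVar m4 t 0) orb (o.base (n₂ * k) + i)) = 0 ↔
          Even (moveColour ha hb G h ((prodMove ha hb G h)^[o.base (n₂ * k) + i] q)) := by
        intro i hi
        rw [f5 _ (by decide), f5 _ (by decide), f4 _ (by decide), v4 _ (by omega), (w3 _).2,
          Nat.even_iff]
      have h2 : ∀ i < n₂ * k, val (pushVar m4 t 0) eo
          (val (pushVar m4 t 0) orb (o.base (n₂ * k) + i)) =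
          G.rankOf (moveColour ha hb G h ((prodMove ha hb G h)^[o.base (n₂ * k) + i] q)) := by
        intro i hi
        rw [f5 _ (by decide), f5 _ (by decide), f4 _ (by decide), v4 _ (by omega), (w3 _).1]
      refine exists_congr fun i => and_congr_right fun hi => and_congr (h1 i hi) ?_
      refine forall_congr' fun j => imp_congr_right fun hj => ?_
      rw [h2 i hi, h2 j hj, rankOf_moveColour_le_iff]
    · intro m' hm'
      cases o <;> simp [baseExpr, Objective.base, hm', S5.n₂_eq, S5.k_eq]
  have hok : (∃ s, Hyps.candAt H st x h (Hyps.jIdx H h) = some s) ∧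
      (wins (baseExpr o)).Holds (pushVar m4 t 0) ↔ Hyps.OkAt H G o st x h := by
    rw [hwins]
    constructor
    · rintro ⟨⟨s, hs⟩, hg⟩
      refine ⟨s, hs, ?_⟩
      have : q = (G.E₁ st.vtx x, s) := by simp [q, curState, hs]
      rwa [this] at hg
    · rintro ⟨s, hs, hg⟩
      refine ⟨⟨s, hs⟩, ?_⟩
      have : q = (G.E₁ st.vtx x, s) := by simp [q, curState, hs]
      rwa [this]
  obtain ⟨m5, e5, v5, g5⟩ := exec_set (B := B) (v := good) (t := t)
    (e := ite (and (le (get cand (get hyp (n2 * nK)) + 1) nK) (wins (baseExpr o))) 1 0) (m := m4)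
    (if Hyps.OkAt H G o st x h then 1 else 0) (by
      simp only [eval_ite, holds_and, ← hok, holds_le, eval_hAdd, eval_get, eval_hMul, eval_ofNat,
        S5.n₂_eq, S5.k_eq, hcand S5, elim_succ_le_iff]) (by split_ifs <;> omega) (by omega)
  refine ⟨m5, .seq e1 (.seq e2 (.seq e3 (.seq e4 e5))), S4.frame g5, ?_, v5⟩
  rw [g5 _ (by decide), f4 _ (by decide), hcur]

omit [NeZero k] in
theorem eval_radix {e : Expr Var} (hE : NumEnv G k m) :
    (radix e).eval m = hypRad n₂ a b k (e.eval m) := by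
  simp [radix, hypRad, hE.n₂_eq, hE.k_eq, hE.a_eq, hE.b_eq]

omit [NeZero k] in
theorem hypRad_le {B : ℕ} (hB : Bound n₁ n₂ a b k B) (i : ℕ) : hypRad n₂ a b k i ≤ B := by
  unfold Bound at hB
  unfold hypRad
  split_ifs <;> omega

omit [NeZero k] in
theorem holds_carries {n : Expr Var} {N : ℕ} (hE : Env G k m)
    (hh : ∀ i < n₂ * k + 1 + k * b + k, val m hyp i = digit (hypRad n₂ a b k) h i)
    (hn : n.eval m = N) (hN : N ≤ n₂ * k + 1 + k * b + k) :
    (carries n).Holds m ↔ Carry (hypRad n₂ a b k) h N := by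
  rw [carries, holds_all (fun i => val m hyp i + 1 = hypRad n₂ a b k i) (by decide) (by decide)
    (by rw [hE.cap_eq]; omega), hn]
  · exact forall_congr' fun i => imp_congr_right fun hi => by rw [hh i (by omega)]
  · intro i hi r
    have hE' : NumEnv G k (pushVar (pushVar m cyc i) acc r) :=
      hE.toNumEnv.congr fun j => by simp
    rw [holds_eq, eval_radix hE']
    simp

theorem exec_advance {B : ℕ} (hB : Bound n₁ n₂ a b k B) (hS : Search ha hb G st x h m)
    (hle : st.hyp ≤ h) (hlt : h < Hyps.total H) :
    ∃ m', Exec B advance m m' ∧ Search ha hb G st x (h + 1) m' := by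
  classical
  have hB' := hB
  unfold Bound at hB'
  have hpush : ∀ {m : Var → List ℕ} (j : ℕ), ∀ v ≠ t, ∀ i, val (pushVar m t j) v i = val m v i :=
    fun j v hv i => val_pushVar_of_ne _ hv j i
  have hdig : ∀ n i, digit (hypRad n₂ a b k) n i ≤ B := fun n i =>
    (digit_lt (hypRad_pos ha hb) n i).le.trans (hypRad_le hB i)
  obtain ⟨m1, e1, v1, f1⟩ := exec_set (B := B) (v := chg) (t := t)
    (e := ite (carries (n2 * nK + 1)) 1 0) (m := m)
    (if Carry (hypRad n₂ a b k) h (n₂ * k + 1) then 1 else 0) (by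
      have hS' := hS.frame (hpush 0)
      have hc := holds_carries (n := n2 * nK + 1) (N := n₂ * k + 1) hS'.toEnv hS'.hyp_eq
        (by simp [hS.n₂_eq, hS.k_eq]) (by omega)
      simp only [eval_ite, hc, eval_ofNat]) (by split_ifs <;> omega) (by omega)
  have S1 := hS.frame f1
  obtain ⟨m2, e2, v2, f2⟩ := exec_set (B := B) (v := exh) (t := t)
    (e := ite (carries (labelPos + nK)) 1 0) (m := m1)
    (if Hyps.total H ≤ h + 1 then 1 else 0) (by
      have hS' := S1.frame (hpush 0)
      have hc := holds_carries (n := labelPos + nK) (N := n₂ * k + 1 + k * b + k) hS'.toEnv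
        hS'.hyp_eq (by simp [S1.n₂_eq, S1.k_eq, S1.b_eq]) le_rfl
      simp only [eval_ite, hc, digitHyps_total_le_succ ha hb hlt, eval_ofNat])
    (by split_ifs <;> omega) (by omega)
  have E2 : Env G k m2 := S1.toEnv.frame f2
  have h2 : ∀ i < n₂ * k + 1 + k * b + k, val m2 hyp i = digit (hypRad n₂ a b k) h i :=
    fun i hi => by rw [f2 _ (by decide), S1.hyp_eq i hi]
  obtain ⟨m3, e3, v3, f3⟩ := exec_assign (B := B) (A := hyp) (t := t) (n := labelPos + nK)
    (body := ite (carries (fst t)) (ite (eq (get hyp (fst t) + 1) (radix (fst t))) 0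
      (get hyp (fst t) + 1)) (get hyp (fst t))) (m := m2)
    (n₂ * k + 1 + k * b + k) (fun j => digit (hypRad n₂ a b k) (h + 1) j)
    (by simp [E2.n₂_eq, E2.k_eq, E2.b_eq]) (by
      intro j hj
      have E2' : Env G k (pushVar m2 t j) := E2.frame (hpush j)
      rw [digit_succ (hypRad_pos ha hb)]
      simp only [eval_ite, holds_carries (h := h) (n := fst t) (N := j) E2'
        (fun i hi => (hpush j _ (by decide) i).trans (h2 i hi)) (by simp) hj.le, holds_eq,
        eval_radix E2'.toNumEnv, eval_hAdd, eval_get, eval_ofNat, ne_eq, reduceCtorEq,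
        not_false_eq_true, val_pushVar_of_ne, val_pushVar_self, h2 j hj]) (by omega)
    (fun j _ => hdig _ j)
  have E3 : Env G k m3 := E2.frame f3
  have hlab : ∀ s : Fin k, val m3 hyp (n₂ * k + 1 + k * b + s) =
      ((Hyps.trans H (Hyps.tIdx H (h + 1))).label s : ℕ) := by
    intro s
    rw [← digitHyps_label, v3]
    omega
  have hinp : val m3 inp 0 = x := by
    rw [f3 _ (by decide), f2 _ (by decide), S1.inp_eq]
  have hchg : val m3 chg 0 = if Carry (hypRad n₂ a b k) h (n₂ * k + 1) then 1 else 0 := by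
    rw [f3 _ (by decide), f2 _ (by decide), v1]
  have hcand : ∀ i : Fin k, (if val m3 chg 0 ≠ 0 then
      (if val m3 hyp (n₂ * k + 1 + k * b + i) = val m3 inp 0 then (i : ℕ) else k)
      else val m3 cand i) =
      (Hyps.candAt H st x (h + 1) i).elim k ((↑) : Fin k → ℕ) := by
    intro i
    have ht := digitHyps_tIdx_succ (n₂ := n₂) (k := k) ha hb h
    rw [hchg]
    by_cases hc : Carry (hypRad n₂ a b k) h (n₂ * k + 1)
    · have hne : Hyps.tIdx H (h + 1) ≠ Hyps.tIdx H st.hyp := by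
        have := Hyps.tIdx_mono H hle
        rw [ht, if_pos hc]
        omega
      rw [if_pos (by simp [hc]), hlab, hinp, Hyps.candAt, if_neg hne, Option.filter_some]
      simp only [Fin.val_inj]
      by_cases hl : (Hyps.trans H (Hyps.tIdx H (h + 1))).label i = x <;> simp [hl]
    · rw [if_neg (by simp [hc]), f3 _ (by decide), f2 _ (by decide), S1.cand_eq,
        Hyps.candAt_congr H st x (h := h + 1) (h' := h) (by rw [ht, if_neg hc, add_zero])]
  obtain ⟨m4, e4, v4, f4⟩ := exec_assign (B := B) (A := cand) (t := t) (n := nK)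
    (body := ite (fst chg) (ite (eq (get hyp (labelPos + fst t)) (fst inp)) (fst t) nK)
      (get cand (fst t))) (m := m3) k
    (fun i => if val m3 chg 0 ≠ 0 then
      (if val m3 hyp (n₂ * k + 1 + k * b + i) = val m3 inp 0 then i else k) else val m3 cand i)
    (by simp [E3.k_eq]) (by simp [E3.k_eq, E3.n₂_eq, E3.b_eq, holds_get]) (by omega) (by
      intro j hj
      have h1 := hcand ⟨j, hj⟩
      dsimp only at h1
      rw [h1]
      cases Hyps.candAt H st x (h + 1) ⟨j, hj⟩ with
      | none => simp only [Option.elim]; omega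
      | some s => have := s.2; simp only [Option.elim]; omega)
  refine ⟨m4, .seq e1 (.seq e2 (.seq e3 e4)), { E3.frame f4 with
    inp_eq := ?_, old_eq := ?_, pos_eq := ?_, hyp_eq := ?_, cand_eq := ?_, exh_eq := ?_ }⟩
  · rw [f4 _ (by decide), hinp]
  · rw [f4 _ (by decide), f3 _ (by decide), f2 _ (by decide), S1.old_eq]
  · rw [f4 _ (by decide), f3 _ (by decide), f2 _ (by decide), S1.pos_eq]
  · exact fun i hi => by rw [f4 _ (by decide), v3 i hi]
  · exact fun i => by rw [v4 _ i.2, hcand]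
  · rw [f4 _ (by decide), f3 _ (by decide), v2]

/-- The search finds the least hypothesis that can be adopted. -/
theorem exec_search {B : ℕ} (o : Objective) (hG : G.HasKind o) (hB : Bound n₁ n₂ a b k B)
    [∀ h, Decidable (Hyps.OkAt H G o st x h)] (d : ℕ) : ∀ (h : ℕ) (m : Var → List ℕ),
    st.hyp ≤ h → h + d = Hyps.nextHyp H G o st x → Search ha hb G st x h m →
    val m cur 0 = curState n₂ ha hb st x h →
    (val m good 0 = if Hyps.OkAt H G o st x h then 1 else 0) →
    ∃ m', Exec B (.loop (and (not (fst good)) (not (fst exh))) (.seq advance (check o))) m m' ∧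
      Search ha hb G st x (Hyps.nextHyp H G o st x) m' ∧
      val m' cur 0 = curState n₂ ha hb st x (Hyps.nextHyp H G o st x) := by
  induction d with
  | zero =>
    intro h m hle hd hS hc hg
    obtain rfl : h = Hyps.nextHyp H G o st x := hd
    refine ⟨m, .loop_done (not_not.1 fun hne => ?_), hS, hc⟩
    have h1 : (and (not (fst good)) (not (fst exh)) : Expr Var).Holds m := hne
    simp only [holds_and, holds_not, holds_get, eval_ofNat, hg, hS.exh_eq] at h1
    rcases Hyps.nextHyp_spec H G o st x with h2 | h2
    · simp [h2] at h1
    · simp [h2] at h1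
  | succ d ih =>
    intro h m hle hd hS hc hg
    have h1 := Hyps.not_okAt_of_lt H G o st x hle (by omega)
    obtain ⟨m1, e1, S1⟩ := exec_advance hB hS hle h1.1
    obtain ⟨m2, e2, S2, c2, g2⟩ := exec_check o hG hB S1
    obtain ⟨m3, e3, S3, c3⟩ := ih (h + 1) m2 (by omega) (by omega) S2 c2 g2
    refine ⟨m3, .loop_cont ?_ (.seq e1 e2) e3, S3, c3⟩
    change Holds _ m
    simp [holds_get, hg, hS.exh_eq, h1.2, h1.1]

end GameProg

/-! ### A round of the play -/

namespace GameProg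

open StackProg Expr Cmd Var Radix

variable {n₁ n₂ a b k : ℕ} {G : Game (Fin n₁) (Fin n₂) (Fin a) (Fin b)} {m m' : Var → List ℕ}
  [NeZero k] (ha : 0 < a) (hb : 0 < b) {st : MemState (Fin n₁) k} {x : Fin a} {h : ℕ}

local notation "H" => digitHyps n₂ a b k ha hb (Nat.pos_of_neZero k)

/-- The memory between two rounds of the play represents the memory of the strategy. -/
structure Rep (G : Game (Fin n₁) (Fin n₂) (Fin a) (Fin b)) (st : MemState (Fin n₁) k)
    (m : Var → List ℕ) : Prop extends Env G k m where
  vtx_eq : val m vtx 0 = st.vtx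
  hyp_eq : ∀ i < n₂ * k + 1 + k * b + k, val m hyp i = digit (hypRad n₂ a b k) st.hyp i
  cand_eq : ∀ i : Fin k, val m cand i = (st.cand i).elim k ((↑) : Fin k → ℕ)
  exh_eq : val m exh 0 = if Hyps.total H ≤ st.hyp then 1 else 0

variable {ha hb}

theorem Rep.frame (hR : Rep ha hb G st m) {A : Var}
    (hf : ∀ v ≠ A, ∀ i, val m' v i = val m v i)
    (hA : ∀ v ∈ [num, ord, par, cap, quo, rem, mode, vtx, hyp, cand, exh], v ≠ A := by decide) :
    Rep ha hb G st m' := by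
  have hf' : ∀ v ∈ [num, ord, par, cap, quo, rem, mode, vtx, hyp, cand, exh], ∀ i,
      val m' v i = val m v i := fun v hv => hf v (hA v hv)
  simp only [List.forall_mem_cons, List.not_mem_nil, false_imp_iff, implies_true, and_true] at hf'
  obtain ⟨h1, h2, h3, h4, h5, h6, h7, h8, h9, h10, h11⟩ := hf'
  exact { hR.toEnv.frame hf fun v hv => hA v (by
            simp only [List.mem_cons, List.not_mem_nil, or_false] at hv ⊢; tauto) with
    vtx_eq := by rw [h8, hR.vtx_eq]
    hyp_eq := by simpa only [h9] using hR.hyp_eq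
    cand_eq := by simp only [h10, hR.cand_eq, implies_true]
    exh_eq := by rw [h11, hR.exh_eq] }

/-- The search starts with the hypothesis of the last round and the candidates that agree with the
action of player 1. -/
theorem exec_startSearch {B : ℕ} (hB : Bound n₁ n₂ a b k B) (hR : Rep ha hb G st m)
    (hx : val m inp 0 = x) (ho : val m old 0 = 3) :
    ∃ m', Exec B (.seq (put pos (get num (6 + (fst vtx * nA + fst inp))))
      (tab cand nK (ite (and (le (get cand (fst t) + 1) nK)
        (eq (get hyp (labelPos + get cand (fst t))) (fst inp))) (get cand (fst t)) nK))) m m' ∧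
      Search ha hb G st x st.hyp m' := by
  unfold Bound at hB
  obtain ⟨m1, e1, v1, f1⟩ := exec_set (B := B) (v := pos) (t := t)
    (e := get num (6 + (fst vtx * nA + fst inp))) (m := m) (G.E₁ st.vtx x)
    (by simp [hR.vtx_eq, hR.a_eq, hx, hR.E₁_eq]) (by omega) (by omega)
  have R1 := hR.frame f1
  have hx1 : val m1 inp 0 = x := by rw [f1 _ (by decide), hx]
  have hcand : ∀ i : Fin k, (if val m1 cand i + 1 ≤ k ∧
      val m1 hyp (n₂ * k + 1 + k * b + val m1 cand i) = val m1 inp 0 then val m1 cand i else k) =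
      (Hyps.candAt H st x st.hyp i).elim k ((↑) : Fin k → ℕ) := by
    intro i
    rw [R1.cand_eq, Hyps.candAt, if_pos rfl]
    cases st.cand i with
    | none => simp
    | some s =>
      have hlab : val m1 hyp (n₂ * k + 1 + k * b + s) =
          ((Hyps.trans H (Hyps.tIdx H st.hyp)).label s : ℕ) := by
        rw [← digitHyps_label, R1.hyp_eq]
        omega
      rw [Option.filter_some]
      simp only [Option.elim, hlab, hx1, Fin.val_inj]
      by_cases hl : (Hyps.trans H (Hyps.tIdx H st.hyp)).label s = x <;> simp [hl]
  obtain ⟨m2, e2, v2, f2⟩ := exec_assign (B := B) (A := cand) (t := t) (n := nK)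
    (body := ite (and (le (get cand (fst t) + 1) nK)
      (eq (get hyp (labelPos + get cand (fst t))) (fst inp))) (get cand (fst t)) nK) (m := m1) k
    (fun i => if val m1 cand i + 1 ≤ k ∧
      val m1 hyp (n₂ * k + 1 + k * b + val m1 cand i) = val m1 inp 0 then val m1 cand i else k)
    (by simp [R1.k_eq]) (by simp [R1.k_eq, R1.n₂_eq, R1.b_eq]) (by omega) (by
      intro j hj
      have h1 := hcand ⟨j, hj⟩
      dsimp only at h1
      rw [h1]
      cases Hyps.candAt H st x st.hyp ⟨j, hj⟩ with
      | none => simp only [Option.elim]; omega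
      | some s => have := s.2; simp only [Option.elim]; omega)
  refine ⟨m2, .seq e1 e2, { R1.toEnv.frame f2 with
    inp_eq := ?_, old_eq := ?_, pos_eq := ?_, hyp_eq := ?_, cand_eq := ?_, exh_eq := ?_ }⟩
  · rw [f2 _ (by decide), hx1]
  · rw [f2 _ (by decide), f1 _ (by decide), ho]
  · rw [f2 _ (by decide), v1]
  · exact fun i hi => by rw [f2 _ (by decide), R1.hyp_eq i hi]
  · exact fun i => by rw [v2 _ i.2, hcand]
  · rw [f2 _ (by decide), R1.exh_eq]

/-- After the search, the answer is given and the memory of the strategy is updated. -/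
theorem exec_answer {B : ℕ} (o : Objective) (hB : Bound n₁ n₂ a b k B)
    (hS : Search ha hb G st x (Hyps.nextHyp H G o st x) m)
    (hc : val m cur 0 = curState n₂ ha hb st x (Hyps.nextHyp H G o st x)) :
    ∃ m', Exec B (.seq (put ans (ite (fst exh) 0 (get hyp (fst cur + nK * fst pos))))
      (.seq (tab cand nK (ite (le (get cand (fst t) + 1) nK)
        (get hyp (n2 * nK + 1 + (fst ans + nB * get cand (fst t)))) nK))
      (put vtx (get num (6 + n1 * nA + (fst pos * nB + fst ans)))))) m m' ∧
      Rep ha hb G (Hyps.nextState H G o ⟨0, hb⟩ st x) m' ∧ val m' old 0 = 3 ∧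
      val m' ans 0 = Hyps.answer H G o ⟨0, hb⟩ st x := by
  unfold Bound at hB
  set hn := Hyps.nextHyp H G o st x
  set y : Fin b := Hyps.answer H G o ⟨0, hb⟩ st x
  obtain ⟨m1, e1, v1, f1⟩ := exec_set (B := B) (v := ans) (t := t)
    (e := ite (fst exh) 0 (get hyp (fst cur + nK * fst pos))) (m := m) y (by
      have h1 := hS.strat (G.E₁ st.vtx x, curState n₂ ha hb st x hn)
      rw [finProdFinEquiv_apply_val] at h1
      by_cases ht : Hyps.total H ≤ hn
      · have hy : y = ⟨0, hb⟩ := if_pos ht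
        simp [holds_get, hS.exh_eq, ht, hy]
      · have hy : y = Hyps.strat H (Hyps.gIdx H hn)
          (G.E₁ st.vtx x, curState n₂ ha hb st x hn) := if_neg ht
        simp [holds_get, hS.exh_eq, ht, hS.k_eq, hc, hS.pos_eq, h1, hy]) (by omega) (by omega)
  have S1 := hS.frame f1
  have hcand : ∀ i : Fin k, (if val m1 cand i + 1 ≤ k then
      val m1 hyp (n₂ * k + 1 + (val m1 ans 0 + b * val m1 cand i)) else k) =
      ((Hyps.nextState H G o ⟨0, hb⟩ st x).cand i).elim k ((↑) : Fin k → ℕ) := by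
    intro i
    rw [S1.cand_eq, v1, Hyps.nextState]
    dsimp only
    cases Hyps.candAt H st x hn i with
    | none => simp
    | some s => simp [S1.next, y, hn]
  obtain ⟨m2, e2, v2, f2⟩ := exec_assign (B := B) (A := cand) (t := t) (n := nK)
    (body := ite (le (get cand (fst t) + 1) nK)
      (get hyp (n2 * nK + 1 + (fst ans + nB * get cand (fst t)))) nK) (m := m1) k
    (fun i => if val m1 cand i + 1 ≤ k then
      val m1 hyp (n₂ * k + 1 + (val m1 ans 0 + b * val m1 cand i)) else k)
    (by simp [S1.k_eq]) (by simp [S1.k_eq, S1.n₂_eq, S1.b_eq]) (by omega) (by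
      intro j hj
      have h1 := hcand ⟨j, hj⟩
      dsimp only at h1
      rw [h1]
      cases (Hyps.nextState H G o ⟨0, hb⟩ st x).cand ⟨j, hj⟩ with
      | none => simp only [Option.elim]; omega
      | some s => have := s.2; simp only [Option.elim]; omega)
  have E2 : Env G k m2 := S1.toEnv.frame f2
  have hp2 : val m2 pos 0 = G.E₁ st.vtx x := by rw [f2 _ (by decide), S1.pos_eq]
  have ha2 : val m2 ans 0 = y := by rw [f2 _ (by decide), v1]
  obtain ⟨m3, e3, v3, f3⟩ := exec_set (B := B) (v := vtx) (t := t)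
    (e := get num (6 + n1 * nA + (fst pos * nB + fst ans))) (m := m2)
    (G.E₂ (G.E₁ st.vtx x) y) (by simp [hp2, ha2, E2.n₁_eq, E2.a_eq, E2.b_eq, E2.E₂_eq])
    (by omega) (by omega)
  refine ⟨m3, .seq e1 (.seq e2 e3), { E2.frame f3 with
    vtx_eq := v3, hyp_eq := ?_, cand_eq := ?_, exh_eq := ?_ }, ?_, ?_⟩
  · exact fun i hi => by
      rw [f3 _ (by decide), f2 _ (by decide), S1.hyp_eq i hi]
      rfl
  · exact fun i => by rw [f3 _ (by decide), v2 _ i.2, hcand]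
  · rw [f3 _ (by decide), f2 _ (by decide), S1.exh_eq]
    rfl
  · rw [f3 _ (by decide), f2 _ (by decide), S1.old_eq]
  · rw [f3 _ (by decide), ha2]

theorem exec_play {B : ℕ} (o : Objective) (hG : G.HasKind o) (hB : Bound n₁ n₂ a b k B)
    (hR : Rep ha hb G st m) (hx : val m inp 0 = x) (ho : val m old 0 = 3) :
    ∃ m', Exec B (play o) m m' ∧ Rep ha hb G (Hyps.nextState H G o ⟨0, hb⟩ st x) m' ∧
      val m' old 0 = 3 ∧ val m' ans 0 = Hyps.answer H G o ⟨0, hb⟩ st x := by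
  classical
  obtain ⟨m1, e1, S1⟩ := exec_startSearch hB hR hx ho
  obtain ⟨m2, e2, S2, c2, g2⟩ := exec_check o hG hB S1
  have hle := Hyps.le_nextHyp H G o st x
  obtain ⟨m3, e3, S3, c3⟩ := exec_search o hG hB (Hyps.nextHyp H G o st x - st.hyp) st.hyp m2
    le_rfl (by omega) S2 c2 g2
  obtain ⟨m4, e4, R4, o4, a4⟩ := exec_answer o hB S3 c3
  cases e1 with
  | seq e1 e1' => exact ⟨m4, .seq e1 (.seq e1' (.seq e2 (.seq e3 e4))), R4, o4, a4⟩

end GameProg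

/-! ### The phases of the machine -/

namespace GameProg

open StackProg Expr Cmd Var Radix

/-- The part of the program of a round that is executed in the phase `p`. -/
def phase (o : Objective) : ℕ → Cmd Var
  | 0 => readNumber
  | 1 => readHeader
  | 2 => readBlock
  | _ => play o

theorem exec_round {B : ℕ} (o : Objective) (hB : 3 ≤ B) {m : Var → List ℕ} (hm : Fits B m) {x : ℕ}
    (hx : x ≤ B) {p : ℕ} (hp : val m mode 0 = p) (hp3 : p ≤ 3) {Q : (Var → List ℕ) → Prop}
    (h : ∀ m₁, Fits B m₁ → (∀ v, v ≠ old → v ≠ inp → ∀ i, val m₁ v i = val m v i) →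
      val m₁ inp 0 = x → val m₁ old 0 = p →
      ∃ m', Exec B (phase o p) m₁ m' ∧ val m' old 0 = p ∧ Q m') :
    ∃ m', Exec B (round o) (Function.update m inp [x]) m' ∧ val m' old 0 = p ∧ Q m' := by
  have hm0 : Fits B (Function.update m inp [x]) :=
    hm.update inp (by simp; omega) (by simpa using hx)
  obtain ⟨m1, e1, v1, f1⟩ := exec_set (B := B) (v := old) (t := t) (e := fst mode)
    (m := Function.update m inp [x]) p (by simp [val_update_of_ne, hp]) (by omega) (by omega)
  obtain ⟨m2, e2, o2, q2⟩ := h m1 (e1.fits hm0)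
    (fun v h1 h2 i => by rw [f1 v h1, val_update_of_ne _ h2])
    (by rw [f1 _ (by decide), val_update_self]) v1
  refine ⟨m2, ?_, o2, q2⟩
  have hskip : ∀ {m : Var → List ℕ} {c : Cmd Var} (q : ℕ), val m old 0 = p → p ≠ q →
      Exec B (cond (eq (fst old) (OfNat.ofNat q)) c) m m := fun q h1 h2 =>
    exec_cond_of_not (by simpa [h1] using h2)
  have hexec : ∀ {m m' : Var → List ℕ} {c : Cmd Var} (q : ℕ), val m old 0 = p → p = q →
      Exec B c m m' → Exec B (cond (eq (fst old) (OfNat.ofNat q)) c) m m' := fun q h1 h2 h3 =>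
    exec_cond_of (by simpa [h1] using h2) h3
  obtain rfl | rfl | rfl | rfl : p = 0 ∨ p = 1 ∨ p = 2 ∨ p = 3 := by omega
  · exact .seq e1 (.seq (hexec 0 v1 rfl e2) (.seq (hskip 1 o2 (by decide))
      (.seq (hskip 2 o2 (by decide)) (hskip 3 o2 (by decide)))))
  · exact .seq e1 (.seq (hskip 0 v1 (by decide)) (.seq (hexec 1 v1 rfl e2)
      (.seq (hskip 2 o2 (by decide)) (hskip 3 o2 (by decide)))))
  · exact .seq e1 (.seq (hskip 0 v1 (by decide)) (.seq (hskip 1 v1 (by decide))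
      (.seq (hexec 2 v1 rfl e2) (hskip 3 o2 (by decide)))))
  · exact .seq e1 (.seq (hskip 0 v1 (by decide)) (.seq (hskip 1 v1 (by decide))
      (.seq (hskip 2 v1 (by decide)) (hexec 3 v1 rfl e2))))

/-- The machine that runs the strategy. -/
def machine (o : Objective) : OnlineTM :=
  (roundProg inp (round o) output).toOnlineTM (.inr .inp) (.inr .out)

/-- A bound for the space of a round of the machine. -/
def machineSpace (o : Objective) (B : ℕ) : ℕ := roundSpace (round o) output B

/-- Started with a memory that satisfies `S`, the machine reads the word `l` and reaches a memory
that satisfies `S'`. -/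
def Accepts (o : Objective) (B : ℕ) (S S' : (Var → List ℕ) → Prop) (l : List Bool) : Prop :=
  ∀ m, Fits B m → S m → ∃ m', (machine o).Reads (machineSpace o B) (none, memStk m) l
    (none, memStk m') ∧ Fits B m' ∧ S' m'

variable {o : Objective} {B : ℕ} {S S' S'' : (Var → List ℕ) → Prop}

theorem Accepts.append {l l' : List Bool} (h : Accepts o B S S' l) (h' : Accepts o B S' S'' l') :
    Accepts o B S S'' (l ++ l') := by
  intro m hm hS
  obtain ⟨m₁, h1, hm1, hS1⟩ := h m hm hS
  obtain ⟨m₂, h2, hm2, hS2⟩ := h' m₁ hm1 hS1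
  refine ⟨m₂, ?_, hm2, hS2⟩
  clear hS hm hS1 hm1 hS2 hm2 h h'
  generalize ((none, memStk m) : (machine o).Memory) = M at h1 ⊢
  induction l generalizing M with
  | nil =>
    obtain rfl := (h1 : _ = _)
    exact h2
  | cons c l ih =>
    obtain ⟨M', h3, h4⟩ := h1
    exact ⟨M', h3, ih M' h4⟩

/-- Reading a bit in the phase `p`. -/
theorem Accepts.bit (c : Bool) {p : ℕ} (hB : 3 ≤ B) (hp3 : p < 3)
    (hp : ∀ m, S m → val m mode 0 = p)
    (h : ∀ m m₁, S m → Fits B m₁ → (∀ v, v ≠ old → v ≠ inp → ∀ i, val m₁ v i = val m v i) →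
      val m₁ inp 0 = c.toNat → val m₁ old 0 = p →
      ∃ m', Exec B (phase o p) m₁ m' ∧ val m' old 0 = p ∧ S' m') :
    Accepts o B S S' [c] := by
  intro m hm hS
  have hc : c.toNat ≤ B := by cases c <;> simp; omega
  obtain ⟨m', e, ho, hS'⟩ := exec_round o hB hm hc (hp m hS) hp3.le (h m · hS)
  have hw : IsInput [c] c.toNat := by
    cases c
    · exact .code 0
    · exact .bit
  have hr := round_roundProg (e := output) hw hc (by omega) hm e
  have hout : output.eval m' = 0 := by
    simp only [output, eval_ite, holds_eq, eval_get, eval_ofNat, ho]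
    rw [if_neg (by omega)]
  rw [hout] at hr
  exact ⟨m', ⟨_, hr, rfl⟩, e.fits (hm.update inp (by simp; omega) (by simpa using hc)), hS'⟩

theorem Accepts.range (S : ℕ → (Var → List ℕ) → Prop) (f : ℕ → List Bool) (n : ℕ)
    (h : ∀ i < n, Accepts o B (S i) (S (i + 1)) (f i)) :
    Accepts o B (S 0) (S n) ((List.range n).flatMap f) := by
  induction n with
  | zero => exact fun m hm hS => ⟨m, rfl, hm, hS⟩
  | succ n ih =>
    rw [List.range_succ, List.flatMap_append]
    simpa using (ih fun i hi => h i (by omega)).append (h n (by omega))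

end GameProg

/-! ### Reading the code of the game -/

theorem List.getD_flatMap_of_length {α β : Type*} (l : List α) (f : α → List β) {a : ℕ}
    (hf : ∀ u ∈ l, (f u).length = a) {i j : ℕ} (hi : i < l.length) (hj : j < a) (d : β) :
    (l.flatMap f).getD (i * a + j) d = (f l[i]).getD j d := by
  induction l generalizing i with
  | nil => simp at hi
  | cons u l ih =>
    rw [List.flatMap_cons]
    have hu := hf u (by simp)
    cases i with
    | zero =>
      rw [Nat.zero_mul, zero_add, List.getD_append _ _ _ _ (by omega)]
      rfl
    | succ i =>
      rw [List.getD_append_right _ _ _ _ (by rw [hu, Nat.succ_mul]; omega), hu,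
        show (i + 1) * a + j - a = i * a + j by rw [Nat.succ_mul]; omega,
        ih (fun u hu => hf u (by simp [hu])) (by simpa using hi)]
      rfl

namespace GameProg

open StackProg Expr Cmd Var Radix

variable {n₁ n₂ a b k : ℕ}

/-- The numbers at the beginning of the code of a game. -/
def nums (G : Game (Fin n₁) (Fin n₂) (Fin a) (Fin b)) (k : ℕ) : List ℕ :=
  [k, a, b, n₁, n₂, (G.init : ℕ)] ++
    (((List.finRange n₁).flatMap fun u => (List.finRange a).map fun x => (G.E₁ u x : ℕ)) ++
    (List.finRange n₂).flatMap fun v => (List.finRange b).map fun y => (G.E₂ v y : ℕ))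

/-- The colour of the `j`-th vertex. -/
def colAt (G : Game (Fin n₁) (Fin n₂) (Fin a) (Fin b)) (j : Fin (n₁ + n₂)) : ℕ :=
  G.color (finSumFinEquiv.symm j)

/-- The characteristic sequence of the vertices of colour `d`. -/
def colBits (G : Game (Fin n₁) (Fin n₂) (Fin a) (Fin b)) (d : ℕ) : List Bool :=
  (List.finRange (n₁ + n₂)).map fun j => decide (colAt G j = d)

variable (G : Game (Fin n₁) (Fin n₂) (Fin a) (Fin b))

theorem colBits_eq (d : ℕ) : ((List.finRange n₁).map fun u => decide (G.color (.inl u) = d)) ++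
    ((List.finRange n₂).map fun v => decide (G.color (.inr v) = d)) = colBits G d := by
  refine List.ext_getElem (by simp [colBits]) fun i h1 h2 => ?_
  have hi : i < n₁ + n₂ := by simpa using h1
  rw [List.getElem_append]
  simp only [List.length_map, List.length_finRange, List.getElem_map, List.getElem_finRange,
    colBits, colAt]
  split_ifs with h
  · have : finSumFinEquiv.symm (⟨i, hi⟩ : Fin (n₁ + n₂)) = .inl ⟨i, h⟩ := by
      rw [Equiv.symm_apply_eq]
      exact Fin.ext (by simp)
    simp only [Fin.cast_mk, this]
  · have : finSumFinEquiv.symm (⟨i, hi⟩ : Fin (n₁ + n₂)) = .inr ⟨i - n₁, by omega⟩ := by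
      rw [Equiv.symm_apply_eq]
      exact Fin.ext (by simp; omega)
    simp only [Fin.cast_mk, this]

theorem code_eq : G.code k = (nums G k).flatMap natCode ++
    ((List.range (Finset.univ.sup G.color + 1)).flatMap (fun d => true :: colBits G d) ++
      [false]) := by
  simp only [Game.code, colBits_eq, nums, List.flatMap_append, List.flatMap_cons, List.flatMap_nil,
    List.flatMap_assoc, List.flatMap_map, List.append_assoc, List.nil_append]

theorem length_nums : (nums G k).length = 6 + n₁ * a + n₂ * b := by
  simp [nums, List.length_flatMap]
  omega

theorem le_of_mem_nums {B : ℕ} (hB : Bound n₁ n₂ a b k B) : ∀ q ∈ nums G k, q ≤ B := by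
  unfold Bound at hB
  intro q hq
  simp only [nums, List.mem_append, List.mem_cons, List.mem_flatMap, List.mem_map] at hq
  have := G.init.2
  rcases hq with (rfl | rfl | rfl | rfl | rfl | rfl | hq) | (⟨u, -, x, -, rfl⟩ | ⟨v, -, y, -, rfl⟩)
  any_goals omega
  simp at hq

theorem numEnv_of_nums {m : Var → List ℕ}
    (h : ∀ i < (nums G k).length, val m num i = (nums G k).getD i 0) : NumEnv G k m := by
  rw [length_nums] at h
  refine ⟨h 0 (by omega), h 1 (by omega), h 2 (by omega), h 3 (by omega), h 4 (by omega),
    h 5 (by omega), fun u x => ?_, fun v y => ?_⟩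
  · have h1 : (u : ℕ) * a + x < n₁ * a := by
      have := (finProdFinEquiv (u, x)).2
      simp only [finProdFinEquiv_apply_val] at this
      rw [mul_comm (u : ℕ) a]
      omega
    rw [h _ (by omega), nums, List.getD_append_right _ _ _ _ (by simp),
      List.getD_append _ _ _ _ (by simpa [List.length_flatMap] using h1)]
    simp only [List.length_cons, List.length_nil, zero_add, Nat.reduceAdd, Nat.add_sub_cancel_left]
    rw [List.getD_flatMap_of_length _ _ (a := a) (by simp) (by simp) x.2]
    simp
  · have h1 : (v : ℕ) * b + y < n₂ * b := by
      have := (finProdFinEquiv (v, y)).2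
      simp only [finProdFinEquiv_apply_val] at this
      rw [mul_comm (v : ℕ) b]
      omega
    rw [h _ (by omega), nums, List.getD_append_right _ _ _ _ (by simp; omega),
      List.getD_append_right _ _ _ _ (by simp [List.length_flatMap]; omega)]
    simp only [List.length_cons, List.length_nil, zero_add, Nat.reduceAdd, List.length_flatMap,
      List.length_map, List.length_finRange, List.map_const', List.sum_replicate, smul_eq_mul]
    rw [show 6 + n₁ * a + ((v : ℕ) * b + y) - 6 - n₁ * a = v * b + y by omega,
      List.getD_flatMap_of_length _ _ (a := b) (by simp) (by simp) y.2]
    simp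

/-- The memory while the numbers are read: the numbers in `L` have been read, and `p` units of the
next one. -/
structure NumState (L : List ℕ) (p : ℕ) (m : Var → List ℕ) : Prop where
  num_eq : ∀ i, val m num i = (L ++ [p]).getD i 0
  cnt_eq : val m cnt 0 = L.length
  rank_eq : val m rank 0 = 0
  pr_eq : val m pr 0 = 0
  fresh_eq : val m fresh 0 = 0

theorem exec_readNumber {B : ℕ} (hB : Bound n₁ n₂ a b k B) {m : Var → List ℕ} (hm : Fits B m)
    {L L' : List ℕ} {p p' x : ℕ} (hS : NumState L p m) (hx : val m inp 0 = x)
    (hlen : L'.length = L.length + (1 - x))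
    (hL' : ∀ i, (L' ++ [p']).getD i 0 = if i < L.length + 1 then
      (if i = L.length then p + x else (L ++ [p]).getD i 0) else 0)
    (hpre : L' <+: nums G k) (hp : p + x ≤ B) :
    ∃ m', Exec B readNumber m m' ∧ val m' old 0 = val m old 0 ∧ NumState L' p' m' ∧
      val m' mode 0 = if L' = nums G k then 1 else 0 := by
  have hB' := hB
  unfold Bound at hB'
  have hle := hpre.length_le
  rw [length_nums] at hle
  obtain ⟨m1, e1, v1, f1⟩ := exec_assign_ite (B := B) (A := num) (t := t) (n := fst cnt + 1)
    (body := ite (eq (fst t) (fst cnt)) (get num (fst t) + fst inp) (get num (fst t))) (m := m)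
    (L.length + 1) (fun i => if i = L.length then p + x else (L ++ [p]).getD i 0)
    (by simp [hS.cnt_eq]) (by
      intro j hj
      simp only [eval_ite, holds_eq, eval_get, eval_ofNat, eval_hAdd, val_pushVar_self, ne_eq,
        reduceCtorEq, not_false_eq_true, val_pushVar_of_ne, hS.cnt_eq, hx, hS.num_eq]
      split_ifs with h
      · simp [h]
      · rfl) (by omega) (by
      intro j hj
      split_ifs
      · exact hp
      · rw [← hS.num_eq]
        exact hm.val_le _ _)
  simp only [← hL'] at v1
  obtain ⟨m2, e2, v2, f2⟩ := exec_set (B := B) (v := cnt) (t := t) (e := fst cnt + (1 - fst inp))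
    (m := m1) L'.length (by simp [f1, hS.cnt_eq, hx, hlen]) (by omega) (by omega)
  have hn2 : ∀ i, val m2 num i = (L' ++ [p']).getD i 0 := fun i => by rw [f2 _ (by decide), v1]
  obtain ⟨R, hR⟩ := hpre
  -- the sizes can be read once the first six numbers are complete
  have hsize : 6 ≤ L'.length → val m2 num 1 = a ∧ val m2 num 2 = b ∧ val m2 num 3 = n₁ ∧
      val m2 num 4 = n₂ := by
    intro h6
    have : ∀ i < 6, val m2 num i = (nums G k).getD i 0 := fun i hi => by
      rw [hn2, ← hR, List.getD_append _ _ _ _ (by omega), List.getD_append _ _ _ _ (by omega)]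
    exact ⟨this 1 (by omega), this 2 (by omega), this 3 (by omega), this 4 (by omega)⟩
  have hiff : L' = nums G k ↔ 6 ≤ L'.length ∧ L'.length = 6 + n₁ * a + n₂ * b := by
    constructor
    · intro h
      rw [h, length_nums]
      omega
    · rintro ⟨-, h⟩
      rw [← length_nums G (k := k), ← hR, List.length_append] at h
      rw [← hR, List.eq_nil_of_length_eq_zero (by omega : R.length = 0), List.append_nil]
  obtain ⟨m3, e3, v3, f3⟩ := exec_set (B := B) (v := mode) (t := t)
    (e := ite (and (le 6 (fst cnt)) (eq (fst cnt) (6 + n1 * nA + n2 * nB))) 1 0) (m := m2)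
    (if L' = nums G k then 1 else 0) (by
      simp only [eval_ite, holds_and, holds_le, holds_eq, eval_get, eval_ofNat, eval_hAdd,
        eval_hMul, ne_eq, reduceCtorEq, not_false_eq_true, val_pushVar_of_ne, v2, hiff]
      by_cases h6 : 6 ≤ L'.length
      · obtain ⟨h1, h2, h3, h4⟩ := hsize h6
        rw [h1, h2, h3, h4]
      · simp [h6]) (by split_ifs <;> omega) (by omega)
  refine ⟨m3, .seq e1 (.seq e2 e3), ?_, ⟨?_, ?_, ?_, ?_, ?_⟩, v3⟩
  · rw [f3 _ (by decide), f2 _ (by decide), f1 _ (by decide)]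
  · exact fun i => by rw [f3 _ (by decide), hn2]
  · rw [f3 _ (by decide), v2]
  · rw [f3 _ (by decide), f2 _ (by decide), f1 _ (by decide), hS.rank_eq]
  · rw [f3 _ (by decide), f2 _ (by decide), f1 _ (by decide), hS.pr_eq]
  · rw [f3 _ (by decide), f2 _ (by decide), f1 _ (by decide), hS.fresh_eq]

theorem NumState.congr {L : List ℕ} {p : ℕ} {m m₁ : Var → List ℕ} (h : NumState L p m)
    (hf : ∀ v, v ≠ old → v ≠ inp → ∀ i, val m₁ v i = val m v i) : NumState L p m₁ := by
  constructor
  · exact fun i => (hf _ (by decide) (by decide) i).trans (h.num_eq i)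
  · exact (hf _ (by decide) (by decide) _).trans h.cnt_eq
  · exact (hf _ (by decide) (by decide) _).trans h.rank_eq
  · exact (hf _ (by decide) (by decide) _).trans h.pr_eq
  · exact (hf _ (by decide) (by decide) _).trans h.fresh_eq

variable {G} {B : ℕ} {o : Objective}

theorem accepts_true {L R : List ℕ} {p q : ℕ} (hB : Bound n₁ n₂ a b k B)
    (hL : nums G k = L ++ q :: R) (hp : p < q) :
    Accepts o B (fun m => NumState L p m ∧ val m mode 0 = 0)
      (fun m => NumState L (p + 1) m ∧ val m mode 0 = 0) [true] := by
  have hB' := hB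
  unfold Bound at hB'
  have hq := le_of_mem_nums G hB q (by simp [hL])
  refine Accepts.bit true (p := 0) (by omega) (by omega) (fun m h => h.2) ?_
  intro m m₁ h hm hf hx ho
  obtain ⟨m', e, o', N', h'⟩ := exec_readNumber (L' := L) (p' := p + 1) G hB hm (h.1.congr hf) hx
    (by simp) (by
      intro i
      rcases Nat.lt_trichotomy i L.length with hi | rfl | hi
      · rw [if_pos (by omega), if_neg (by omega), List.getD_append _ _ _ _ hi,
          List.getD_append _ _ _ _ hi]
      · simp
      · rw [if_neg (by omega), List.getD_eq_default _ _ (by simp; omega)])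
    ⟨_, hL.symm⟩ (by simp; omega)
  refine ⟨m', e, by rw [o', ho], N', ?_⟩
  rw [h', if_neg]
  rw [hL]
  simp

theorem accepts_false {L R : List ℕ} {q : ℕ} (hB : Bound n₁ n₂ a b k B)
    (hL : nums G k = L ++ q :: R) :
    Accepts o B (fun m => NumState L q m ∧ val m mode 0 = 0)
      (fun m => NumState (L ++ [q]) 0 m ∧ val m mode 0 = if R = [] then 1 else 0) [false] := by
  have hB' := hB
  unfold Bound at hB'
  have hq := le_of_mem_nums G hB q (by simp [hL])
  refine Accepts.bit false (p := 0) (by omega) (by omega) (fun m h => h.2) ?_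
  intro m m₁ h hm hf hx ho
  obtain ⟨m', e, o', N', h'⟩ := exec_readNumber (L' := L ++ [q]) (p' := 0) G hB hm (h.1.congr hf)
    hx (by simp) (by
      intro i
      rcases Nat.lt_trichotomy i L.length with hi | rfl | hi
      · rw [if_pos (by omega), if_neg (by omega), List.getD_append _ _ _ _ (by simp; omega)]
      · simp
      · rw [if_neg (by omega)]
        rcases Nat.lt_or_ge i (L.length + 2) with hi' | hi'
        · obtain rfl : i = L.length + 1 := by omega
          rw [List.getD_append_right _ _ _ _ (by simp)]
          simp
        · rw [List.getD_eq_default _ _ (by simp; omega)])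
    ⟨R, by simp [hL]⟩ (by simpa using hq)
  refine ⟨m', e, by rw [o', ho], N', ?_⟩
  rw [h', hL]
  simp

theorem accepts_natCode {L R : List ℕ} {q : ℕ} (hB : Bound n₁ n₂ a b k B)
    (hL : nums G k = L ++ q :: R) :
    Accepts o B (fun m => NumState L 0 m ∧ val m mode 0 = 0)
      (fun m => NumState (L ++ [q]) 0 m ∧ val m mode 0 = if R = [] then 1 else 0) (natCode q) := by
  have h : ∀ p ≤ q, Accepts o B (fun m => NumState L 0 m ∧ val m mode 0 = 0)
      (fun m => NumState L p m ∧ val m mode 0 = 0) (List.replicate p true) := by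
    intro p
    induction p with
    | zero => exact fun _ m hm hS => ⟨m, rfl, hm, hS⟩
    | succ p ih =>
      intro hp
      rw [List.replicate_succ']
      exact (ih (by omega)).append (accepts_true hB hL (by omega))
  exact (h q le_rfl).append (accepts_false hB hL)

theorem accepts_nums (hB : Bound n₁ n₂ a b k B) :
    Accepts o B (fun m => NumState [] 0 m ∧ val m mode 0 = 0)
      (fun m => NumState (nums G k) 0 m ∧ val m mode 0 = 1) ((nums G k).flatMap natCode) := by
  have h : ∀ (R L : List ℕ), nums G k = L ++ R → R ≠ [] →
      Accepts o B (fun m => NumState L 0 m ∧ val m mode 0 = 0)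
        (fun m => NumState (nums G k) 0 m ∧ val m mode 0 = 1) (R.flatMap natCode) := by
    intro R
    induction R with
    | nil => exact fun _ _ h => absurd rfl h
    | cons q R ih =>
      intro L hL _
      have h1 := accepts_natCode (o := o) hB hL
      rw [List.flatMap_cons]
      by_cases hR : R = []
      · subst hR
        rw [← hL] at h1
        simpa using h1
      · rw [if_neg hR] at h1
        exact h1.append (ih (L ++ [q]) (by simp [hL]) hR)
  exact h _ [] rfl (by simp [nums])

end GameProg

/-! ### Reading the colouring -/

namespace GameProg

open StackProg Expr Cmd Var Radix

variable {n₁ n₂ a b k : ℕ} (G : Game (Fin n₁) (Fin n₂) (Fin a) (Fin b)) {m m' m₁ : Var → List ℕ}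

/-- The memory after the blocks of the colours less than `d` and the bits of the vertices less than
`i` in the block of the colour `d` have been read. -/
structure ColState (k : ℕ) (d i : ℕ) (m : Var → List ℕ) : Prop extends NumEnv G k m where
  rank_eq : val m rank 0 = G.rankOf d
  pr_eq : val m pr 0 = d % 2
  fresh_eq : val m fresh 0 = if ∃ j : Fin (n₁ + n₂), j < i ∧ colAt G j = d then 1 else 0
  ord_eq : ∀ j : Fin (n₁ + n₂), colAt G j < d ∨ colAt G j = d ∧ j < i →
    val m ord j = G.rankOf (colAt G j)
  par_eq : ∀ j : Fin (n₁ + n₂), colAt G j < d ∨ colAt G j = d ∧ j < i →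
    val m par j = colAt G j % 2

variable {G} {d i : ℕ}

theorem ColState.congr (h : ColState G k d i m)
    (hf : ∀ v ∈ [num, rank, pr, fresh, ord, par], ∀ i, val m₁ v i = val m v i) :
    ColState G k d i m₁ := by
  simp only [List.forall_mem_cons, List.not_mem_nil, false_imp_iff, implies_true, and_true] at hf
  obtain ⟨h1, h2, h3, h4, h5, h6⟩ := hf
  refine ⟨h.toNumEnv.congr h1, ?_, ?_, ?_, ?_, ?_⟩
  · rw [h2, h.rank_eq]
  · rw [h3, h.pr_eq]
  · rw [h4, h.fresh_eq]
  · simpa only [h5] using h.ord_eq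
  · simpa only [h6] using h.par_eq

theorem ColState.congr_of_ne (h : ColState G k d i m)
    (hf : ∀ v, v ≠ old → v ≠ inp → ∀ i, val m₁ v i = val m v i) : ColState G k d i m₁ := by
  refine h.congr fun v hv => hf v ?_ ?_ <;> rintro rfl <;> simp at hv

theorem ColState.frame (h : ColState G k d i m) {A : Var}
    (hf : ∀ v ≠ A, ∀ i, val m' v i = val m v i)
    (hA : ∀ v ∈ [num, rank, pr, fresh, ord, par], v ≠ A := by decide) : ColState G k d i m' :=
  h.congr fun v hv => hf v (hA v hv)

theorem exists_colAt_eq_iff (c : ℕ) : (∃ z, G.color z = c) ↔ ∃ j, colAt G j = c := by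
  constructor
  · rintro ⟨z, rfl⟩
    exact ⟨finSumFinEquiv z, by rw [colAt, Equiv.symm_apply_apply]⟩
  · exact fun ⟨j, hj⟩ => ⟨_, hj⟩

/-- Once a block has been read completely, the colour is counted if it occurs. -/
theorem ColState.rankOf_succ (h : ColState G k d (n₁ + n₂) m) :
    val m rank 0 + val m fresh 0 = G.rankOf (d + 1) := by
  classical
  rw [h.rank_eq, h.fresh_eq, Game.rankOf_succ]
  simp only [exists_colAt_eq_iff, Fin.is_lt, true_and]

theorem rankOf_colAt_le (c : ℕ) : G.rankOf c ≤ n₁ + n₂ := by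
  simpa using G.rankOf_le c

variable {B : ℕ} {o : Objective}

theorem exec_readBit (hB : Bound n₁ n₂ a b k B) (hm : Fits B m) (hS : ColState G k d i m)
    (hi : i < n₁ + n₂) (hidx : val m idx 0 = i)
    (hx : val m inp 0 = (decide (colAt G ⟨i, hi⟩ = d)).toNat) :
    ∃ m', Exec B (.seq (tab par (n1 + n2) (ite (and (eq (fst t) (fst idx)) (fst inp)) (fst pr)
        (get par (fst t))))
      (.seq (tab ord (n1 + n2) (ite (and (eq (fst t) (fst idx)) (fst inp)) (fst rank)
        (get ord (fst t))))
      (.seq (put fresh (ite (fst inp) 1 (fst fresh))) (put idx (fst idx + 1))))) m m' ∧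
      val m' old 0 = val m old 0 ∧ val m' mode 0 = val m mode 0 ∧ ColState G k d (i + 1) m' ∧
      val m' idx 0 = i + 1 := by
  unfold Bound at hB
  have hx0 : val m inp 0 ≠ 0 ↔ colAt G ⟨i, hi⟩ = d := by
    rw [hx]
    by_cases hc : colAt G ⟨i, hi⟩ = d <;> simp [hc]
  obtain ⟨m1, e1, v1, f1⟩ := exec_assign (B := B) (A := par) (t := t) (n := n1 + n2)
    (body := ite (and (eq (fst t) (fst idx)) (fst inp)) (fst pr) (get par (fst t))) (m := m)
    (n₁ + n₂) (fun j => if j = i ∧ colAt G ⟨i, hi⟩ = d then d % 2 else val m par j)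
    (by simp [hS.n₁_eq, hS.n₂_eq]) (by simp [holds_get, hidx, hx0, hS.pr_eq]) (by omega) (by
      intro j hj
      split_ifs
      · omega
      · exact hm.val_le _ _)
  obtain ⟨m2, e2, v2, f2⟩ := exec_assign (B := B) (A := ord) (t := t) (n := n1 + n2)
    (body := ite (and (eq (fst t) (fst idx)) (fst inp)) (fst rank) (get ord (fst t))) (m := m1)
    (n₁ + n₂) (fun j => if j = i ∧ colAt G ⟨i, hi⟩ = d then G.rankOf d else val m ord j)
    (by simp [f1, hS.n₁_eq, hS.n₂_eq]) (by simp [f1, holds_get, hidx, hx0, hS.rank_eq]) (by omega)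
    (by
      intro j hj
      split_ifs
      · have := rankOf_colAt_le (G := G) d
        omega
      · exact hm.val_le _ _)
  have hfresh : (if colAt G ⟨i, hi⟩ = d then 1 else val m fresh 0) =
      if ∃ j : Fin (n₁ + n₂), j < i + 1 ∧ colAt G j = d then 1 else 0 := by
    rw [hS.fresh_eq]
    by_cases hc : colAt G ⟨i, hi⟩ = d
    · rw [if_pos hc, if_pos ⟨⟨i, hi⟩, by simp, hc⟩]
    · rw [if_neg hc]
      refine if_congr (exists_congr fun j => and_congr_left fun hj => ?_) rfl rfl
      have : (j : ℕ) ≠ i := by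
        rintro rfl
        exact hc hj
      omega
  obtain ⟨m3, e3, v3, f3⟩ := exec_set (B := B) (v := fresh) (t := t)
    (e := ite (fst inp) 1 (fst fresh)) (m := m2)
    (if ∃ j : Fin (n₁ + n₂), j < i + 1 ∧ colAt G j = d then 1 else 0)
    (by rw [← hfresh]; simp [f1, f2, holds_get, hx0]) (by split_ifs <;> omega) (by omega)
  obtain ⟨m4, e4, v4, f4⟩ := exec_set (B := B) (v := idx) (t := t)
    (e := fst idx + 1) (m := m3) (i + 1) (by simp [f1, f2, f3, hidx]) (by omega) (by omega)
  refine ⟨m4, .seq e1 (.seq e2 (.seq e3 e4)), by simp [f1, f2, f3, f4], by simp [f1, f2, f3, f4],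
    ⟨hS.toNumEnv.congr (by simp [f1, f2, f3, f4]), ?_, ?_, ?_, fun j hj => ?_, fun j hj => ?_⟩, v4⟩
  · simp [f1, f2, f3, f4, hS.rank_eq]
  · simp [f1, f2, f3, f4, hS.pr_eq]
  · rw [f4 _ (by decide), v3]
  · rw [f4 _ (by decide), f3 _ (by decide), v2 _ j.2]
    split_ifs with h
    · obtain rfl : j = ⟨i, hi⟩ := Fin.ext h.1
      rw [h.2]
    · refine hS.ord_eq j (hj.imp_right fun h' => ⟨h'.1, ?_⟩)
      have : (j : ℕ) ≠ i := by
        rintro rfl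
        exact h ⟨rfl, h'.1⟩
      omega
  · rw [f4 _ (by decide), f3 _ (by decide), f2 _ (by decide), v1 _ j.2]
    split_ifs with h
    · obtain rfl : j = ⟨i, hi⟩ := Fin.ext h.1
      rw [h.2]
    · refine hS.par_eq j (hj.imp_right fun h' => ⟨h'.1, ?_⟩)
      have : (j : ℕ) ≠ i := by
        rintro rfl
        exact h ⟨rfl, h'.1⟩
      omega

theorem exec_endBlock (hB : Bound n₁ n₂ a b k B) (hS : ColState G k d (n₁ + n₂) m) :
    ∃ m', Exec B (.seq (put mode 1) (.seq (put rank (fst rank + fst fresh))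
      (.seq (put pr (1 - fst pr)) (put fresh 0)))) m m' ∧
      val m' old 0 = val m old 0 ∧ val m' mode 0 = 1 ∧ ColState G k (d + 1) 0 m' := by
  unfold Bound at hB
  have hr := rankOf_colAt_le (G := G) (d + 1)
  obtain ⟨m1, e1, v1, f1⟩ := exec_set (B := B) (v := mode) (t := t) (e := 1) (m := m) 1
    (by simp) (by omega) (by omega)
  obtain ⟨m2, e2, v2, f2⟩ := exec_set (B := B) (v := rank) (t := t) (e := fst rank + fst fresh)
    (m := m1) (G.rankOf (d + 1)) (by simp [f1, hS.rankOf_succ]) (by omega) (by omega)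
  obtain ⟨m3, e3, v3, f3⟩ := exec_set (B := B) (v := pr) (t := t) (e := 1 - fst pr)
    (m := m2) ((d + 1) % 2) (by simp [f1, f2, hS.pr_eq]; omega) (by omega) (by omega)
  obtain ⟨m4, e4, v4, f4⟩ := exec_set (B := B) (v := fresh) (t := t) (e := 0)
    (m := m3) 0 (by simp) (by omega) (by omega)
  have hlt : ∀ j : Fin (n₁ + n₂), colAt G j < d + 1 ∨ colAt G j = d + 1 ∧ (j : ℕ) < 0 →
      colAt G j < d ∨ colAt G j = d ∧ (j : ℕ) < n₁ + n₂ := fun j hj => by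
    have := j.2
    omega
  refine ⟨m4, .seq e1 (.seq e2 (.seq e3 e4)), by simp [f1, f2, f3, f4], by simp [f2, f3, f4, v1],
    ⟨hS.toNumEnv.congr (by simp [f1, f2, f3, f4]), ?_, ?_, ?_, fun j hj => ?_, fun j hj => ?_⟩⟩
  · simp [f3, f4, v2]
  · simp [f4, v3]
  · simp [v4]
  · simp [f1, f2, f3, f4, hS.ord_eq j (hlt j hj)]
  · simp [f1, f2, f3, f4, hS.par_eq j (hlt j hj)]

/-- The memory in front of the block of the colour `d`. -/
def HeaderState (G : Game (Fin n₁) (Fin n₂) (Fin a) (Fin b)) (k d : ℕ) (m : Var → List ℕ) : Prop :=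
  ColState G k d 0 m ∧ val m mode 0 = 1

/-- The memory after `i` bits of the block of the colour `d`. -/
def BlockState (G : Game (Fin n₁) (Fin n₂) (Fin a) (Fin b)) (k d i : ℕ) (m : Var → List ℕ) :
    Prop :=
  if i < n₁ + n₂ then ColState G k d i m ∧ val m mode 0 = 2 ∧ val m idx 0 = i
  else HeaderState G k (d + 1) m

theorem accepts_header (hB : Bound n₁ n₂ a b k B) (d : ℕ) :
    Accepts o B (HeaderState G k d) (BlockState G k d 0) [true] := by
  have hB' := hB
  unfold Bound at hB'
  refine Accepts.bit true (p := 1) (by omega) (by omega) (fun m h => h.2) ?_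
  intro m m₁ h hm hf hx ho
  have S := h.1.congr_of_ne hf
  obtain ⟨m1, e1, v1, f1⟩ := exec_set (B := B) (v := idx) (t := t) (e := 0) (m := m₁) 0
    (by simp) (by omega) (by omega)
  obtain ⟨m2, e2, v2, f2⟩ := exec_set (B := B) (v := mode) (t := t) (e := ite (fst inp) 2 3)
    (m := m1) 2 (by simp [holds_get, f1, hx]) (by omega) (by omega)
  refine ⟨m2, .seq e1 (.seq e2 (exec_cond_of_not (by simp [holds_get, f1, f2, hx]))),
    by simp [f1, f2, ho], ?_⟩
  rw [BlockState, if_pos (by have := G.init.2; omega)]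
  exact ⟨(S.frame f1).frame f2, v2, by simp [f2, v1]⟩

theorem accepts_blockBit (hB : Bound n₁ n₂ a b k B) (d : ℕ) (hi : i < n₁ + n₂) :
    Accepts o B (BlockState G k d i) (BlockState G k d (i + 1))
      [decide (colAt G ⟨i, hi⟩ = d)] := by
  have hB' := hB
  unfold Bound at hB'
  refine Accepts.bit _ (p := 2) (by omega) (by omega)
    (fun m h => by rw [BlockState, if_pos hi] at h; exact h.2.1) ?_
  intro m m₁ h hm hf hx ho
  rw [BlockState, if_pos hi] at h
  have S := h.1.congr_of_ne hf
  obtain ⟨m1, e1, o1, h1, S1, i1⟩ := exec_readBit hB hm S hi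
    ((hf _ (by decide) (by decide) 0).trans h.2.2) hx
  have hseq : ∀ {c}, ∀ {m'}, Exec B c m1 m' → Exec B (.seq (tab par (n1 + n2)
      (ite (and (eq (fst t) (fst idx)) (fst inp)) (fst pr) (get par (fst t))))
      (.seq (tab ord (n1 + n2) (ite (and (eq (fst t) (fst idx)) (fst inp)) (fst rank)
        (get ord (fst t))))
      (.seq (put fresh (ite (fst inp) 1 (fst fresh))) (.seq (put idx (fst idx + 1)) c)))) m₁
      m' := by
    intro c m' hc
    cases e1 with
    | seq e1 e2 => cases e2 with
      | seq e2 e3 => cases e3 with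
        | seq e3 e4 => exact .seq e1 (.seq e2 (.seq e3 (.seq e4 hc)))
  by_cases hlast : i + 1 = n₁ + n₂
  · rw [hlast] at S1
    obtain ⟨m2, e2, o2, h2, S2⟩ := exec_endBlock hB S1
    refine ⟨m2, hseq (exec_cond_of (by simp [i1, S1.n₁_eq, S1.n₂_eq, hlast]) e2),
      by rw [o2, o1, ho], ?_⟩
    rw [BlockState, if_neg (by omega)]
    exact ⟨S2, h2⟩
  · refine ⟨m1, hseq (exec_cond_of_not (by simp [i1, S1.n₁_eq, S1.n₂_eq, hlast])),
      by rw [o1, ho], ?_⟩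
    rw [BlockState, if_pos (by omega)]
    exact ⟨S1, by rw [h1, hf _ (by decide) (by decide), h.2.1], i1⟩

theorem accepts_block (hB : Bound n₁ n₂ a b k B) (d : ℕ) :
    Accepts o B (HeaderState G k d) (HeaderState G k (d + 1)) (true :: colBits G d) := by
  have h1 := Accepts.range (o := o) (B := B) (BlockState G k d)
    (fun i => if hi : i < n₁ + n₂ then [decide (colAt G ⟨i, hi⟩ = d)] else []) (n₁ + n₂)
    (fun i hi => by rw [dif_pos hi]; exact accepts_blockBit hB d hi)
  have h2 : ((List.range (n₁ + n₂)).flatMap fun i =>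
      if hi : i < n₁ + n₂ then [decide (colAt G ⟨i, hi⟩ = d)] else []) = colBits G d := by
    rw [← List.map_coe_finRange_eq_range, List.flatMap_map]
    simp [colBits, List.map_eq_flatMap]
  rw [h2] at h1
  have h3 : BlockState G k d (n₁ + n₂) = HeaderState G k (d + 1) := by
    funext m
    rw [BlockState, if_neg (lt_irrefl _)]
  rw [h3] at h1
  exact (accepts_header hB d).append h1

theorem HeaderState.colEnv (h : HeaderState G k d m) (hd : ∀ z, G.color z < d) : ColEnv G m := by
  have key : ∀ z, val m ord (finSumFinEquiv z : Fin _) = G.rankOf (G.color z) ∧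
      val m par (finSumFinEquiv z : Fin _) = G.color z % 2 := by
    intro z
    have hz : colAt G (finSumFinEquiv z) = G.color z := by rw [colAt, Equiv.symm_apply_apply]
    have h1 := h.1.ord_eq (finSumFinEquiv z) (.inl (hz ▸ hd z))
    have h2 := h.1.par_eq (finSumFinEquiv z) (.inl (hz ▸ hd z))
    rw [hz] at h1 h2
    exact ⟨h1, h2⟩
  refine ⟨fun u => ?_, fun v => ?_, fun u => ?_, fun v => ?_⟩
  · simpa using (key (.inl u)).1
  · simpa using (key (.inr v)).1
  · simpa using (key (.inl u)).2
  · simpa using (key (.inr v)).2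

/-- The quotients of the indices of product states are computed by counting. -/
theorem eval_quo [NeZero k] (hn : NumEnv G k m) (hcap : val m cap 0 = n₂ * k + 1) {q : ℕ}
    (hq : q < n₂ * k) :
    (loop cap acc cyc n2 0 (ite (le (nK * fst cyc) (fst t)) (fst cyc) (fst acc)) :
      Expr Var).eval (pushVar m t q) = q / k := by
  have hk : 0 < k := Nat.pos_of_neZero k
  have hdiv : q / k < n₂ := Nat.div_lt_of_lt_mul (by rwa [mul_comm])
  have hle : q / k ≤ q := Nat.div_le_self q k
  rw [eval_loop (fun j => min (j - 1) (q / k)) (by decide) (by decide)]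
  · simp [hn.n₂_eq]
    omega
  · simp
  · intro j hj
    have h1 : k * j ≤ q ↔ j ≤ q / k := by rw [Nat.le_div_iff_mul_le hk, mul_comm]
    simp [hn.k_eq, h1]
    split_ifs <;> omega
  · intro j hj
    simp [hcap]
    omega

/-- The memory at the beginning of the play. -/
structure StartState (G : Game (Fin n₁) (Fin n₂) (Fin a) (Fin b)) (k : ℕ) (m : Var → List ℕ) :
    Prop extends Env G k m where
  vtx_eq : val m vtx 0 = G.init
  hyp_eq : ∀ i < n₂ * k + 1 + k * b + k, val m hyp i = 0
  cand_eq : ∀ i < k, val m cand i = i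
  exh_eq : val m exh 0 = 0

variable [NeZero k]

theorem StartState.rep (ha : 0 < a) (hb : 0 < b) (h : StartState G k m) :
    Rep ha hb G (Hyps.initState (k := k) G) m := by
  refine { h.toEnv with
    vtx_eq := h.vtx_eq, hyp_eq := fun i hi => ?_, cand_eq := fun i => ?_, exh_eq := ?_ }
  · rw [h.hyp_eq i hi]
    simp [digit, Hyps.initState]
  · rw [h.cand_eq i i.2]
    rfl
  · have hk : 0 < k := Nat.pos_of_neZero k
    have hT : 0 < (digitHyps n₂ a b k ha hb hk).total :=
      Nat.mul_pos (Nat.mul_pos (Nat.mul_pos (Nat.pow_pos hk) (Nat.pow_pos ha)) hk) (Nat.pow_pos hb)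
    rw [h.exh_eq]
    exact (if_neg (not_le.2 hT)).symm

theorem exec_startPlay (hB : Bound n₁ n₂ a b k B) (hn : NumEnv G k m) (hc : ColEnv G m)
    (hmode : val m mode 0 = 3) :
    ∃ m', Exec B startPlay m m' ∧ val m' old 0 = val m old 0 ∧
      StartState G k m' := by
  unfold Bound at hB
  have hk : 0 < k := Nat.pos_of_neZero k
  obtain ⟨m1, e1, v1, f1⟩ := exec_set (B := B) (v := cap) (t := t) (e := n2 * nK + 1) (m := m)
    (n₂ * k + 1) (by simp [hn.n₂_eq, hn.k_eq]) (by omega) (by omega)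
  have N1 : NumEnv G k m1 := hn.congr (f1 _ (by decide))
  obtain ⟨m2, e2, v2, f2⟩ := exec_assign (B := B) (A := quo) (t := t) (n := n2 * nK)
    (body := loop cap acc cyc n2 0 (ite (le (nK * fst cyc) (fst t)) (fst cyc) (fst acc)))
    (m := m1) (n₂ * k) (fun q => q / k) (by simp [N1.n₂_eq, N1.k_eq])
    (fun q hq => eval_quo N1 v1 hq) (by omega) (fun q hq => by
      have := Nat.div_le_self q k
      omega)
  obtain ⟨m3, e3, v3, f3⟩ := exec_assign (B := B) (A := rem) (t := t) (n := n2 * nK)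
    (body := fst t - nK * get quo (fst t)) (m := m2) (n₂ * k) (fun q => q - k * (q / k))
    (by simp [f2, N1.n₂_eq, N1.k_eq])
    (fun q hq => by simp [f2 num (by decide), N1.k_eq, v2 q hq]) (by omega) (fun q hq => by omega)
  obtain ⟨m4, e4, v4, f4⟩ := exec_set (B := B) (v := vtx) (t := t) (e := get num 5) (m := m3)
    G.init (by simp [f2, f3, N1.init_eq]) (by have := G.init.2; omega) (by omega)
  obtain ⟨m5, e5, v5, f5⟩ := exec_assign (B := B) (A := hyp) (t := t) (n := labelPos + nK)
    (body := 0) (m := m4) (n₂ * k + 1 + k * b + k) (fun _ => 0)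
    (by simp [f2, f3, f4, N1.n₂_eq, N1.k_eq, N1.b_eq]) (by simp) (by omega) (by simp)
  obtain ⟨m6, e6, v6, f6⟩ := exec_assign (B := B) (A := cand) (t := t) (n := nK)
    (body := fst t) (m := m5) k (fun i => i)
    (by simp [f2, f3, f4, f5, N1.k_eq]) (by simp) (by omega) (fun i hi => by omega)
  obtain ⟨m7, e7, v7, f7⟩ := exec_set (B := B) (v := exh) (t := t) (e := 0) (m := m6)
    0 (by simp) (by omega) (by omega)
  have hquo : ∀ q : Fin n₂ × Fin k, ((finProdFinEquiv q : Fin _) : ℕ) / k = q.1 := by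
    intro q
    rw [finProdFinEquiv_apply_val, Nat.add_mul_div_left _ _ hk, Nat.div_eq_of_lt q.2.2, zero_add]
  refine ⟨m7, .seq e1 (.seq e2 (.seq e3 (.seq e4 (.seq e5 (.seq e6 e7))))),
    by simp [f1, f2, f3, f4, f5, f6, f7],
    { N1.congr (m' := m7) (by simp [f2, f3, f4, f5, f6, f7]),
      hc.congr (m' := m7) (by simp [f1, f2, f3, f4, f5, f6, f7])
        (by simp [f1, f2, f3, f4, f5, f6, f7]) with
      cap_eq := by simp [f2, f3, f4, f5, f6, f7, v1]
      quo_eq := fun q => ?_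
      rem_eq := fun q => ?_
      mode_eq := by simp [f1, f2, f3, f4, f5, f6, f7, hmode]
      vtx_eq := by simp [f5, f6, f7, v4]
      hyp_eq := fun i hi => ?_
      cand_eq := fun i hi => ?_
      exh_eq := v7 }⟩
  · rw [f7 _ (by decide), f6 _ (by decide), f5 _ (by decide), f4 _ (by decide), f3 _ (by decide),
      v2 _ (Fin.is_lt _), hquo]
  · rw [f7 _ (by decide), f6 _ (by decide), f5 _ (by decide), f4 _ (by decide),
      v3 _ (Fin.is_lt _), hquo, finProdFinEquiv_apply_val, Nat.add_sub_cancel]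
  · rw [f7 _ (by decide), f6 _ (by decide), v5 i hi]
  · rw [f7 _ (by decide), v6 i hi]

theorem accepts_end (hB : Bound n₁ n₂ a b k B) (hd : ∀ z, G.color z < d) :
    Accepts o B (HeaderState G k d) (StartState G k) [false] := by
  have hB' := hB
  unfold Bound at hB'
  refine Accepts.bit false (p := 1) (by omega) (by omega) (fun m h => h.2) ?_
  intro m m₁ h hm hf hx ho
  have S := h.1.congr_of_ne hf
  have hC : ColEnv G m₁ := (h.colEnv hd).congr (hf _ (by decide) (by decide))
    (hf _ (by decide) (by decide))
  obtain ⟨m1, e1, v1, f1⟩ := exec_set (B := B) (v := idx) (t := t) (e := 0) (m := m₁) 0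
    (by simp) (by omega) (by omega)
  obtain ⟨m2, e2, v2, f2⟩ := exec_set (B := B) (v := mode) (t := t) (e := ite (fst inp) 2 3)
    (m := m1) 3 (by simp [holds_get, f1, hx]) (by omega) (by omega)
  obtain ⟨m3, e3, o3, R3⟩ := exec_startPlay hB (m := m2) (S.toNumEnv.congr (by simp [f1, f2]))
    (hC.congr (by simp [f1, f2]) (by simp [f1, f2])) v2
  exact ⟨m3, .seq e1 (.seq e2 (exec_cond_of (by simp [holds_get, f1, f2, hx]) e3)),
    by rw [o3]; simp [f1, f2, ho], R3⟩

theorem accepts_code (hB : Bound n₁ n₂ a b k B) :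
    Accepts o B (fun m => NumState [] 0 m ∧ val m mode 0 = 0) (StartState G k)
      (G.code k) := by
  rw [code_eq]
  have h1 : Accepts o B (HeaderState G k 0) (HeaderState G k (Finset.univ.sup G.color + 1))
      ((List.range (Finset.univ.sup G.color + 1)).flatMap fun d => true :: colBits G d) :=
    Accepts.range (HeaderState G k) _ _ fun d _ => accepts_block hB d
  have h2 : Accepts o B (HeaderState G k (Finset.univ.sup G.color + 1))
      (StartState G k) [false] :=
    accepts_end hB fun z => Nat.lt_succ_of_le (Finset.le_sup (Finset.mem_univ z))
  refine Accepts.append ?_ (h1.append h2)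
  intro m hm hS
  obtain ⟨m', h3, hm', N, h4⟩ := accepts_nums hB m hm hS
  refine ⟨m', h3, hm', ⟨numEnv_of_nums G fun i hi => ?_, ?_, ?_, ?_, ?_, ?_⟩, h4⟩
  · rw [N.num_eq, List.getD_append _ _ _ _ hi]
  · simp [N.rank_eq, Game.rankOf]
  · rw [N.pr_eq]
  · rw [N.fresh_eq, if_neg (by simp)]
  · intro j hj
    omega
  · intro j hj
    omega

end GameProg

/-! ### The machine runs the strategy -/

namespace GameProg

open StackProg Expr Cmd Var Radix

variable {n₁ n₂ a b k : ℕ} {G : Game (Fin n₁) (Fin n₂) (Fin a) (Fin b)} {B : ℕ} {o : Objective}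

/-- The code of the game is read, starting with the empty memory. -/
theorem reads_code [NeZero k] (hB : Bound n₁ n₂ a b k B) :
    ∃ m, (machine o).Reads (machineSpace o B) (machine o).initMemory (G.code k)
      (none, memStk m) ∧ Fits B m ∧ StartState G k m := by
  have hinit : (machine o).initMemory = (none, memStk fun _ => []) := by
    refine Prod.ext rfl (funext fun v => ?_)
    rcases v with v | v
    · rfl
    · cases v <;> rfl
  rw [hinit]
  refine accepts_code hB (fun _ => []) (fun v => ?_) ⟨⟨?_, rfl, rfl, rfl, rfl⟩, rfl⟩
  · simp
  · rintro (_ | i) <;> simp [val]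

variable [NeZero k] {ha : 0 < a} {hb : 0 < b}

local notation "H" => digitHyps n₂ a b k ha hb (Nat.pos_of_neZero k)

/-- A round of the play realizes a step of the strategy. -/
theorem round_play (hG : G.HasKind o) (hB : Bound n₁ n₂ a b k B) {st : MemState (Fin n₁) k}
    {m : Var → List ℕ} (hm : Fits B m) (hR : Rep ha hb G st m) (x : Fin a) :
    ∃ m', (machine o).Round (machineSpace o B) (none, memStk m) (natCode x)
      (natCode (Hyps.answer H G o ⟨0, hb⟩ st x : Fin b)) (none, memStk m') ∧ Fits B m' ∧
      Rep ha hb G (Hyps.nextState H G o ⟨0, hb⟩ st x) m' := by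
  have hB' := hB
  unfold Bound at hB'
  have hxB : (x : ℕ) ≤ B := by omega
  obtain ⟨m', e, ho, hR', hy⟩ := exec_round o (by omega) hm hxB hR.mode_eq le_rfl
    (Q := fun m' => Rep ha hb G (Hyps.nextState H G o ⟨0, hb⟩ st x) m' ∧
      val m' ans 0 = (Hyps.answer H G o ⟨0, hb⟩ st x : Fin b)) (by
    intro m₁ _ hf hx ho
    suffices hR₁ : Rep ha hb G st m₁ by
      obtain ⟨m', e, hR', ho', hy⟩ := exec_play o hG hB hR₁ hx ho
      exact ⟨m', e, ho', hR', hy⟩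
    refine (hR.frame (A := old) (m' := Function.update m₁ inp (m inp)) ?_).frame (A := inp) ?_
    · intro v hv i
      by_cases hvi : v = inp
      · subst hvi
        simp [val]
      · rw [val_update_of_ne _ hvi, hf v hv hvi]
    · exact fun v hv i => (val_update_of_ne _ hv _ i).symm)
  have hr := round_roundProg (e := output) (.code x) hxB (by omega) hm e
  have hout : output.eval m' = ((Hyps.answer H G o ⟨0, hb⟩ st x : Fin b) : ℕ) + 1 := by
    simp [output, ho, hy]
  rw [hout] at hr
  exact ⟨m', hr, e.fits (hm.update inp (by simp; omega) (by simpa using hxB)), hR'⟩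

theorem runsStrategy (hG : G.HasKind o) (hB : Bound n₁ n₂ a b k B) :
    (machine o).RunsStrategy (machineSpace o B) (G.code k) (Hyps.strategy H G o ⟨0, hb⟩) := by
  obtain ⟨m₀, h₀, hm₀, hS⟩ := reads_code (o := o) (G := G) hB
  refine ⟨_, h₀, fun w hw => ?_⟩
  have hstep : ∀ i m, Fits B m ∧ Rep ha hb G (Hyps.stateSeq H G o ⟨0, hb⟩ w i) m →
      ∃ m', (machine o).Round (machineSpace o B) (none, memStk m) (natCode (w i).1)
        (natCode (w i).2) (none, memStk m') ∧ Fits B m' ∧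
        Rep ha hb G (Hyps.stateSeq H G o ⟨0, hb⟩ w (i + 1)) m' := by
    rintro i m ⟨hm, hR⟩
    rw [(Hyps.agrees_strategy_iff H).1 hw i]
    exact round_play hG hB hm hR (w i).1
  choose! F hF using hstep
  obtain ⟨ms, hms₀, hms⟩ : ∃ ms : ℕ → Var → List ℕ, ms 0 = m₀ ∧ ∀ i, ms (i + 1) = F i (ms i) :=
    ⟨fun i => Nat.rec m₀ F i, rfl, fun _ => rfl⟩
  have hinv : ∀ i, Fits B (ms i) ∧ Rep ha hb G (Hyps.stateSeq H G o ⟨0, hb⟩ w i) (ms i) := by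
    intro i
    induction i with
    | zero =>
      rw [hms₀]
      exact ⟨hm₀, hS.rep ha hb⟩
    | succ i ih =>
      rw [hms]
      exact (hF i _ ih).2
  refine ⟨fun i => (none, memStk (ms i)), by dsimp only; rw [hms₀], fun i => ?_⟩
  dsimp only
  rw [hms]
  exact (hF i _ (hinv i)).1

end GameProg

/-! ### The complexity bounds -/

theorem GameProg.bound_of_sum (n₁ n₂ a b k : ℕ) :
    GameProg.Bound n₁ n₂ a b k ((n₁ + n₂ + k + a + b) ^ 2 + (n₁ + n₂ + k + a + b) + 10) := by
  unfold Bound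
  nlinarith [Nat.zero_le (n₁ * n₂), Nat.zero_le (n₁ * a), Nat.zero_le (n₁ * b),
    Nat.zero_le (n₁ * k), Nat.zero_le (n₂ * a), Nat.zero_le (n₂ * b), Nat.zero_le (n₂ * k),
    Nat.zero_le (a * b), Nat.zero_le (a * k), Nat.zero_le (b * k)]

theorem two_mul_hypotheses_le (n₁ n₂ a b k : ℕ) : 2 * (k ^ (k * b) * a ^ k * k * (n₂ * k)) + 1 ≤
    (2 * (n₁ + n₂) + 1) * 2 ^ ((k + a + b) ^ 3 + (k + a + b) ^ 2 + 2 * (k + a + b)) := by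
  set K := k + a + b with hK
  have hle : ∀ x ≤ K, x ≤ 2 ^ K := fun x hx => hx.trans Nat.lt_two_pow_self.le
  have h1 : k ^ (k * b) ≤ 2 ^ K ^ 3 := calc
    k ^ (k * b) ≤ (2 ^ K) ^ (k * b) := Nat.pow_le_pow_left (hle k (by omega)) _
    _ = 2 ^ (K * (k * b)) := (pow_mul _ _ _).symm
    _ ≤ 2 ^ (K * (K * K)) :=
      Nat.pow_le_pow_right two_pos (Nat.mul_le_mul_left _ (Nat.mul_le_mul (by omega) (by omega)))
    _ = 2 ^ K ^ 3 := by ring_nf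
  have h2 : a ^ k ≤ 2 ^ K ^ 2 := calc
    a ^ k ≤ (2 ^ K) ^ k := Nat.pow_le_pow_left (hle a (by omega)) _
    _ = 2 ^ (K * k) := (pow_mul _ _ _).symm
    _ ≤ 2 ^ (K * K) := Nat.pow_le_pow_right two_pos (Nat.mul_le_mul_left _ (by omega))
    _ = 2 ^ K ^ 2 := by ring_nf
  have h3 : k * k ≤ 2 ^ (2 * K) := by
    rw [two_mul, pow_add]
    exact Nat.mul_le_mul (hle k (by omega)) (hle k (by omega))
  have h4 : k ^ (k * b) * a ^ k * (k * k) ≤ 2 ^ (K ^ 3 + K ^ 2 + 2 * K) := by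
    rw [pow_add, pow_add]
    exact Nat.mul_le_mul (Nat.mul_le_mul h1 h2) h3
  calc 2 * (k ^ (k * b) * a ^ k * k * (n₂ * k)) + 1
      = 2 * n₂ * (k ^ (k * b) * a ^ k * (k * k)) + 1 := by ring
    _ ≤ 2 * n₂ * 2 ^ (K ^ 3 + K ^ 2 + 2 * K) + 2 ^ (K ^ 3 + K ^ 2 + 2 * K) :=
      Nat.add_le_add (Nat.mul_le_mul_left _ h4) (Nat.one_le_two_pow)
    _ = (2 * n₂ + 1) * 2 ^ (K ^ 3 + K ^ 2 + 2 * K) := by ring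
    _ ≤ _ := Nat.mul_le_mul_right _ (by omega)

open GameProg in
/-- For each kind of game there are one online Turing machine and polynomials `p, q, r` such that,
on every `k`-transducer live game, the machine (given the game and `k`) runs within polynomial
space a strategy of player 2 that wins against all `k`-transducers and, in reachability games,
visits a final vertex after at most `q(n) * 2 ^ r(k + |Σ| + |Γ|)` moves. -/
theorem mainTheorem4 (o : Objective) :
    ∃ (M : OnlineTM) (p q r : Polynomial ℕ),
      ∀ (n₁ n₂ a b k : ℕ) (G : Game (Fin n₁) (Fin n₂) (Fin a) (Fin b)),
        0 < k → G.HasKind o → G.IsTransducerLive o k →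
        ∃ f : Strategy₂ (Fin a) (Fin b),
          G.IsWinningStrategy o k f ∧
          M.RunsStrategy (p.eval (n₁ + n₂ + k + a + b)) (G.code k) f ∧
          (o = Objective.reachability →
            ∀ (T : KTransducer (Fin a) (Fin b) k) (w : ℕ → Fin a × Fin b),
              T.Agrees w → f.Agrees w →
              ∃ j ≤ q.eval (n₁ + n₂) * 2 ^ r.eval (k + a + b),
                G.color (G.vertex w j) = 2) := by
  obtain ⟨p, hp⟩ := StackProg.exists_polynomial_roundSpace (round o) output
  refine ⟨machine o, p.comp (.X ^ 2 + .X + 10), 2 * .X + 1, .X ^ 3 + .X ^ 2 + 2 * .X, ?_⟩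
  intro n₁ n₂ a b k G hk hG hlive
  have : NeZero k := ⟨hk.ne'⟩
  have hB := bound_of_sum n₁ n₂ a b k
  have hs : (p.comp (.X ^ 2 + .X + 10)).eval (n₁ + n₂ + k + a + b) =
      machineSpace o ((n₁ + n₂ + k + a + b) ^ 2 + (n₁ + n₂ + k + a + b) + 10) := by
    rw [Polynomial.eval_comp, machineSpace, ← hp]
    simp
  rw [hs]
  rcases Nat.eq_zero_or_pos a with rfl | ha
  · -- player 1 has no action, and hence there is neither a transducer nor a play
    obtain ⟨m₀, h₀, -⟩ := reads_code (o := o) (G := G) hB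
    exact ⟨fun _ x => x.elim0, fun T => (T.label 0).elim0, ⟨_, h₀, fun w => (w 0).1.elim0⟩,
      fun _ T => (T.label 0).elim0⟩
  · have hb : 0 < b := by
      obtain ⟨β, -⟩ := hlive [] ⟨⟨0, fun _ _ => 0, fun _ => ⟨0, ha⟩⟩, fun i hi => by simp at hi⟩
      exact Fin.pos (β 0).2
    refine ⟨(digitHyps n₂ a b k ha hb (Nat.pos_of_neZero k)).strategy G o ⟨0, hb⟩,
      Hyps.isWinningStrategy _ hG hlive, runsStrategy hG hB, ?_⟩
    rintro rfl T w hT hw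
    obtain ⟨-, j, hj, hc⟩ := Hyps.visited_of_reachability _ (P := n₂ * k) (by simp) hw hG hlive hT
    refine ⟨j, hj.trans ?_, hc⟩
    simpa [digitHyps] using two_mul_hypotheses_le n₁ n₂ a b k
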